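/- A \emph{finite polygon} in $\mathbb{E}^3$ consists of $n\ge 3$ distinct points $v_1,\dots,v_n$ together with the line segments $(v_i,v_{i+1})$ for $i<n$ and $(v_n,v_1)$. An \emph{infinite polygon} consists of distinct points $v_i$ $(i\in\mathbb{Z})$ and the line segments $(v_i,v_{i+1})$, such that each compact set meets only finitely many of these segments. A \emph{polygonal complex} $\mathcal{K}$ in $\mathbb{E}^3$ consists of a set of points (vertices), a set of line segments joining vertices (edges) and a set of polygons (faces) whose edges are edges of $\mathcal{K}$, such that: the edge graph is connected (and nonempty); for each vertex $v$ the vertex-figure at $v$ (the graph on the neighbors of $v$ in which $u,w$ are joined whenever $(u,v)$ and $(v,w)$ are edges of a common face) is connected (and nonempty); each edge lies in exactly $r$ faces, for a fixed $r\ge 2$; and each compact set meets only finitely many faces. $\mathcal{K}$ is a \emph{polyhedron} if $r=2$. A \emph{flag} is a triple of mutually incident vertex, edge and face, and $G(\mathcal{K})$ is the group of all isometries of the affine hull of $\mathcal{K}$ that map $\mathcal{K}$ to itself. (If the affine hull is a proper subspace, each of its isometries is identified with its extension to $\mathbb{E}^3$ that acts as the identity on the directions orthogonal to the hull; dimensions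 of fixed point sets are taken in $\mathbb{E}^3$.) $\mathcal{K}$ is a \emph{simply flag-transitive regular} complex if $G(\mathcal{K})$ is simply transitive on the flags. For a flag $\{F_0,F_1,F_2\}$ (vertex, edge, face) let $G_i$ be the stabilizer in $G(\mathcal{K})$ of the two elements $F_j$, $j\neq i$. $\mathcal{K}$ has \emph{mirror vector} $(1,2)$ if $G_0=\langle R_0\rangle$ and $G_1=\langle R_1\rangle$, where the fixed point sets of $R_0$ and $R_1$ have dimension $1$ and $2$, respectively. For a real number $a\neq 0$ and $i=1,\dots,8$ let $R_0,R_1$ and the generators of $G_2$ be the following isometries, where a triple stands for the map taking $(x,y,z)$ to it: \[ \begin{array}{c|l|l|l} i & R_0 & R_1 & \text{generators of } G_2\\ \hline 1 & (-x,y,-z)+(a,0,a) & (y,x,z) & (z,y,x),\ (x,-y,z)\\ 2 & (y,x,-z)+(a,-a,a) & (x,-y,z) & (-y,-z,x)\\ 3 & (y,x,-z)+(a,-a,a) & (x,-y,z) & (-y,-x,z),\ (x,-z,-y)\\ 4 & (-z,-y,-x)+(0,a,0) & (y,x,z) & (-z,y,-x),\ (z,y,x)\\ 5 & (-z,-y,-x)+(0,a,0)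 & (y,x,z) & (-x,y,z),\ (x,y,-z)\\ 6 & (-z,-y,-x)+(0,a,0) & (y,x,z) & (-z,y,-x),\ (-x,y,z)\\ 7 & (-z,-y,-x)+(a,-a,a) & (y,x,z) & (-y,-x,z),\ (x,-z,-y)\\ 8 & (-z,-y,-x)+(a,0,a) & (y,x,z) & (x,-y,z),\ (z,y,x) \end{array} \] Let $\mathcal{K}_i(1,2)$ (with parameter $a$) be the figure obtained from them by Wythoff's construction with initial vertex the origin $o$: the base vertex is $F_0=o$, the base edge $F_1$ joins $o$ to its image under $R_0$, the edges of the base face $F_2$ are the images of $F_1$ under $\langle R_0,R_1\rangle$, and the vertices, edges and faces of $\mathcal{K}_i(1,2)$ are the images of $F_0$, $F_1$, $F_2$ under $\langle R_0,R_1,G_2\rangle$. \textbf{Theorem.} \begin{enumerate} \item For each $i$ and each $a\ne0$, $\mathcal{K}_i(1,2)$ is a simply flag-transitive regular polygonal complex with finite faces and mirror vector $(1,2)$, and it is not a polyhedron. Its full symmetry group is $\langle R_0,R_1,G_2\rangle$; with respect to the base flag $\{F_0,F_1,F_2\}$ its distinguished stabilizers $G_0$, $G_1$, $G_2$ are $\langle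 R_0\rangle$, $\langle R_1\rangle$ and the group generated by the isometries in the last column. The special group of its symmetry group (the group of linear parts) is the octahedral group $[3,4]$, the symmetry group of the cube with vertices $(\pm1,\pm1,\pm1)$. \item For $i\neq j$ the complexes $\mathcal{K}_i(1,2)$ and $\mathcal{K}_j(1,2)$ are not similar, for any choices of their parameters. \item Let $a\neq0$. Every simply flag-transitive regular polygonal complex in $\mathbb{E}^3$ with finite faces and mirror vector $(1,2)$ that is not a polyhedron is similar to $\mathcal{K}_i(1,2)$ with parameter $a$, for some $i\in\{1,\dots,8\}$. \end{enumerate} -/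

import Mathlib

/-- Euclidean 3-space. -/
abbrev E3 : Type := EuclideanSpace ℝ (Fin 3)

/-- The group of all isometries of Euclidean 3-space. -/
abbrev Isom3 : Type := E3 ≃ᵃⁱ[ℝ] E3

/-! ### Polygons

A line segment is recorded by the unordered pair of its end points, and a polygon by the set of its
edges (a polygon with at least three vertices is determined by its edges). -/

/-- The edge set of an `n`-gon with distinct vertices `v 0, …, v (n - 1)`, for some `n ≥ 3`. -/
def IsFinitePolygon (P : Set (Sym2 E3)) : Prop :=
  ∃ n : ℕ, 3 ≤ n ∧ ∃ v : ZMod n → E3, Function.Injective v ∧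
    P = Set.range fun i => s(v i, v (i + 1))

/-- The edge set of an infinite polygon `(…, v (-1), v 0, v 1, …)` with distinct vertices, such that
each compact set meets only finitely many of its line segments. -/
def IsInfinitePolygon (P : Set (Sym2 E3)) : Prop :=
  ∃ v : ℤ → E3, Function.Injective v ∧
    (∀ C : Set E3, IsCompact C → {i : ℤ | (segment ℝ (v i) (v (i + 1)) ∩ C).Nonempty}.Finite) ∧
    P = Set.range fun i => s(v i, v (i + 1))

/-- The point set covered by the line segments in `P`. -/
def polygonCarrier (P : Set (Sym2 E3)) : Set E3 :=
  {x | ∃ u w : E3, s(u, w) ∈ P ∧ x ∈ segment ℝ u w}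

/-! ### Polygonal complexes -/

/-- Vertices, edges and faces in Euclidean 3-space; each face is given by the set of its edges.
The axioms of a polygonal complex are stated in `PolygonalFigure.IsComplexWith`. -/
@[ext]
structure PolygonalFigure where
  verts : Set E3
  edges : Set (Sym2 E3)
  faces : Set (Set (Sym2 E3))

namespace PolygonalFigure

/-- The image of a figure under a map of the space. -/
def map (f : E3 → E3) (K : PolygonalFigure) : PolygonalFigure where
  verts := f '' K.verts
  edges := Sym2.map f '' K.edges
  faces := (fun P => Sym2.map f '' P) '' K.faces

theorem map_id (K : PolygonalFigure) : K.map id = K := by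
  simp [map]

theorem map_map (K : PolygonalFigure) (f g : E3 → E3) : (K.map f).map g = K.map (g ∘ f) := by
  simp [map, Set.image_image, Sym2.map_map]

/-- The edge graph. -/
def edgeGraph (K : PolygonalFigure) : SimpleGraph K.verts where
  Adj u w := u ≠ w ∧ s((u : E3), (w : E3)) ∈ K.edges
  symm := ⟨fun u w h => ⟨h.1.symm, by rw [Sym2.eq_swap]; exact h.2⟩⟩
  loopless := ⟨fun _ h => h.1 rfl⟩

/-- The neighbors of `v` in the edge graph. -/
def nbrs (K : PolygonalFigure) (v : E3) : Set E3 :=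
  {u | u ≠ v ∧ s(u, v) ∈ K.edges}

/-- The vertex-figure at `v` (edge multiplicities do not matter for its connectedness): the vertices
are the neighbors of `v`, and `u`, `w` are joined if `(u, v)` and `(v, w)` are edges of a common
face. -/
def vertexFigure (K : PolygonalFigure) (v : E3) : SimpleGraph (K.nbrs v) where
  Adj u w := u ≠ w ∧ ∃ P ∈ K.faces, s((u : E3), v) ∈ P ∧ s(v, (w : E3)) ∈ P
  symm := ⟨fun u w h => ⟨h.1.symm, by
    obtain ⟨P, hP, h1, h2⟩ := h.2
    exact ⟨P, hP, by rwa [Sym2.eq_swap], by rwa [Sym2.eq_swap]⟩⟩⟩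
  loopless := ⟨fun _ h => h.1 rfl⟩

/-- `K` is a polygonal complex with exactly `r` faces around each edge. (`SimpleGraph.Connected`
includes that the graph is nonempty.) -/
structure IsComplexWith (K : PolygonalFigure) (r : ℕ) : Prop where
  edge_verts : ∀ e ∈ K.edges, ∀ v ∈ e, v ∈ K.verts
  face_polygon : ∀ P ∈ K.faces, IsFinitePolygon P ∨ IsInfinitePolygon P
  face_edges : ∀ P ∈ K.faces, P ⊆ K.edges
  connected : K.edgeGraph.Connected
  vertexFigure_connected : ∀ v ∈ K.verts, (K.vertexFigure v).Connected
  two_le : 2 ≤ r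
  faces_at_edge : ∀ e ∈ K.edges, {P ∈ K.faces | e ∈ P}.ncard = r
  discrete : ∀ C : Set E3, IsCompact C → {P ∈ K.faces | (polygonCarrier P ∩ C).Nonempty}.Finite

/-- `K` is a polygonal complex. -/
def IsComplex (K : PolygonalFigure) : Prop := ∃ r, K.IsComplexWith r

/-- `K` is a (geometric) polyhedron: a polygonal complex with two faces around each edge. -/
def IsPolyhedron (K : PolygonalFigure) : Prop := K.IsComplexWith 2

/-- All faces are finite polygons. -/
def HasFiniteFaces (K : PolygonalFigure) : Prop := ∀ P ∈ K.faces, IsFinitePolygon P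

/-- The flags: mutually incident triples of a vertex, an edge and a face. -/
def flags (K : PolygonalFigure) : Set (E3 × Sym2 E3 × Set (Sym2 E3)) :=
  {Φ | Φ.1 ∈ K.verts ∧ Φ.2.1 ∈ K.edges ∧ Φ.2.2 ∈ K.faces ∧ Φ.1 ∈ Φ.2.1 ∧ Φ.2.1 ∈ Φ.2.2}

end PolygonalFigure

/-- The image of a flag under an isometry. -/
noncomputable def flagImage (g : Isom3) (Φ : E3 × Sym2 E3 × Set (Sym2 E3)) : E3 × Sym2 E3 × Set (Sym2 E3) :=
  (g Φ.1, Sym2.map g Φ.2.1, Sym2.map g '' Φ.2.2)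

/-! ### Stabilizers and symmetry groups -/

/-- The isometries fixing the point `v`. -/
def pointStab (v : E3) : Subgroup Isom3 where
  carrier := {g | g v = v}
  one_mem' := rfl
  mul_mem' := fun {g h} hg hh => by
    simp only [Set.mem_ofPred_eq, AffineIsometryEquiv.coe_mul, Function.comp_apply] at *
    rw [hh, hg]
  inv_mem' := fun {g} hg => by
    have hg' : g v = v := hg
    change g.symm v = v
    rw [AffineIsometryEquiv.symm_apply_eq, hg']

/-- The isometries mapping the line segment `e` to itself. -/
def edgeStab (e : Sym2 E3) : Subgroup Isom3 where
  carrier := {g | Sym2.map g e = e}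
  one_mem' := by simp
  mul_mem' := fun {g h} hg hh => by
    simp only [Set.mem_ofPred_eq, AffineIsometryEquiv.coe_mul] at *
    rw [← Sym2.map_map, hh, hg]
  inv_mem' := fun {g} hg => by
    have hg' : Sym2.map g e = e := hg
    change Sym2.map (g⁻¹ : Isom3) e = e
    conv_lhs => rw [← hg']
    rw [Sym2.map_map, ← AffineIsometryEquiv.coe_mul]
    simp

/-- The isometries mapping the polygon `P` to itself. -/
def polygonStab (P : Set (Sym2 E3)) : Subgroup Isom3 where
  carrier := {g | Sym2.map g '' P = P}
  one_mem' := by simp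
  mul_mem' := fun {g h} hg hh => by
    simp only [Set.mem_ofPred_eq, AffineIsometryEquiv.coe_mul] at *
    rw [Sym2.map_comp, Set.image_comp, hh, hg]
  inv_mem' := fun {g} hg => by
    have hg' : Sym2.map g '' P = P := hg
    change Sym2.map (g⁻¹ : Isom3) '' P = P
    conv_lhs => rw [← hg']
    rw [← Set.image_comp, ← Sym2.map_comp, ← AffineIsometryEquiv.coe_mul]
    simp

namespace PolygonalFigure

/-- The symmetry group `G(K)`: the isometries of the affine hull of `K` that map `K` to itself. An
isometry of the affine hull is represented by its unique extension to an isometry of the whole space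
whose linear part is the identity on the orthogonal complement of the direction of the hull; if the
hull is the whole space, this condition is void. -/
def symmetryGroup (K : PolygonalFigure) : Subgroup Isom3 where
  carrier := {g | K.map g = K ∧
    ∀ w ∈ (affineSpan ℝ K.verts).directionᗮ, g.linearIsometryEquiv w = w}
  one_mem' := ⟨K.map_id, fun _ _ => rfl⟩
  mul_mem' := fun {g h} hg hh => by
    refine ⟨?_, fun w hw => ?_⟩
    · rw [AffineIsometryEquiv.coe_mul, ← map_map, hh.1, hg.1]
    · change g.linearIsometryEquiv (h.linearIsometryEquiv w) = w
      rw [hh.2 w hw, hg.2 w hw]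
  inv_mem' := fun {g} hg => by
    refine ⟨?_, fun w hw => ?_⟩
    · conv_lhs => rw [← hg.1]
      rw [map_map, ← AffineIsometryEquiv.coe_mul, inv_mul_cancel]
      exact K.map_id
    · change g.linearIsometryEquiv.symm w = w
      rw [LinearIsometryEquiv.symm_apply_eq, hg.2 w hw]

/-- `K` is a simply flag-transitive regular polygonal complex: its full symmetry group is simply
transitive on the flags. -/
def IsSimplyFlagTransitive (K : PolygonalFigure) : Prop :=
  K.IsComplex ∧ ∀ Φ ∈ K.flags, ∀ Ψ ∈ K.flags, ∃! g : Isom3, g ∈ K.symmetryGroup ∧ flagImage g Φ = Ψ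

/-- `G₀`: the stabilizer in `G(K)` of the edge and the face of the flag `Φ`. -/
noncomputable def G0 (K : PolygonalFigure) (Φ : E3 × Sym2 E3 × Set (Sym2 E3)) : Subgroup Isom3 :=
  K.symmetryGroup ⊓ edgeStab Φ.2.1 ⊓ polygonStab Φ.2.2

/-- `G₁`: the stabilizer in `G(K)` of the vertex and the face of the flag `Φ`. -/
noncomputable def G1 (K : PolygonalFigure) (Φ : E3 × Sym2 E3 × Set (Sym2 E3)) : Subgroup Isom3 :=
  K.symmetryGroup ⊓ pointStab Φ.1 ⊓ polygonStab Φ.2.2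

/-- `G₂`: the stabilizer in `G(K)` of the vertex and the edge of the flag `Φ`. -/
noncomputable def G2 (K : PolygonalFigure) (Φ : E3 × Sym2 E3 × Set (Sym2 E3)) : Subgroup Isom3 :=
  K.symmetryGroup ⊓ pointStab Φ.1 ⊓ edgeStab Φ.2.1

end PolygonalFigure

/-- The mirror (fixed point set) of `g` is a nonempty affine subspace of dimension `d`. -/
def HasMirrorDim (g : Isom3) (d : ℕ) : Prop :=
  ∃ M : AffineSubspace ℝ E3, (M : Set E3) = {x | g x = x} ∧ (M : Set E3).Nonempty ∧
    Module.finrank ℝ M.direction = d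

namespace PolygonalFigure

/-- `K` has mirror vector `(j, k)`: with respect to a base flag, `G₀ = ⟨R₀⟩` and `G₁ = ⟨R₁⟩`, where
the mirrors of `R₀` and `R₁` have dimensions `j` and `k`. (For flag-transitive `K` the choice of the
base flag does not matter.) -/
def HasMirrorVector (K : PolygonalFigure) (j k : ℕ) : Prop :=
  ∃ Φ ∈ K.flags, ∃ R₀ R₁ : Isom3,
    K.G0 Φ = Subgroup.zpowers R₀ ∧ K.G1 Φ = Subgroup.zpowers R₁ ∧
    HasMirrorDim R₀ j ∧ HasMirrorDim R₁ k

/-- `K` and `L` are similar. -/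
def Similar (K L : PolygonalFigure) : Prop := ∃ f : E3 ≃ᵈ E3, K.map f = L

end PolygonalFigure

/-- The special group of `G`: the linear parts of the elements of `G`. -/
def specialGroup (G : Subgroup Isom3) : Subgroup (E3 ≃ₗᵢ[ℝ] E3) where
  carrier := {A | ∃ g ∈ G, g.linearIsometryEquiv = A}
  one_mem' := ⟨1, G.one_mem, rfl⟩
  mul_mem' := by
    rintro _ _ ⟨g, hg, rfl⟩ ⟨h, hh, rfl⟩
    exact ⟨g * h, G.mul_mem hg hh, rfl⟩
  inv_mem' := by
    rintro _ ⟨g, hg, rfl⟩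
    exact ⟨g⁻¹, G.inv_mem hg, rfl⟩

/-- The octahedral group `[3,4]`: the linear isometries preserving the vertex set
`(±1, ±1, ±1)` of the cube. -/
def octahedralGroup : Subgroup (E3 ≃ₗᵢ[ℝ] E3) where
  carrier := {A | A '' {x : E3 | ∀ i, x i = 1 ∨ x i = -1} = {x : E3 | ∀ i, x i = 1 ∨ x i = -1}}
  one_mem' := by simp
  mul_mem' := fun {A B} hA hB => by
    simp only [Set.mem_ofPred_eq, LinearIsometryEquiv.coe_mul, Set.image_comp] at *
    rw [hB, hA]
  inv_mem' := fun {A} hA => by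
    have hA' : A '' {x : E3 | ∀ i, x i = 1 ∨ x i = -1} = _ := hA
    change (A⁻¹ : E3 ≃ₗᵢ[ℝ] E3) '' {x : E3 | ∀ i, x i = 1 ∨ x i = -1} = _
    conv_lhs => rw [← hA']
    rw [← Set.image_comp, ← LinearIsometryEquiv.coe_mul]
    simp

/-! ### Wythoff's construction -/

/-- The base flag of Wythoff's construction: the base vertex `o`, the base edge joining `o` and
`R₀ o`, and the base face, whose edges are the images of the base edge under `⟨R₀, R₁⟩`. -/
noncomputable def wythoffFlag (R₀ R₁ : Isom3) (o : E3) : E3 × Sym2 E3 × Set (Sym2 E3) :=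
  (o, s(o, R₀ o),
    {e | ∃ g ∈ Subgroup.closure ({R₀, R₁} : Set Isom3), e = Sym2.map g s(o, R₀ o)})

/-- Wythoff's construction with initial vertex `o` for the group `G` generated by `R₀`, `R₁` and the
set `S`: vertices, edges and faces are the images under `G` of those of the base flag. -/
def wythoff (R₀ R₁ : Isom3) (S : Set Isom3) (o : E3) : PolygonalFigure where
  verts := {x | ∃ g ∈ Subgroup.closure ({R₀, R₁} ∪ S), x = g (wythoffFlag R₀ R₁ o).1}
  edges := {e | ∃ g ∈ Subgroup.closure ({R₀, R₁} ∪ S), e = Sym2.map g (wythoffFlag R₀ R₁ o).2.1}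
  faces := {P | ∃ g ∈ Subgroup.closure ({R₀, R₁} ∪ S), P = Sym2.map g '' (wythoffFlag R₀ R₁ o).2.2}

/-! ### The eight complexes -/

/-- The isometry `x ↦ (ε i * x (σ i) + t i)ᵢ`, see `signedPerm_apply`. -/
noncomputable def signedPerm (σ : Equiv.Perm (Fin 3)) (ε : Fin 3 → ℤˣ) (t : E3) : Isom3 :=
  (((LinearIsometryEquiv.piLpCongrLeft 2 ℝ ℝ σ.symm).trans
    (LinearIsometryEquiv.piLpCongrRight 2 fun i =>
      if ε i = 1 then LinearIsometryEquiv.refl ℝ ℝ else LinearIsometryEquiv.neg ℝ)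
    ).toAffineIsometryEquiv).trans (AffineIsometryEquiv.constVAdd ℝ E3 t)

theorem signedPerm_apply (σ : Equiv.Perm (Fin 3)) (ε : Fin 3 → ℤˣ) (t x : E3) (i : Fin 3) :
    signedPerm σ ε t x i = ((ε i : ℤ) : ℝ) * x (σ i) + t i := by
  rcases Int.units_eq_one_or (ε i) with h | h <;>
    simp [signedPerm, h, LinearIsometryEquiv.piLpCongrLeft_apply, Equiv.piCongrLeft',
      show ((-1 : ℤˣ) = 1) = False by decide] <;> ring

/-- The half-turn `R₀` of the `i`-th complex. -/
noncomputable def genR0 (a : ℝ) : Fin 8 → Isom3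
  -- `(x, y, z) ↦ (-x, y, -z) + (a, 0, a)`
  | 0 => signedPerm 1 ![-1, 1, -1] !₂[a, 0, a]
  -- `(x, y, z) ↦ (y, x, -z) + (a, -a, a)`
  | 1 => signedPerm (Equiv.swap 0 1) ![1, 1, -1] !₂[a, -a, a]
  | 2 => signedPerm (Equiv.swap 0 1) ![1, 1, -1] !₂[a, -a, a]
  -- `(x, y, z) ↦ (-z, -y, -x) + (0, a, 0)`
  | 3 => signedPerm (Equiv.swap 0 2) ![-1, -1, -1] !₂[0, a, 0]
  | 4 => signedPerm (Equiv.swap 0 2) ![-1, -1, -1] !₂[0, a, 0]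
  | 5 => signedPerm (Equiv.swap 0 2) ![-1, -1, -1] !₂[0, a, 0]
  -- `(x, y, z) ↦ (-z, -y, -x) + (a, -a, a)`
  | 6 => signedPerm (Equiv.swap 0 2) ![-1, -1, -1] !₂[a, -a, a]
  -- `(x, y, z) ↦ (-z, -y, -x) + (a, 0, a)`
  | 7 => signedPerm (Equiv.swap 0 2) ![-1, -1, -1] !₂[a, 0, a]

/-- The plane reflection `R₁` of the `i`-th complex. -/
noncomputable def genR1 : Fin 8 → Isom3
  -- `(x, y, z) ↦ (x, -y, z)`
  | 1 => signedPerm 1 ![1, -1, 1] 0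
  | 2 => signedPerm 1 ![1, -1, 1] 0
  -- `(x, y, z) ↦ (y, x, z)`
  | _ => signedPerm (Equiv.swap 0 1) ![1, 1, 1] 0

/-- The generators of the group `G₂` of the `i`-th complex. -/
noncomputable def genG2 : Fin 8 → Set Isom3
  -- `(z, y, x)` and `(x, -y, z)`
  | 0 => {signedPerm (Equiv.swap 0 2) ![1, 1, 1] 0, signedPerm 1 ![1, -1, 1] 0}
  -- `(-y, -z, x)`
  | 1 => {signedPerm (finRotate 3) ![-1, -1, 1] 0}
  -- `(-y, -x, z)` and `(x, -z, -y)`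
  | 2 => {signedPerm (Equiv.swap 0 1) ![-1, -1, 1] 0, signedPerm (Equiv.swap 1 2) ![1, -1, -1] 0}
  -- `(-z, y, -x)` and `(z, y, x)`
  | 3 => {signedPerm (Equiv.swap 0 2) ![-1, 1, -1] 0, signedPerm (Equiv.swap 0 2) ![1, 1, 1] 0}
  -- `(-x, y, z)` and `(x, y, -z)`
  | 4 => {signedPerm 1 ![-1, 1, 1] 0, signedPerm 1 ![1, 1, -1] 0}
  -- `(-z, y, -x)` and `(-x, y, z)`
  | 5 => {signedPerm (Equiv.swap 0 2) ![-1, 1, -1] 0, signedPerm 1 ![-1, 1, 1] 0}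
  -- `(-y, -x, z)` and `(x, -z, -y)`
  | 6 => {signedPerm (Equiv.swap 0 1) ![-1, -1, 1] 0, signedPerm (Equiv.swap 1 2) ![1, -1, -1] 0}
  -- `(x, -y, z)` and `(z, y, x)`
  | 7 => {signedPerm 1 ![1, -1, 1] 0, signedPerm (Equiv.swap 0 2) ![1, 1, 1] 0}

/-- The complex `K_{i+1}(1,2)` with scale parameter `a`, obtained by Wythoff's construction from its
generators, with initial vertex the origin. -/
noncomputable def complexK12 (i : Fin 8) (a : ℝ) : PolygonalFigure :=
  wythoff (genR0 a i) (genR1 i) (genG2 i) 0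

/-- The base flag of `complexK12 i a`. -/
noncomputable def baseFlagK12 (i : Fin 8) (a : ℝ) : E3 × Sym2 E3 × Set (Sym2 E3) :=
  wythoffFlag (genR0 a i) (genR1 i) 0

/-! Three arguments carry the theorem: a criterion under which Wythoff's construction yields a
simply flag-transitive complex, three counts that tell the complexes apart, and an arithmetic
classification of the possible generators.

Existence. `WythoffData` asks for the vertices of the base face as a list over `ZMod n` on which
`R₀` and `R₁` act as `j ↦ 1 - j` and `j ↦ -j`, for the expected stabilizers of the base vertex and
the base edge, for a spanning base face and a locally finite vertex orbit. An isometry fixing the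
base flag then fixes the base face vertex by vertex, hence is 1; the axioms of a complex follow from
orbits and cosets. No symmetry lies outside the generated group, because that group is already
transitive on the flags. For the eight complexes every group element has a signed permutation as
linear part and a translation part in `a • ℤ³`. A relation `K12.inv` between the linear part and the
translation part modulo 2 is preserved by the generators and cuts out the vertex stabilizer; the
rest is a finite computation.

Non-similarity. The numbers of faces at an edge, of edges at a vertex and of edges of a face
together separate the eight complexes.

Classification. A regular complex is Wythoff's construction applied to its own `R₀`, `R₁`, `G₂`
(`FlagData.eq_wythoff`). Its symmetry group is discrete, infinite and irreducible; irreducibility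
uses that `G₂` has at least two nontrivial elements, so that it fixes only directions along the base
edge. Bieberbach's commutator argument gives a lattice of translations spanning the space, so all
linear parts have integral trace (`trace_linear_int`). Take an orthonormal frame with `b 2` along
the edge and `s • b 0 + c • b 2` normal to the mirror of `R₁`; let `R₀` take `b 0` to `x • b 0 + y •
b 1`, and an element of `G₂` take `b 0` to `C • b 0 + S • b 1`. Then `2s²(1 - C)` and `2s²(1 + Cx +
Sy)` are integers, as are `2C` for rotations and `2(Cx + Sy)` for reflections.

Two more facts enter. First, `x ≠ -1`, as otherwise `(R₀R₁)²` is a translation preserving a finite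
face. Second, if `y = 0` then `G₂` is not closed under `S ↦ -S`, as otherwise the reflection in the
plane of `b 0` and `b 2` is a symmetry fixing the base flag. What remains is `s² ∈ {1/2, 3/4, 1/3,
2/3}`, and in each case `x` and `G₂` have few possibilities, eight altogether up to the sign of `y`.
A similarity matching the frames conjugates the generators to those of the model
(`FlagFrame.similar`, `wythoff_map`). -/

open Subgroup

/-! ### Isometries acting on segments and polygons -/

theorem isom_mul_apply (g h : Isom3) (x : E3) : (g * h) x = g (h x) := rfl

theorem isom_inv_apply_self (g : Isom3) (x : E3) : g⁻¹ (g x) = x := by simp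

theorem isom_apply_inv_self (g : Isom3) (x : E3) : g (g⁻¹ x) = x := by simp

theorem edge_map_mul (g h : Isom3) (e : Sym2 E3) :
    Sym2.map (g * h : Isom3) e = Sym2.map g (Sym2.map h e) := by
  rw [AffineIsometryEquiv.coe_mul, Sym2.map_comp]; rfl

theorem edge_map_one (e : Sym2 E3) : Sym2.map (1 : Isom3) e = e := by simp

theorem edge_map_inv_self (g : Isom3) (e : Sym2 E3) :
    Sym2.map (g⁻¹ : Isom3) (Sym2.map g e) = e := by
  rw [← edge_map_mul, inv_mul_cancel, edge_map_one]

theorem edge_map_self_inv (g : Isom3) (e : Sym2 E3) :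
    Sym2.map g (Sym2.map (g⁻¹ : Isom3) e) = e := by
  rw [← edge_map_mul, mul_inv_cancel, edge_map_one]

theorem face_map_mul (g h : Isom3) (P : Set (Sym2 E3)) :
    Sym2.map (g * h : Isom3) '' P = Sym2.map g '' (Sym2.map h '' P) := by
  rw [Set.image_image]; exact Set.image_congr fun e _ => edge_map_mul g h e

theorem face_map_one (P : Set (Sym2 E3)) : Sym2.map (1 : Isom3) '' P = P := by simp

theorem face_map_inv_self (g : Isom3) (P : Set (Sym2 E3)) :
    Sym2.map (g⁻¹ : Isom3) '' (Sym2.map g '' P) = P := by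
  rw [← face_map_mul, inv_mul_cancel, face_map_one]

theorem mem_face_map (g : Isom3) (e : Sym2 E3) (P : Set (Sym2 E3)) :
    e ∈ Sym2.map g '' P ↔ Sym2.map (g⁻¹ : Isom3) e ∈ P := by
  constructor
  · rintro ⟨e', h, rfl⟩; rwa [edge_map_inv_self]
  · intro h; exact ⟨_, h, edge_map_self_inv g e⟩

theorem flagImage_mul (g h : Isom3) (Φ : E3 × Sym2 E3 × Set (Sym2 E3)) :
    flagImage (g * h) Φ = flagImage g (flagImage h Φ) := by
  simp only [flagImage, edge_map_mul, isom_mul_apply, Set.image_image]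

theorem flagImage_one (Φ : E3 × Sym2 E3 × Set (Sym2 E3)) : flagImage 1 Φ = Φ := by
  simp [flagImage]

theorem mem_edge_map (g : Isom3) (x : E3) (e : Sym2 E3) : g x ∈ Sym2.map g e ↔ x ∈ e := by
  induction e with | _ a b => simp

/-- An isometry of the space fixing an affinely spanning set pointwise is the identity. -/
theorem isom_eq_one_of_span {s : Set E3} (hs : affineSpan ℝ s = ⊤) {g : Isom3}
    (h : ∀ x ∈ s, g x = x) : g = 1 := by
  have : (g.toAffineEquiv : E3 →ᵃ[ℝ] E3) = AffineMap.id ℝ E3 := AffineMap.ext_on hs h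
  ext1 x
  exact DFunLike.congr_fun this x

/-! ### Edges of a finite polygon -/

theorem two_ne_zero_zmod {n : ℕ} (hn : 3 ≤ n) : (2 : ZMod n) ≠ 0 := by
  intro h
  have : ((2 : ℕ) : ZMod n) = 0 := by exact_mod_cast h
  rw [ZMod.natCast_eq_zero_iff] at this
  exact absurd (Nat.le_of_dvd (by norm_num) this) (by omega)

theorem one_ne_zero_zmod {n : ℕ} (hn : 3 ≤ n) : (1 : ZMod n) ≠ 0 := by
  intro h
  have : ((1 : ℕ) : ZMod n) = 0 := by exact_mod_cast h
  rw [ZMod.natCast_eq_zero_iff] at this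
  exact absurd (Nat.le_of_dvd (by norm_num) this) (by omega)

section Polygon

variable {n : ℕ} {v : ZMod n → E3}

theorem polygon_mem_edge (hv : Function.Injective v) (i j : ZMod n) :
    v j ∈ s(v i, v (i + 1)) ↔ j = i ∨ j = i + 1 := by
  simp [hv.eq_iff]

/-- Two edges with the same end points in opposite order would give `2 = 0` in `ZMod n`, which `3 ≤
n` excludes. -/
theorem polygon_edge_injective (hn : 3 ≤ n) (hv : Function.Injective v) :
    Function.Injective fun i => s(v i, v (i + 1)) := by
  intro i j h
  rcases Sym2.eq_iff.1 h with ⟨h, -⟩ | ⟨h1, h2⟩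
  · exact hv h
  · have h1 := hv h1
    have h2 := hv h2
    exact absurd (by linear_combination h2 - h1 : (2 : ZMod n) = 0) (two_ne_zero_zmod hn)

theorem polygon_edge_ne (hn : 3 ≤ n) (hv : Function.Injective v) (i : ZMod n) :
    v i ≠ v (i + 1) := by
  intro h
  exact one_ne_zero_zmod hn (by linear_combination -(hv h))

theorem zmod_induction [NeZero n] {p : ZMod n → Prop} (k : ZMod n) (h0 : p k)
    (h : ∀ i, p i → p (i + 1)) (j : ZMod n) : p j := by
  have key : ∀ m : ℕ, p (k + m) := by
    intro m
    induction m with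
    | zero => simpa using h0
    | succ m ih => simpa [add_assoc] using h _ ih
  simpa using key (j - k).val

/-- Walk around the polygon: once two consecutive vertices are fixed, the next edge goes to an edge
through the second of them, and injectivity keeps it from turning back. -/
theorem polygon_eq_one_of_flag_fixed (hn : 3 ≤ n) (hv : Function.Injective v) {g : Isom3}
    (h0 : g (v 0) = v 0) (h1 : g (v 1) = v 1)
    (h : ∀ i, ∃ j, Sym2.map g s(v i, v (i + 1)) = s(v j, v (j + 1))) (j : ZMod n) :
    g (v j) = v j := by
  have : NeZero n := ⟨by omega⟩
  refine (zmod_induction (p := fun j => g (v j) = v j ∧ g (v (j + 1)) = v (j + 1)) 0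
    ⟨h0, by simpa using h1⟩ ?_ j).1
  rintro i ⟨hi, hi'⟩
  refine ⟨hi', ?_⟩
  obtain ⟨j, hj⟩ := h (i + 1)
  rw [Sym2.map_mk, hi'] at hj
  have hmem : v (i + 1) ∈ s(v j, v (j + 1)) := hj ▸ Sym2.mem_mk_left _ _
  rcases (polygon_mem_edge hv j (i + 1)).1 hmem with rfl | h'
  · exact Sym2.congr_right.1 hj
  · have hij : i = j := by linear_combination h'
    subst hij
    rw [Sym2.eq_swap, Sym2.congr_left] at hj
    have := g.injective (hj.trans hi.symm)
    have := hv this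
    exact absurd (by linear_combination this : (2 : ZMod n) = 0) (two_ne_zero_zmod hn)

end Polygon

/-! ### Conjugation of Wythoff's construction -/

/-- `f` carries the action of `g` to that of `h`. -/
def Intertwines (f : E3 → E3) (g h : Isom3) : Prop := ∀ x, f (g x) = h (f x)

namespace Intertwines

variable {f : E3 → E3} {g h g' h' : Isom3}

theorem one : Intertwines f 1 1 := fun _ => rfl

theorem mul (H : Intertwines f g h) (H' : Intertwines f g' h') :
    Intertwines f (g * g') (h * h') := fun x => by
  rw [isom_mul_apply, isom_mul_apply, H, H']

theorem inv (H : Intertwines f g h) : Intertwines f g⁻¹ h⁻¹ := fun x => by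
  rw [← isom_inv_apply_self h (f (g⁻¹ x)), ← H, isom_apply_inv_self]

theorem edge_map (H : Intertwines f g h) (e : Sym2 E3) :
    Sym2.map f (Sym2.map g e) = Sym2.map h (Sym2.map f e) := by
  induction e with | _ a b => simp [H a, H b]

theorem face_map (H : Intertwines f g h) (P : Set (Sym2 E3)) :
    Sym2.map f '' (Sym2.map g '' P) = Sym2.map h '' (Sym2.map f '' P) := by
  rw [Set.image_image, Set.image_image]
  exact Set.image_congr fun e _ => H.edge_map e

theorem closure_left {S T : Set Isom3} (H : ∀ g ∈ S, ∃ h ∈ closure T, Intertwines f g h) :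
    ∀ g ∈ closure S, ∃ h ∈ closure T, Intertwines f g h := by
  intro g hg
  induction hg using Subgroup.closure_induction with
  | mem x hx => exact H x hx
  | one => exact ⟨1, one_mem _, one⟩
  | mul x y _ _ hx hy =>
    obtain ⟨a, ha, ha'⟩ := hx
    obtain ⟨b, hb, hb'⟩ := hy
    exact ⟨a * b, mul_mem ha hb, ha'.mul hb'⟩
  | inv x _ hx =>
    obtain ⟨a, ha, ha'⟩ := hx
    exact ⟨a⁻¹, inv_mem ha, ha'.inv⟩

theorem closure_right {S T : Set Isom3} (H : ∀ h ∈ T, ∃ g ∈ closure S, Intertwines f g h) :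
    ∀ h ∈ closure T, ∃ g ∈ closure S, Intertwines f g h := by
  intro g hg
  induction hg using Subgroup.closure_induction with
  | mem x hx => exact H x hx
  | one => exact ⟨1, one_mem _, one⟩
  | mul x y _ _ hx hy =>
    obtain ⟨a, ha, ha'⟩ := hx
    obtain ⟨b, hb, hb'⟩ := hy
    exact ⟨a * b, mul_mem ha hb, ha'.mul hb'⟩
  | inv x _ hx =>
    obtain ⟨a, ha, ha'⟩ := hx
    exact ⟨a⁻¹, inv_mem ha, ha'.inv⟩

end Intertwines

/-- A map carrying the generators of one Wythoff construction to those of another one carries the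
first figure to the second. -/
theorem wythoff_map {f : E3 → E3} {R₀ R₁ R₀' R₁' : Isom3} {S S' : Set Isom3} {o o' : E3}
    (ho : f o = o') (h0 : Intertwines f R₀ R₀') (h1 : Intertwines f R₁ R₁')
    (hS : ∀ g ∈ S, ∃ h ∈ closure S', Intertwines f g h)
    (hS' : ∀ h ∈ S', ∃ g ∈ closure S, Intertwines f g h) :
    (wythoff R₀ R₁ S o).map f = wythoff R₀' R₁' S' o' := by
  have hG : ∀ g ∈ closure ({R₀, R₁} ∪ S), ∃ h ∈ closure ({R₀', R₁'} ∪ S'), Intertwines f g h := by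
    refine Intertwines.closure_left ?_
    rintro g ((rfl | rfl) | hg)
    · exact ⟨_, subset_closure (by simp), h0⟩
    · exact ⟨_, subset_closure (by simp), h1⟩
    · obtain ⟨h, hh, hf⟩ := hS g hg
      exact ⟨h, closure_mono Set.subset_union_right hh, hf⟩
  have hG' : ∀ h ∈ closure ({R₀', R₁'} ∪ S'), ∃ g ∈ closure ({R₀, R₁} ∪ S), Intertwines f g h := by
    refine Intertwines.closure_right ?_
    rintro g ((rfl | rfl) | hg)
    · exact ⟨_, subset_closure (by simp), h0⟩
    · exact ⟨_, subset_closure (by simp), h1⟩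
    · obtain ⟨h, hh, hf⟩ := hS' g hg
      exact ⟨h, closure_mono Set.subset_union_right hh, hf⟩
  have hF : ∀ g ∈ closure {R₀, R₁}, ∃ h ∈ closure {R₀', R₁'}, Intertwines f g h := by
    refine Intertwines.closure_left ?_
    rintro g (rfl | rfl)
    · exact ⟨_, subset_closure (by simp), h0⟩
    · exact ⟨_, subset_closure (by simp), h1⟩
  have hF' : ∀ h ∈ closure {R₀', R₁'}, ∃ g ∈ closure {R₀, R₁}, Intertwines f g h := by
    refine Intertwines.closure_right ?_
    rintro g (rfl | rfl)
    · exact ⟨_, subset_closure (by simp), h0⟩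
    · exact ⟨_, subset_closure (by simp), h1⟩
  have he : Sym2.map f s(o, R₀ o) = s(o', R₀' o') := by
    rw [Sym2.map_mk, h0, ho]
  have hP : Sym2.map f '' (wythoffFlag R₀ R₁ o).2.2 = (wythoffFlag R₀' R₁' o').2.2 := by
    ext e
    constructor
    · rintro ⟨_, ⟨g, hg, rfl⟩, rfl⟩
      obtain ⟨h, hh, hf⟩ := hF g hg
      exact ⟨h, hh, by rw [hf.edge_map, he]⟩
    · rintro ⟨h, hh, rfl⟩
      obtain ⟨g, hg, hf⟩ := hF' h hh
      exact ⟨_, ⟨g, hg, rfl⟩, by rw [hf.edge_map, he]⟩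
  refine PolygonalFigure.ext ?_ ?_ ?_
  · ext x
    constructor
    · rintro ⟨_, ⟨g, hg, rfl⟩, rfl⟩
      obtain ⟨h, hh, hf⟩ := hG g hg
      exact ⟨h, hh, by rw [hf]; exact congrArg h ho⟩
    · rintro ⟨h, hh, rfl⟩
      obtain ⟨g, hg, hf⟩ := hG' h hh
      exact ⟨_, ⟨g, hg, rfl⟩, by rw [hf]; exact congrArg h ho⟩
  · ext x
    constructor
    · rintro ⟨_, ⟨g, hg, rfl⟩, rfl⟩
      obtain ⟨h, hh, hf⟩ := hG g hg
      exact ⟨h, hh, by rw [hf.edge_map]; exact congrArg _ he⟩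
    · rintro ⟨h, hh, rfl⟩
      obtain ⟨g, hg, hf⟩ := hG' h hh
      exact ⟨_, ⟨g, hg, rfl⟩, by rw [hf.edge_map]; exact congrArg _ he⟩
  · ext x
    constructor
    · rintro ⟨_, ⟨g, hg, rfl⟩, rfl⟩
      obtain ⟨h, hh, hf⟩ := hG g hg
      exact ⟨h, hh, by dsimp only; rw [hf.face_map, hP]⟩
    · rintro ⟨h, hh, rfl⟩
      obtain ⟨g, hg, hf⟩ := hG' h hh
      exact ⟨_, ⟨g, hg, rfl⟩, by dsimp only; rw [hf.face_map, hP]⟩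

theorem flagImage_mem {K : PolygonalFigure} {g : Isom3} (hg : K.map g = K)
    {Φ : E3 × Sym2 E3 × Set (Sym2 E3)} (hΦ : Φ ∈ K.flags) : flagImage g Φ ∈ K.flags := by
  obtain ⟨h1, h2, h3, h4, h5⟩ := hΦ
  refine ⟨?_, ?_, ?_, (mem_edge_map _ _ _).2 h4, ⟨_, h5, rfl⟩⟩
  · rw [← hg]; exact ⟨_, h1, rfl⟩
  · rw [← hg]; exact ⟨_, h2, rfl⟩
  · rw [← hg]; exact ⟨_, h3, rfl⟩

theorem mem_zpowers_of_eq_one_or {R g : Isom3} (h : g = 1 ∨ g = R) : g ∈ zpowers R := by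
  rcases h with rfl | rfl
  · exact one_mem _
  · exact mem_zpowers _

/-! ### Wythoff's construction with prescribed stabilizers -/

/-- Generators for which Wythoff's construction yields a simply flag-transitive complex with finite
faces: `v` runs through the vertices of the base face. -/
structure WythoffData (R₀ R₁ : Isom3) (S : Set Isom3) {n : ℕ} (v : ZMod n → E3) : Prop where
  three_le : 3 ≤ n
  inj : Function.Injective v
  R₀_v : ∀ j, R₀ (v j) = v (1 - j)
  R₁_v : ∀ j, R₁ (v j) = v (-j)
  S_v_zero : ∀ g ∈ S, g (v 0) = v 0
  S_v_one : ∀ g ∈ S, g (v 1) = v 1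
  stab_vertex : ∀ g ∈ closure ({R₀, R₁} ∪ S), g (v 0) = v 0 → g ∈ closure ({R₁} ∪ S)
  stab_edge : ∀ g ∈ closure ({R₁} ∪ S), g (v 1) = v 1 → g ∈ closure S
  span : affineSpan ℝ (Set.range v) = ⊤
  three_le_card : 3 ≤ Nat.card (closure S)
  locallyFinite : ∀ R : ℝ, {x : E3 | (∃ g ∈ closure ({R₀, R₁} ∪ S), x = g (v 0)) ∧ ‖x‖ ≤ R}.Finite

set_option linter.unusedSectionVars false

namespace WythoffData

variable {R₀ R₁ : Isom3} {S : Set Isom3} {n : ℕ} {v : ZMod n → E3} (D : WythoffData R₀ R₁ S v)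

section
include D

theorem R₀_zero : R₀ (v 0) = v 1 := by simpa using D.R₀_v 0

theorem R₀_one : R₀ (v 1) = v 0 := by simpa using D.R₀_v 1

theorem R₁_zero : R₁ (v 0) = v 0 := by simpa using D.R₁_v 0

theorem eq_one_of_fixed {g : Isom3} (h : ∀ j, g (v j) = v j) : g = 1 :=
  isom_eq_one_of_span D.span (by rintro _ ⟨j, rfl⟩; exact h j)

theorem R₀_mul_self : R₀ * R₀ = 1 :=
  D.eq_one_of_fixed fun j => by rw [isom_mul_apply, D.R₀_v, D.R₀_v]; congr 1; ring

theorem R₁_mul_self : R₁ * R₁ = 1 :=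
  D.eq_one_of_fixed fun j => by rw [isom_mul_apply, D.R₁_v, D.R₁_v]; congr 1; ring

theorem flag_edge : (wythoffFlag R₀ R₁ (v 0)).2.1 = s(v 0, v 1) := by
  rw [← D.R₀_zero]; rfl

theorem polygon_edge_R₀ (i : ZMod n) :
    Sym2.map R₀ s(v i, v (i + 1)) = s(v (-i), v (-i + 1)) := by
  rw [Sym2.map_mk, D.R₀_v, D.R₀_v, Sym2.eq_swap]; congr 2 <;> ring_nf

theorem polygon_edge_R₁ (i : ZMod n) :
    Sym2.map R₁ s(v i, v (i + 1)) = s(v (-i - 1), v (-i - 1 + 1)) := by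
  rw [Sym2.map_mk, D.R₁_v, D.R₁_v, Sym2.eq_swap]; congr 2 <;> ring_nf

/-- `R₀` and `R₁` permute the edge indices by `i ↦ -i` and `i ↦ -i - 1`, so `R₀ * R₁` is the shift
by one: the orbit of the base edge stays inside the polygon and exhausts it. -/
theorem flag_face : (wythoffFlag R₀ R₁ (v 0)).2.2 = Set.range fun i => s(v i, v (i + 1)) := by
  have hne : NeZero n := ⟨by have := D.three_le; omega⟩
  ext e
  constructor
  · rintro ⟨g, hg, rfl⟩
    have key : ∀ g ∈ closure {R₀, R₁}, ∀ i, ∃ j,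
        Sym2.map g s(v i, v (i + 1)) = s(v j, v (j + 1)) := by
      intro g hg
      induction hg using Subgroup.closure_induction with
      | mem x hx =>
        rcases hx with rfl | rfl
        · exact fun i => ⟨_, D.polygon_edge_R₀ i⟩
        · exact fun i => ⟨_, D.polygon_edge_R₁ i⟩
      | one => exact fun i => ⟨i, edge_map_one _⟩
      | mul x y _ _ hx hy =>
        intro i
        obtain ⟨j, hj⟩ := hy i
        obtain ⟨k, hk⟩ := hx j
        exact ⟨k, by rw [edge_map_mul, hj, hk]⟩
      | inv x _ hx =>
        choose f hf using hx
        -- An injective self-map of the finite index set is onto, so the inverse isometry also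
        -- permutes the edges.
        have hinj : Function.Injective f := by
          intro i j hij
          apply polygon_edge_injective D.three_le D.inj
          apply Sym2.map.injective x.injective
          dsimp only
          rw [hf, hf, hij]
        intro i
        obtain ⟨j, rfl⟩ := Finite.surjective_of_injective hinj i
        exact ⟨j, by rw [← hf, edge_map_inv_self]⟩
    obtain ⟨j, hj⟩ := key g hg 0
    refine ⟨j, ?_⟩
    dsimp only
    rw [← hj, zero_add, D.R₀_zero]
  · rintro ⟨j, rfl⟩
    refine zmod_induction (p := fun j => s(v j, v (j + 1)) ∈ (wythoffFlag R₀ R₁ (v 0)).2.2) 0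
      ⟨1, one_mem _, by rw [zero_add, edge_map_one, D.R₀_zero]⟩ ?_ j
    rintro i ⟨g, hg, h⟩
    refine ⟨R₀ * R₁ * g, mul_mem (mul_mem (subset_closure (by simp)) (subset_closure (by simp))) hg,
      ?_⟩
    rw [edge_map_mul, ← h, edge_map_mul, D.polygon_edge_R₁, D.polygon_edge_R₀]
    congr 2 <;> ring_nf

theorem base_edge_mem_face : s(v 0, v 1) ∈ Set.range fun i => s(v i, v (i + 1)) :=
  ⟨0, by simp⟩

theorem mem_edges {e : Sym2 E3} : e ∈ (wythoff R₀ R₁ S (v 0)).edges ↔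
    ∃ g ∈ closure ({R₀, R₁} ∪ S), e = Sym2.map g s(v 0, v 1) := by
  rw [← D.flag_edge]; rfl

theorem mem_faces {P : Set (Sym2 E3)} : P ∈ (wythoff R₀ R₁ S (v 0)).faces ↔
    ∃ g ∈ closure ({R₀, R₁} ∪ S), P = Sym2.map g '' Set.range fun i => s(v i, v (i + 1)) := by
  rw [← D.flag_face]; rfl

theorem v_mem_orbit (j : ZMod n) : ∃ g ∈ closure {R₀, R₁}, v j = g (v 0) := by
  have hne : NeZero n := ⟨by have := D.three_le; omega⟩
  refine zmod_induction (p := fun j => ∃ g ∈ closure {R₀, R₁}, v j = g (v 0)) 0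
    ⟨1, one_mem _, rfl⟩ ?_ j
  rintro i ⟨g, hg, h⟩
  refine ⟨R₀ * R₁ * g, mul_mem (mul_mem (subset_closure (by simp)) (subset_closure (by simp))) hg,
      ?_⟩
  rw [isom_mul_apply, ← h, isom_mul_apply, D.R₁_v, D.R₀_v]
  congr 1; ring

theorem pair_le : closure {R₀, R₁} ≤ closure ({R₀, R₁} ∪ S) := closure_mono Set.subset_union_left

theorem R₀_mem : R₀ ∈ closure ({R₀, R₁} ∪ S) := subset_closure (by simp)

theorem R₁_mem : R₁ ∈ closure ({R₀, R₁} ∪ S) := subset_closure (by simp)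

theorem closure_S_le : closure S ≤ closure ({R₀, R₁} ∪ S) := closure_mono Set.subset_union_right

theorem stab_le : closure ({R₁} ∪ S) ≤ closure ({R₀, R₁} ∪ S) :=
  closure_mono (Set.union_subset_union_left _ (by simp))

theorem closure_S_v_zero {g : Isom3} (hg : g ∈ closure S) : g (v 0) = v 0 :=
  (closure_le (K := pointStab (v 0))).2 D.S_v_zero hg

theorem closure_S_v_one {g : Isom3} (hg : g ∈ closure S) : g (v 1) = v 1 :=
  (closure_le (K := pointStab (v 1))).2 D.S_v_one hg

theorem stab_v_zero {g : Isom3} (hg : g ∈ closure ({R₁} ∪ S)) : g (v 0) = v 0 := by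
  refine (closure_le (K := pointStab (v 0))).2 ?_ hg
  rintro x (rfl | hx)
  · exact D.R₁_zero
  · exact D.S_v_zero x hx

theorem v_mem_verts {g : Isom3} (hg : g ∈ closure ({R₀, R₁} ∪ S)) (j : ZMod n) :
    g (v j) ∈ (wythoff R₀ R₁ S (v 0)).verts := by
  obtain ⟨h, hh, e⟩ := D.v_mem_orbit j
  exact ⟨g * h, mul_mem hg (D.pair_le hh), by rw [e]; rfl⟩

theorem affineSpan_verts : affineSpan ℝ (wythoff R₀ R₁ S (v 0)).verts = ⊤ := by
  rw [eq_top_iff, ← D.span]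
  refine affineSpan_mono _ ?_
  rintro _ ⟨j, rfl⟩
  exact D.v_mem_verts (one_mem _) j

theorem v_zero_ne_one : v 0 ≠ v 1 := by
  simpa using polygon_edge_ne D.three_le D.inj 0

theorem v_neg_one_ne_one : v (-1) ≠ v 1 := by
  intro h
  have := D.inj h
  exact two_ne_zero_zmod D.three_le (by linear_combination -this)

/-- The edges through the base vertex lead to the images of `v 1` under the vertex stabilizer. -/
theorem mem_nbrs {g : Isom3} (hg : g ∈ closure ({R₀, R₁} ∪ S)) {u : E3} :
    u ∈ (wythoff R₀ R₁ S (v 0)).nbrs (g (v 0)) ↔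
      ∃ h ∈ closure ({R₁} ∪ S), u = g (h (v 1)) := by
  constructor
  · rintro ⟨-, he⟩
    obtain ⟨k, hk, he⟩ := D.mem_edges.1 he
    -- If `k` carries the base edge with the wrong orientation, `k * R₀` carries it with the right
    -- one.
    obtain ⟨k, hk, h0, h1⟩ : ∃ k ∈ closure ({R₀, R₁} ∪ S), g (v 0) = k (v 0) ∧ u = k (v 1) := by
      rw [Sym2.map_mk] at he
      rcases Sym2.eq_iff.1 he with ⟨h1, h2⟩ | ⟨h1, h2⟩
      · exact ⟨k * R₀, mul_mem hk D.R₀_mem, by rw [isom_mul_apply, D.R₀_zero, h2],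
          by rw [isom_mul_apply, D.R₀_one, h1]⟩
      · exact ⟨k, hk, h2, h1⟩
    refine ⟨g⁻¹ * k, D.stab_vertex _ (mul_mem (inv_mem hg) hk) ?_, ?_⟩
    · rw [isom_mul_apply, ← h0, isom_inv_apply_self]
    · rw [isom_mul_apply, isom_apply_inv_self, h1]
  · rintro ⟨h, hh, rfl⟩
    have h0 := D.stab_v_zero hh
    refine ⟨?_, D.mem_edges.2 ⟨g * h, mul_mem hg (D.stab_le hh), ?_⟩⟩
    · intro h'
      rw [← h0] at h'
      exact D.v_zero_ne_one (h.injective (g.injective h')).symm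
    · rw [edge_map_mul, Sym2.map_mk, Sym2.map_mk, h0, Sym2.eq_swap]

/-- Write a group element as a word. Appending a generator on the right leaves the vertex `g (v 0)`
in place, or, for `R₀`, moves it to the neighbor `g (v 1)`. -/
theorem edgeGraph_connected : (wythoff R₀ R₁ S (v 0)).edgeGraph.Connected := by
  rw [SimpleGraph.connected_iff_exists_forall_reachable]
  have hb : ∀ g ∈ closure ({R₀, R₁} ∪ S), g (v 0) ∈ (wythoff R₀ R₁ S (v 0)).verts :=
    fun g hg => D.v_mem_verts hg 0
  refine ⟨⟨v 0, hb 1 (one_mem _)⟩, ?_⟩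
  have key : ∀ g, ∀ hg : g ∈ closure ({R₀, R₁} ∪ S),
      (wythoff R₀ R₁ S (v 0)).edgeGraph.Reachable ⟨v 0, hb 1 (one_mem _)⟩ ⟨g (v 0), hb g hg⟩ := by
    have step : ∀ g, ∀ hg : g ∈ closure ({R₀, R₁} ∪ S), ∀ h, ∀ hh : h ∈ closure ({R₀, R₁} ∪ S),
        (h (v 0) = v 0 ∨ h (v 0) = v 1) →
        (wythoff R₀ R₁ S (v 0)).edgeGraph.Reachable ⟨g (v 0), hb g hg⟩
          ⟨(g * h) (v 0), hb _ (mul_mem hg hh)⟩ := by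
      rintro g hg h hh (h0 | h0)
      · have : (⟨(g * h) (v 0), hb _ (mul_mem hg hh)⟩ : (wythoff R₀ R₁ S (v 0)).verts) =
            ⟨g (v 0), hb g hg⟩ := Subtype.ext (congrArg g h0)
        rw [this]
      · refine SimpleGraph.Adj.reachable ⟨?_, ?_⟩
        · intro h'
          have h' : g (v 0) = g (h (v 0)) := congrArg Subtype.val h'
          rw [h0] at h'
          exact D.v_zero_ne_one (g.injective h')
        · exact D.mem_edges.2 ⟨g, hg, by
            change s(g (v 0), g (h (v 0))) = _
            rw [h0, Sym2.map_mk]⟩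
    intro g hg
    induction hg using Subgroup.closure_induction_right with
    | one => exact SimpleGraph.Reachable.refl _
    | mul_right x hx y hy ih =>
      refine ih.trans (step x hx y (subset_closure hy) ?_)
      rcases hy with (rfl | rfl) | hy
      · exact Or.inr D.R₀_zero
      · exact Or.inl D.R₁_zero
      · exact Or.inl (D.S_v_zero y hy)
    | mul_inv_cancel x hx y hy ih =>
      refine ih.trans (step x hx y⁻¹ (inv_mem (subset_closure hy)) ?_)
      rcases hy with (rfl | rfl) | hy
      · rw [inv_eq_of_mul_eq_one_left D.R₀_mul_self]; exact Or.inr D.R₀_zero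
      · rw [inv_eq_of_mul_eq_one_left D.R₁_mul_self]; exact Or.inl D.R₁_zero
      · exact Or.inl ((pointStab (v 0)).inv_mem (D.S_v_zero y hy))
  rintro ⟨_, g, hg, rfl⟩
  exact key g hg

/-- The word argument for the vertex stabilizer: appending a generator in `S` to `h` leaves the
neighbor `g (h (v 1))` unchanged, and appending `R₁` replaces it by `g (h (v (-1)))`, the other
neighbor in the face that is the image of the base face under `g * h`. -/
theorem vertexFigure_connected {x : E3} (hx : x ∈ (wythoff R₀ R₁ S (v 0)).verts) :
    ((wythoff R₀ R₁ S (v 0)).vertexFigure x).Connected := by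
  obtain ⟨g, hg, rfl⟩ := hx
  change ((wythoff R₀ R₁ S (v 0)).vertexFigure (g (v 0))).Connected
  rw [SimpleGraph.connected_iff_exists_forall_reachable]
  have hb : ∀ h ∈ closure ({R₁} ∪ S), g (h (v 1)) ∈ (wythoff R₀ R₁ S (v 0)).nbrs (g (v 0)) :=
    fun h hh => (D.mem_nbrs hg).2 ⟨h, hh, rfl⟩
  refine ⟨⟨g ((1 : Isom3) (v 1)), hb 1 (one_mem _)⟩, ?_⟩
  have key : ∀ h, ∀ hh : h ∈ closure ({R₁} ∪ S),
      ((wythoff R₀ R₁ S (v 0)).vertexFigure (g (v 0))).Reachable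
        ⟨g ((1 : Isom3) (v 1)), hb 1 (one_mem _)⟩ ⟨g (h (v 1)), hb h hh⟩ := by
    have step : ∀ h, ∀ hh : h ∈ closure ({R₁} ∪ S), ∀ k, ∀ hk : k ∈ closure ({R₁} ∪ S),
        (k (v 1) = v 1 ∨ k (v 1) = v (-1)) →
        ((wythoff R₀ R₁ S (v 0)).vertexFigure (g (v 0))).Reachable ⟨g (h (v 1)), hb h hh⟩
          ⟨g ((h * k) (v 1)), hb _ (mul_mem hh hk)⟩ := by
      rintro h hh k hk (h0 | h0)
      · have : (⟨g ((h * k) (v 1)), hb _ (mul_mem hh hk)⟩ :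
            (wythoff R₀ R₁ S (v 0)).nbrs (g (v 0))) = ⟨g (h (v 1)), hb h hh⟩ :=
          Subtype.ext (congrArg (fun x => g (h x)) h0)
        rw [this]
      · refine SimpleGraph.Adj.reachable ⟨?_, _, D.mem_faces.2 ⟨g * h, mul_mem hg (D.stab_le hh),
          rfl⟩, ⟨s(v 1, v 0), ⟨0, ?_⟩, ?_⟩, ⟨s(v 0, v (-1)), ⟨-1, ?_⟩, ?_⟩⟩
        · intro h'
          have h' : g (h (v 1)) = g (h (k (v 1))) := congrArg Subtype.val h'
          rw [h0] at h'
          exact D.v_neg_one_ne_one (h.injective (g.injective h')).symm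
        · dsimp only; rw [zero_add, Sym2.eq_swap]
        · rw [edge_map_mul, Sym2.map_mk, Sym2.map_mk, D.stab_v_zero hh]
        · dsimp only; rw [neg_add_cancel, Sym2.eq_swap]
        · change _ = s(g (v 0), g (h (k (v 1))))
          rw [edge_map_mul, Sym2.map_mk, Sym2.map_mk, D.stab_v_zero hh, h0]
    intro h hh
    induction hh using Subgroup.closure_induction_right with
    | one => exact SimpleGraph.Reachable.refl _
    | mul_right x hx y hy ih =>
      refine ih.trans (step x hx y (subset_closure hy) ?_)
      rcases hy with rfl | hy
      · exact Or.inr (D.R₁_v 1)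
      · exact Or.inl (D.S_v_one y hy)
    | mul_inv_cancel x hx y hy ih =>
      refine ih.trans (step x hx y⁻¹ (inv_mem (subset_closure hy)) ?_)
      rcases hy with rfl | hy
      · rw [inv_eq_of_mul_eq_one_left D.R₁_mul_self]; exact Or.inr (D.R₁_v 1)
      · exact Or.inl ((pointStab (v 1)).inv_mem (D.S_v_one y hy))
  rintro ⟨u, hu⟩
  obtain ⟨h, hh, rfl⟩ := (D.mem_nbrs hg).1 hu
  exact key h hh

/-- An isometry fixing the base flag is the identity. -/
theorem eq_one_of_flag_fixed {g : Isom3} (h0 : g (v 0) = v 0) (h1 : g (v 1) = v 1)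
    (hP : Sym2.map g '' (Set.range fun i => s(v i, v (i + 1))) =
      Set.range fun i => s(v i, v (i + 1))) : g = 1 := by
  refine D.eq_one_of_fixed (polygon_eq_one_of_flag_fixed D.three_le D.inj h0 h1 fun i => ?_)
  have : Sym2.map g s(v i, v (i + 1)) ∈ Set.range fun i => s(v i, v (i + 1)) := by
    rw [← hP]; exact ⟨_, ⟨i, rfl⟩, rfl⟩
  obtain ⟨j, hj⟩ := this
  exact ⟨j, hj.symm⟩

theorem face_invariant {g : Isom3} (hg : g ∈ closure {R₀, R₁}) :
    Sym2.map g '' (Set.range fun i => s(v i, v (i + 1))) =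
      Set.range fun i => s(v i, v (i + 1)) := by
  rw [← D.flag_face]
  ext e
  constructor
  · rintro ⟨_, ⟨h, hh, rfl⟩, rfl⟩
    exact ⟨g * h, mul_mem hg hh, by rw [edge_map_mul]⟩
  · rintro ⟨h, hh, rfl⟩
    exact ⟨_, ⟨g⁻¹ * h, mul_mem (inv_mem hg) hh, rfl⟩,
      by rw [edge_map_mul, edge_map_self_inv]⟩

/-- Every edge of the base face is an image of the base edge under the face group. -/
theorem exists_of_mem_face {e : Sym2 E3} (he : e ∈ Set.range fun i => s(v i, v (i + 1))) :
    ∃ w ∈ closure {R₀, R₁}, e = Sym2.map w s(v 0, v 1) := by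
  rw [← D.flag_face] at he
  obtain ⟨w, hw, rfl⟩ := he
  exact ⟨w, hw, by rw [D.R₀_zero]⟩

/-- An element reversing the base edge fixes both of its end points after composition with `R₀`. -/
theorem edge_stab {g : Isom3} (hg : g ∈ closure ({R₀, R₁} ∪ S))
    (h : Sym2.map g s(v 0, v 1) = s(v 0, v 1)) : g ∈ closure S ∨ g * R₀ ∈ closure S := by
  rw [Sym2.map_mk] at h
  rcases Sym2.eq_iff.1 h with ⟨h0, h1⟩ | ⟨h0, h1⟩
  · exact Or.inl (D.stab_edge _ (D.stab_vertex g hg h0) h1)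
  · have h0' : (g * R₀) (v 0) = v 0 := by rw [isom_mul_apply, D.R₀_zero, h1]
    have h1' : (g * R₀) (v 1) = v 1 := by rw [isom_mul_apply, D.R₀_one, h0]
    exact Or.inr (D.stab_edge _ (D.stab_vertex _ (mul_mem hg D.R₀_mem) h0') h1')

/-- The faces at the image of the base edge under `g` are the images of the base face under `g * h`
with `h` in `closure S`. Distinct `h` give distinct faces, since an isometry fixing the base flag is
1. -/
theorem faces_at_edge {e : Sym2 E3} (he : e ∈ (wythoff R₀ R₁ S (v 0)).edges) :
    {P ∈ (wythoff R₀ R₁ S (v 0)).faces | e ∈ P}.ncard = Nat.card (closure S) := by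
  obtain ⟨g, hg, rfl⟩ := D.mem_edges.1 he
  set F := Set.range fun i => s(v i, v (i + 1)) with hF
  have hset : {P ∈ (wythoff R₀ R₁ S (v 0)).faces | Sym2.map g s(v 0, v 1) ∈ P} =
      (fun h : Isom3 => Sym2.map (g * h : Isom3) '' F) '' (closure S : Set Isom3) := by
    ext P
    constructor
    · rintro ⟨hP, heP⟩
      obtain ⟨k, hk, rfl⟩ := D.mem_faces.1 hP
      rw [← hF] at heP ⊢
      rw [mem_face_map, ← edge_map_mul] at heP
      obtain ⟨w, hw, hw'⟩ := D.exists_of_mem_face heP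
      have hfix : Sym2.map (g⁻¹ * (k * w) : Isom3) s(v 0, v 1) = s(v 0, v 1) := by
        rw [edge_map_mul, edge_map_mul, ← hw', edge_map_mul, edge_map_self_inv, edge_map_inv_self]
      have hkw : g⁻¹ * (k * w) ∈ closure ({R₀, R₁} ∪ S) :=
        mul_mem (inv_mem hg) (mul_mem hk (D.pair_le hw))
      rcases D.edge_stab hkw hfix with h | h
      · refine ⟨_, h, ?_⟩
        dsimp only
        rw [mul_inv_cancel_left, face_map_mul, D.face_invariant hw]
      · refine ⟨_, h, ?_⟩
        dsimp only
        rw [mul_assoc, mul_inv_cancel_left, face_map_mul, face_map_mul,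
          D.face_invariant (subset_closure (by simp)), D.face_invariant hw]
    · rintro ⟨h, hh, rfl⟩
      refine ⟨D.mem_faces.2 ⟨g * h, mul_mem hg (D.closure_S_le hh), rfl⟩, s(v 0, v 1),
        D.base_edge_mem_face, ?_⟩
      rw [edge_map_mul, Sym2.map_mk (h : E3 → E3), D.closure_S_v_zero hh, D.closure_S_v_one hh]
  rw [hset, Set.InjOn.ncard_image]
  · exact (Nat.card_coe_set_eq _).symm
  · intro h hh k hk hhk
    dsimp only at hhk
    rw [face_map_mul, face_map_mul] at hhk
    have hhk' := congrArg (fun P => Sym2.map (g⁻¹ : Isom3) '' P) hhk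
    rw [face_map_inv_self, face_map_inv_self] at hhk'
    have hfix : Sym2.map (h⁻¹ * k : Isom3) '' F = F := by
      rw [face_map_mul, ← hhk', face_map_inv_self]
    have := D.eq_one_of_flag_fixed (D.closure_S_v_zero (mul_mem (inv_mem hh) hk))
      (D.closure_S_v_one (mul_mem (inv_mem hh) hk)) hfix
    exact (inv_mul_eq_one.1 this)

/-- A face meeting a bounded set has all its vertices in a larger ball, hence in a finite set; its
edge set is then one of finitely many subsets. -/
theorem finite_faces_meeting (C : Set E3) (hC : IsCompact C) :
    {P ∈ (wythoff R₀ R₁ S (v 0)).faces | (polygonCarrier P ∩ C).Nonempty}.Finite := by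
  have hne : NeZero n := ⟨by have := D.three_le; omega⟩
  obtain ⟨R, hR⟩ := hC.isBounded.exists_norm_le
  obtain ⟨M, hM⟩ := (Set.finite_range v).isBounded.exists_norm_le
  have hM' : ∀ i j, dist (v i) (v j) ≤ M + M := fun i j =>
    (dist_le_norm_add_norm _ _).trans (add_le_add (hM _ ⟨i, rfl⟩) (hM _ ⟨j, rfl⟩))
  -- One `M + M` bounds the distance from a point of an edge to an end point of it, the other the
  -- distance between two vertices of the face.
  set W := {x : E3 | (∃ g ∈ closure ({R₀, R₁} ∪ S), x = g (v 0)) ∧ ‖x‖ ≤ R + (M + M) + (M + M)}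
    with hWdef
  have hW : W.Finite := D.locallyFinite _
  have hE : ((fun q : E3 × E3 => s(q.1, q.2)) '' (W ×ˢ W)).Finite := (hW.prod hW).image _
  refine hE.finite_subsets.subset ?_
  rintro P ⟨hP, x, ⟨a, b, hab, hx⟩, hxC⟩
  obtain ⟨g, hg, rfl⟩ := D.mem_faces.1 hP
  obtain ⟨_, ⟨i, rfl⟩, hi⟩ := hab
  have hxi : ∃ k, dist x (g (v k)) ≤ M + M := by
    have hd : ∀ c d : E3, ∀ y ∈ segment ℝ c d, dist y c ≤ dist c d := by
      intro c d y hy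
      rw [segment_eq_image_lineMap] at hy
      obtain ⟨t, ht, rfl⟩ := hy
      rw [dist_lineMap_left, Real.norm_of_nonneg ht.1]
      exact mul_le_of_le_one_left dist_nonneg ht.2
    dsimp only at hi
    rw [Sym2.map_mk] at hi
    rcases Sym2.eq_iff.1 hi with ⟨rfl, rfl⟩ | ⟨rfl, rfl⟩
    · exact ⟨i, (hd _ _ x hx).trans (by rw [g.dist_map]; exact hM' _ _)⟩
    · exact ⟨i + 1, (hd _ _ x hx).trans (by rw [g.dist_map]; exact hM' _ _)⟩
  obtain ⟨k, hk⟩ := hxi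
  have hv : ∀ j, g (v j) ∈ W := by
    intro j
    refine ⟨D.v_mem_verts hg j, ?_⟩
    have h1 : dist (g (v k)) (g (v j)) ≤ M + M := by rw [g.dist_map]; exact hM' _ _
    have h2 := hR x hxC
    have h3 : ‖g (v j)‖ ≤ ‖x‖ + dist x (g (v j)) := by
      rw [dist_comm, dist_eq_norm]
      linarith [norm_sub_norm_le (g (v j)) x]
    linarith [dist_triangle x (g (v k)) (g (v j))]
  rintro _ ⟨_, ⟨j, rfl⟩, rfl⟩
  exact ⟨(g (v j), g (v (j + 1))), Set.mk_mem_prod (hv _) (hv _), rfl⟩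

theorem isComplexWith : (wythoff R₀ R₁ S (v 0)).IsComplexWith (Nat.card (closure S)) where
  edge_verts := by
    intro e he x hx
    obtain ⟨g, hg, rfl⟩ := D.mem_edges.1 he
    rw [Sym2.map_mk, Sym2.mem_iff] at hx
    rcases hx with rfl | rfl <;> exact D.v_mem_verts hg _
  face_polygon := by
    intro P hP
    obtain ⟨g, hg, rfl⟩ := D.mem_faces.1 hP
    refine Or.inl ⟨n, D.three_le, g ∘ v, g.injective.comp D.inj, ?_⟩
    rw [← Set.range_comp]
    rfl
  face_edges := by
    intro P hP e he
    obtain ⟨g, hg, rfl⟩ := D.mem_faces.1 hP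
    obtain ⟨e, he, rfl⟩ := he
    obtain ⟨w, hw, rfl⟩ := D.exists_of_mem_face he
    exact D.mem_edges.2 ⟨g * w, mul_mem hg (D.pair_le hw), by rw [edge_map_mul]⟩
  connected := D.edgeGraph_connected
  vertexFigure_connected := fun x hx => D.vertexFigure_connected hx
  two_le := by have := D.three_le_card; omega
  faces_at_edge := fun e he => D.faces_at_edge he
  discrete := D.finite_faces_meeting

theorem hasFiniteFaces : (wythoff R₀ R₁ S (v 0)).HasFiniteFaces := by
  intro P hP
  obtain ⟨g, hg, rfl⟩ := D.mem_faces.1 hP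
  refine ⟨n, D.three_le, g ∘ v, g.injective.comp D.inj, ?_⟩
  rw [← Set.range_comp]
  rfl

theorem map_eq_self {g : Isom3} (hg : g ∈ closure ({R₀, R₁} ∪ S)) :
    (wythoff R₀ R₁ S (v 0)).map g = wythoff R₀ R₁ S (v 0) := by
  refine PolygonalFigure.ext ?_ ?_ ?_
  · ext x
    constructor
    · rintro ⟨_, ⟨h, hh, rfl⟩, rfl⟩
      exact ⟨g * h, mul_mem hg hh, rfl⟩
    · rintro ⟨h, hh, rfl⟩
      exact ⟨_, ⟨g⁻¹ * h, mul_mem (inv_mem hg) hh, rfl⟩, by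
        rw [isom_mul_apply, isom_apply_inv_self]⟩
  · ext x
    constructor
    · rintro ⟨_, ⟨h, hh, rfl⟩, rfl⟩
      exact ⟨g * h, mul_mem hg hh, by rw [edge_map_mul]⟩
    · rintro ⟨h, hh, rfl⟩
      exact ⟨_, ⟨g⁻¹ * h, mul_mem (inv_mem hg) hh, rfl⟩, by
        rw [edge_map_mul, edge_map_self_inv]⟩
  · ext x
    constructor
    · rintro ⟨_, ⟨h, hh, rfl⟩, rfl⟩
      exact ⟨g * h, mul_mem hg hh, by dsimp only; rw [face_map_mul]⟩
    · rintro ⟨h, hh, rfl⟩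
      exact ⟨_, ⟨g⁻¹ * h, mul_mem (inv_mem hg) hh, rfl⟩, by
        dsimp only; rw [← face_map_mul, mul_inv_cancel_left]⟩

theorem baseFlag_mem : wythoffFlag R₀ R₁ (v 0) ∈ (wythoff R₀ R₁ S (v 0)).flags := by
  refine ⟨D.v_mem_verts (one_mem _) 0, D.mem_edges.2 ⟨1, one_mem _, ?_⟩,
    D.mem_faces.2 ⟨1, one_mem _, ?_⟩, ?_, ?_⟩
  · rw [edge_map_one, D.flag_edge]
  · rw [face_map_one, D.flag_face]
  · rw [D.flag_edge]; exact Sym2.mem_mk_left _ _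
  · rw [D.flag_edge, D.flag_face]; exact D.base_edge_mem_face

/-- The face is an image of the base face, its edges form one orbit under the face group, and `R₀`
interchanges the two end points of the base edge. -/
theorem exists_flagImage {Φ : E3 × Sym2 E3 × Set (Sym2 E3)}
    (hΦ : Φ ∈ (wythoff R₀ R₁ S (v 0)).flags) :
    ∃ g ∈ closure ({R₀, R₁} ∪ S), flagImage g (wythoffFlag R₀ R₁ (v 0)) = Φ := by
  obtain ⟨x, e, P⟩ := Φ
  obtain ⟨-, -, hP, hxe, heP⟩ := hΦ
  dsimp only at hP hxe heP
  obtain ⟨g, hg, rfl⟩ := D.mem_faces.1 hP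
  obtain ⟨e, he, rfl⟩ := heP
  obtain ⟨w, hw, rfl⟩ := D.exists_of_mem_face he
  have hbase : ∀ k, k ∈ closure {R₀, R₁} → x = (g * k) (v 0) →
      Sym2.map g (Sym2.map w s(v 0, v 1)) = Sym2.map (g * k : Isom3) s(v 0, v 1) →
      flagImage (g * k) (wythoffFlag R₀ R₁ (v 0)) =
        (x, Sym2.map g (Sym2.map w s(v 0, v 1)),
          Sym2.map g '' Set.range fun i => s(v i, v (i + 1))) := by
    intro k hk hx he
    rw [flagImage, D.flag_edge, D.flag_face, face_map_mul g k, D.face_invariant hk, he, hx]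
    rfl
  rw [Sym2.map_mk, Sym2.map_mk, Sym2.mem_iff] at hxe
  rcases hxe with rfl | rfl
  · exact ⟨g * w, mul_mem hg (D.pair_le hw), hbase w hw rfl (edge_map_mul _ _ _).symm⟩
  · have hR : R₀ ∈ closure {R₀, R₁} := subset_closure (by simp)
    refine ⟨g * (w * R₀), mul_mem hg (D.pair_le (mul_mem hw hR)), hbase _ (mul_mem hw hR) ?_ ?_⟩
    · rw [isom_mul_apply, isom_mul_apply, D.R₀_zero]
    · rw [edge_map_mul, edge_map_mul, Sym2.map_mk R₀, D.R₀_zero, D.R₀_one, Sym2.eq_swap]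

theorem eq_one_of_flagImage {g : Isom3}
    (h : flagImage g (wythoffFlag R₀ R₁ (v 0)) = wythoffFlag R₀ R₁ (v 0)) : g = 1 := by
  have h0 : g (v 0) = v 0 := congrArg Prod.fst h
  have h1 := congrArg (fun Φ => Φ.2.1) h
  have h2 := congrArg (fun Φ => Φ.2.2) h
  simp only [flagImage] at h1 h2
  rw [D.flag_edge, Sym2.map_mk, h0, Sym2.congr_right] at h1
  rw [D.flag_face] at h2
  exact D.eq_one_of_flag_fixed h0 h1 h2

/-- A symmetry and a suitable element of the generated group agree on the base flag, so they are
equal. The condition on the orthogonal complement of the hull is void because the vertices span. -/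
theorem symmetryGroup_eq :
    (wythoff R₀ R₁ S (v 0)).symmetryGroup = closure ({R₀, R₁} ∪ S) := by
  apply le_antisymm
  · intro g hg
    obtain ⟨h, hh, he⟩ := D.exists_flagImage (flagImage_mem hg.1 D.baseFlag_mem)
    have : h⁻¹ * g = 1 := D.eq_one_of_flagImage (by
      rw [flagImage_mul, ← he, ← flagImage_mul, inv_mul_cancel, flagImage_one])
    rw [← inv_mul_eq_one.1 this]
    exact hh
  · intro g hg
    refine ⟨D.map_eq_self hg, fun w hw => ?_⟩
    rw [D.affineSpan_verts, AffineSubspace.direction_top, Submodule.top_orthogonal_eq_bot,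
      Submodule.mem_bot] at hw
    rw [hw, map_zero]

theorem isSimplyFlagTransitive : (wythoff R₀ R₁ S (v 0)).IsSimplyFlagTransitive := by
  refine ⟨⟨_, D.isComplexWith⟩, fun Φ hΦ Ψ hΨ => ?_⟩
  rw [D.symmetryGroup_eq]
  obtain ⟨g, hg, rfl⟩ := D.exists_flagImage hΦ
  obtain ⟨h, hh, rfl⟩ := D.exists_flagImage hΨ
  refine ⟨h * g⁻¹, ⟨mul_mem hh (inv_mem hg), ?_⟩, ?_⟩
  · rw [← flagImage_mul, inv_mul_cancel_right]
  · rintro k ⟨hk, he⟩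
    have : h⁻¹ * (k * g) = 1 := D.eq_one_of_flagImage (by
      rw [flagImage_mul, flagImage_mul, he, ← flagImage_mul, inv_mul_cancel, flagImage_one])
    rw [inv_mul_eq_one.1 this, mul_inv_cancel_right]

theorem not_isPolyhedron : ¬ (wythoff R₀ R₁ S (v 0)).IsPolyhedron := by
  intro h
  have he : s(v 0, v 1) ∈ (wythoff R₀ R₁ S (v 0)).edges :=
    D.mem_edges.2 ⟨1, one_mem _, (edge_map_one _).symm⟩
  have h1 := h.faces_at_edge _ he
  rw [D.faces_at_edge he] at h1
  have := D.three_le_card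
  omega

theorem G0_eq : (wythoff R₀ R₁ S (v 0)).G0 (wythoffFlag R₀ R₁ (v 0)) = zpowers R₀ := by
  rw [PolygonalFigure.G0, D.flag_edge, D.flag_face, D.symmetryGroup_eq]
  apply le_antisymm
  · rintro g ⟨⟨-, he⟩, hP⟩
    replace he : Sym2.map g s(v 0, v 1) = s(v 0, v 1) := he
    replace hP : Sym2.map g '' _ = _ := hP
    apply mem_zpowers_of_eq_one_or
    rw [Sym2.map_mk] at he
    rcases Sym2.eq_iff.1 he with ⟨h0, h1⟩ | ⟨h0, h1⟩
    · exact Or.inl (D.eq_one_of_flag_fixed h0 h1 hP)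
    · right
      have : R₀ * g = 1 := by
        refine D.eq_one_of_flag_fixed ?_ ?_ ?_
        · rw [isom_mul_apply, h0, D.R₀_one]
        · rw [isom_mul_apply, h1, D.R₀_zero]
        · rw [face_map_mul, hP, D.face_invariant (subset_closure (by simp))]
      rw [← inv_eq_of_mul_eq_one_right this, inv_eq_of_mul_eq_one_left D.R₀_mul_self]
  · rw [zpowers_le]
    refine ⟨⟨D.R₀_mem, ?_⟩, D.face_invariant (subset_closure (by simp))⟩
    change Sym2.map R₀ s(v 0, v 1) = s(v 0, v 1)
    rw [Sym2.map_mk, D.R₀_zero, D.R₀_one, Sym2.eq_swap]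

/-- Only two edges of the base face contain the base vertex. An element fixing that vertex and the
face either fixes the base edge, and is 1, or sends it to the other one, and then agrees with `R₁`
on the flag. -/
theorem G1_eq : (wythoff R₀ R₁ S (v 0)).G1 (wythoffFlag R₀ R₁ (v 0)) = zpowers R₁ := by
  rw [PolygonalFigure.G1, D.flag_face, D.symmetryGroup_eq]
  apply le_antisymm
  · rintro g ⟨⟨-, h0⟩, hP⟩
    replace h0 : g (v 0) = v 0 := h0
    replace hP : Sym2.map g '' _ = _ := hP
    apply mem_zpowers_of_eq_one_or
    have he : Sym2.map g s(v 0, v 1) ∈ Set.range fun i => s(v i, v (i + 1)) := by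
      rw [← hP]; exact ⟨_, D.base_edge_mem_face, rfl⟩
    obtain ⟨j, hj⟩ := he
    dsimp only at hj
    rw [Sym2.map_mk, h0] at hj
    have hmem : v 0 ∈ s(v j, v (j + 1)) := by rw [hj]; exact Sym2.mem_mk_left _ _
    rcases (polygon_mem_edge D.inj j 0).1 hmem with rfl | h'
    · rw [zero_add, Sym2.congr_right] at hj
      exact Or.inl (D.eq_one_of_flag_fixed h0 hj.symm hP)
    · right
      obtain rfl : j = -1 := by linear_combination -h'
      rw [neg_add_cancel, Sym2.eq_swap, Sym2.congr_right] at hj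
      have : R₁ * g = 1 := by
        refine D.eq_one_of_flag_fixed ?_ ?_ ?_
        · rw [isom_mul_apply, h0, D.R₁_zero]
        · rw [isom_mul_apply, ← hj, D.R₁_v, neg_neg]
        · rw [face_map_mul, hP, D.face_invariant (subset_closure (by simp))]
      rw [← inv_eq_of_mul_eq_one_right this, inv_eq_of_mul_eq_one_left D.R₁_mul_self]
  · rw [zpowers_le]
    exact ⟨⟨D.R₁_mem, D.R₁_zero⟩, D.face_invariant (subset_closure (by simp))⟩

theorem G2_eq : (wythoff R₀ R₁ S (v 0)).G2 (wythoffFlag R₀ R₁ (v 0)) = closure S := by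
  rw [PolygonalFigure.G2, D.flag_edge, D.symmetryGroup_eq]
  apply le_antisymm
  · rintro g ⟨⟨hg, h0⟩, he⟩
    replace h0 : g (v 0) = v 0 := h0
    replace he : Sym2.map g s(v 0, v 1) = s(v 0, v 1) := he
    rw [Sym2.map_mk, h0, Sym2.congr_right] at he
    exact D.stab_edge g (D.stab_vertex g hg h0) he
  · intro g hg
    refine ⟨⟨D.closure_S_le hg, D.closure_S_v_zero hg⟩, ?_⟩
    change Sym2.map g s(v 0, v 1) = s(v 0, v 1)
    rw [Sym2.map_mk, D.closure_S_v_zero hg, D.closure_S_v_one hg]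

end

end WythoffData

/-! ### Signed permutations with integral translation part -/

/-- A signed permutation `x ↦ (ε i * x (σ i))ᵢ` of the three coordinates. -/
abbrev SPerm : Type := Equiv.Perm (Fin 3) × (Fin 3 → ℤˣ)

namespace SPerm

/-- Composition of signed permutations. -/
def comp (b c : SPerm) : SPerm := (c.1 * b.1, fun i => b.2 i * c.2 (b.1 i))

/-- The inverse of a signed permutation. -/
def symm (b : SPerm) : SPerm := (b.1⁻¹, fun i => b.2 (b.1⁻¹ i))

/-- The action on vectors over a ring, followed by the translation by `t`. -/
def act {R : Type*} [Ring R] (b : SPerm) (t s : Fin 3 → R) : Fin 3 → R :=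
  fun i => ((b.2 i : ℤ) : R) * s (b.1 i) + t i

/-- All products of at most `k` elements of a list. -/
def words (l : List SPerm) : ℕ → List SPerm
  | 0 => [(1, 1)]
  | k + 1 => (words l k ++ l.flatMap fun b => (words l k).map (comp b)).dedup

/-- The images of `q` under products of at most `k` elements of a list. -/
def orbit (l : List SPerm) (q : Fin 3 → ℤ) : ℕ → List (Fin 3 → ℤ)
  | 0 => [q]
  | k + 1 => (orbit l q k ++ l.flatMap fun b => (orbit l q k).map (b.act 0)).dedup

/-- The translation part of the inverse isometry. -/
def symmTrans (b : SPerm) (t : Fin 3 → ℤ) : Fin 3 → ℤ :=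
  fun i => -((b.2 (b.1⁻¹ i) : ℤ) * t (b.1⁻¹ i))

theorem comp_symm (b : SPerm) : comp b b.symm = (1, 1) := by
  refine Prod.ext (by simp [comp, symm]) ?_
  funext i
  simp [comp, symm, Int.units_mul_self]

theorem act_symmTrans (b : SPerm) (t : Fin 3 → ℤ) : b.act t (b.symmTrans t) = 0 := by
  funext i
  simp only [act, symmTrans, Equiv.Perm.inv_def, Equiv.symm_apply_apply, Int.cast_id, Pi.zero_apply]
  have : (b.2 i : ℤ) * (b.2 i : ℤ) = 1 := by
    rw [← Units.val_mul, Int.units_mul_self, Units.val_one]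
  linear_combination -(t i) * this

/-- The entries of the test vector are nonzero with distinct absolute values, so its image reveals
both the permutation and the signs. -/
theorem eq_of_act_eq {b c : SPerm} (h : b.act (R := ℤ) 0 ![1, 2, 3] = c.act 0 ![1, 2, 3]) :
    b = c := by
  have key : ∀ (e e' : ℤˣ) (k k' : Fin 3),
      (e : ℤ) * ![1, 2, 3] k = (e' : ℤ) * ![1, 2, 3] k' → e = e' ∧ k = k' := by decide
  have h' : ∀ i, b.2 i = c.2 i ∧ b.1 i = c.1 i := fun i => by
    have := congrFun h i
    simp only [act, Pi.zero_apply, add_zero, Int.cast_id] at this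
    exact key _ _ _ _ this
  exact Prod.ext (Equiv.ext fun i => (h' i).2) (funext fun i => (h' i).1)

end SPerm

/-- The point with coordinates `a * t i`. -/
noncomputable def intVec (a : ℝ) (t : Fin 3 → ℤ) : E3 := WithLp.toLp 2 fun i => a * t i

theorem intVec_apply (a : ℝ) (t : Fin 3 → ℤ) (i : Fin 3) : intVec a t i = a * t i := rfl

theorem intVec_zero (a : ℝ) : intVec a 0 = 0 := by
  ext i; simp [intVec_apply]

theorem intVec_injective {a : ℝ} (ha : a ≠ 0) : Function.Injective (intVec a) := by
  intro s t h
  funext i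
  have : intVec a s i = intVec a t i := by rw [h]
  rw [intVec_apply, intVec_apply] at this
  exact_mod_cast mul_left_cancel₀ ha this

/-- The isometry with linear part a signed permutation and translation part in `a • ℤ³`. -/
noncomputable def spIsom (a : ℝ) (b : SPerm) (t : Fin 3 → ℤ) : Isom3 :=
  signedPerm b.1 b.2 (intVec a t)

section

variable {a : ℝ}

theorem spIsom_intVec (b : SPerm) (t s : Fin 3 → ℤ) :
    spIsom a b t (intVec a s) = intVec a (b.act t s) := by
  ext i
  simp only [spIsom, signedPerm_apply, intVec_apply, SPerm.act]
  push_cast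
  ring

theorem spIsom_mul (b c : SPerm) (t s : Fin 3 → ℤ) :
    spIsom a b t * spIsom a c s = spIsom a (b.comp c) (b.act t s) := by
  ext x i
  rw [isom_mul_apply]
  simp only [spIsom, signedPerm_apply, intVec_apply, SPerm.act, SPerm.comp, Equiv.Perm.mul_apply]
  push_cast
  ring

theorem spIsom_one : spIsom a (1, 1) 0 = 1 := by
  ext x i
  simp [spIsom, signedPerm_apply, intVec_zero]

theorem spIsom_inv (b : SPerm) (t : Fin 3 → ℤ) :
    (spIsom a b t)⁻¹ = spIsom a b.symm (b.symmTrans t) := by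
  rw [inv_eq_iff_mul_eq_one, spIsom_mul, SPerm.comp_symm, SPerm.act_symmTrans, spIsom_one]

theorem spIsom_zero_apply_zero (b : SPerm) (t : Fin 3 → ℤ) : spIsom a b t 0 = intVec a t := by
  rw [← intVec_zero a, spIsom_intVec]
  congr 1; funext i; simp [SPerm.act]

theorem spIsom_injective (ha : a ≠ 0) (t : Fin 3 → ℤ) :
    Function.Injective fun b => spIsom a b t := by
  intro b c h
  apply SPerm.eq_of_act_eq
  have := DFunLike.congr_fun h (intVec a ![1, 2, 3])
  dsimp only at this
  rw [spIsom_intVec, spIsom_intVec] at this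
  have := intVec_injective ha this
  funext i
  have := congrFun this i
  simpa [SPerm.act] using this

/-- Translates membership in a computed list of signed permutations into membership in a group of
isometries. -/
theorem spIsom_mem_of_words {l : List SPerm} {G : Subgroup Isom3}
    (h : ∀ b ∈ l, spIsom a b 0 ∈ G) (k : ℕ) : ∀ b ∈ SPerm.words l k, spIsom a b 0 ∈ G := by
  induction k with
  | zero =>
    intro b hb
    rw [SPerm.words, List.mem_singleton] at hb
    rw [hb, spIsom_one]
    exact one_mem _
  | succ k ih =>
    intro b hb
    rw [SPerm.words, List.mem_dedup, List.mem_append, List.mem_flatMap] at hb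
    rcases hb with hb | ⟨c, hc, hb⟩
    · exact ih b hb
    · obtain ⟨d, hd, rfl⟩ := List.mem_map.1 hb
      have := mul_mem (h c hc) (ih d hd)
      rw [spIsom_mul] at this
      convert this using 2
      funext i; simp [SPerm.act]

theorem exists_of_mem_orbit {l : List SPerm} {G : Subgroup Isom3}
    (h : ∀ b ∈ l, spIsom a b 0 ∈ G) (q : Fin 3 → ℤ) (k : ℕ) :
    ∀ q' ∈ SPerm.orbit l q k, ∃ g ∈ G, g (intVec a q) = intVec a q' := by
  induction k with
  | zero =>
    intro q' hq
    rw [SPerm.orbit, List.mem_singleton] at hq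
    exact ⟨1, one_mem _, by rw [hq]; rfl⟩
  | succ k ih =>
    intro q' hq
    rw [SPerm.orbit, List.mem_dedup, List.mem_append, List.mem_flatMap] at hq
    rcases hq with hq | ⟨c, hc, hq⟩
    · exact ih q' hq
    · obtain ⟨d, hd, rfl⟩ := List.mem_map.1 hq
      obtain ⟨g, hg, e⟩ := ih d hd
      exact ⟨_, mul_mem (h c hc) hg, by rw [isom_mul_apply, e, spIsom_intVec]⟩

end

/-! ### Integral data of the eight complexes -/

namespace K12

/-- The linear part of `R₀`. -/
def r0 : Fin 8 → SPerm
  | 0 => (1, ![-1, 1, -1])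
  | 1 | 2 => (Equiv.swap 0 1, ![1, 1, -1])
  | 3 | 4 | 5 | 6 | 7 => (Equiv.swap 0 2, ![-1, -1, -1])

/-- The other end point of the base edge. -/
def p : Fin 8 → Fin 3 → ℤ
  | 0 | 7 => ![1, 0, 1]
  | 1 | 2 | 6 => ![1, -1, 1]
  | 3 | 4 | 5 => ![0, 1, 0]

/-- The reflection `R₁`. -/
def r1 : Fin 8 → SPerm
  | 1 | 2 => (1, ![1, -1, 1])
  | 0 | 3 | 4 | 5 | 6 | 7 => (Equiv.swap 0 1, ![1, 1, 1])

/-- The generators of `G₂`. -/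
def s : Fin 8 → List SPerm
  | 0 => [(Equiv.swap 0 2, ![1, 1, 1]), (1, ![1, -1, 1])]
  | 1 => [(finRotate 3, ![-1, -1, 1])]
  | 2 => [(Equiv.swap 0 1, ![-1, -1, 1]), (Equiv.swap 1 2, ![1, -1, -1])]
  | 3 => [(Equiv.swap 0 2, ![-1, 1, -1]), (Equiv.swap 0 2, ![1, 1, 1])]
  | 4 => [(1, ![-1, 1, 1]), (1, ![1, 1, -1])]
  | 5 => [(Equiv.swap 0 2, ![-1, 1, -1]), (1, ![-1, 1, 1])]
  | 6 => [(Equiv.swap 0 1, ![-1, -1, 1]), (Equiv.swap 1 2, ![1, -1, -1])]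
  | 7 => [(1, ![1, -1, 1]), (Equiv.swap 0 2, ![1, 1, 1])]

/-- A condition, invariant under the group of the complex, on the linear part of an isometry and its
translation part modulo 2. -/
def inv : Fin 8 → SPerm → (Fin 3 → ZMod 2) → Bool
  | 1, b, t => t 0 = t 1 ∧ t 1 = t 2 ∧ (Equiv.Perm.sign b.1 = 1 ↔ t 0 = 0)
  | 3, b, t => b.2 0 * b.2 1 * b.2 2 = 1 ↔ t 0 + t 1 + t 2 = 0
  | 4, b, t => (b.1 2 = 2 ∧ t 0 = t 1 ∧ t 1 = t 2) ∨ (b.1 1 = 2 ∧ t 0 ≠ t 1 ∧ t 1 = t 2) ∨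
      (b.1 0 = 2 ∧ t 0 ≠ t 1 ∧ t 0 = t 2)
  | 6, b, t => t 0 = t 1 ∧ t 1 = t 2 ∧ (b.2 0 * b.2 1 * b.2 2 = 1 ↔ t 0 = 0)
  | 0, _, _ | 2, _, _ | 5, _, _ | 7, _, _ => true

/-- All generators, as pairs of a linear part and a translation part. -/
def gens (i : Fin 8) : List (SPerm × (Fin 3 → ℤ)) :=
  (r0 i, p i) :: (r1 i, 0) :: (s i).map fun b => (b, 0)

/-- The number of faces at each edge. -/
def r : Fin 8 → ℕ := ![4, 3, 6, 4, 4, 8, 6, 4]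

/-- The number of edges at each vertex. -/
def deg : Fin 8 → ℕ := ![12, 8, 8, 6, 4, 6, 4, 12]

/-- The number of edges of each face. -/
def faceSize : Fin 8 → ℕ := ![4, 4, 4, 6, 6, 6, 6, 6]

set_option maxRecDepth 100000 in
theorem inv_one (i : Fin 8) : inv i (1, 1) 0 := by
  revert i; decide +kernel

set_option maxRecDepth 100000 in
-- Since the translation part matters only modulo 2, closure under left multiplication by generators
-- and their inverses is a finite check. The condition is trivial when the vertex stabilizer is the
-- whole octahedral group; in the other cases the parity of the translation part records a coset of
-- the stabilizer.
theorem inv_comp (i : Fin 8) : ∀ g ∈ gens i ++ (gens i).map fun g => (g.1.symm, g.1.symmTrans g.2),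
    ∀ b t, inv i b t → inv i (g.1.comp b) (g.1.act (fun j => (g.2 j : ZMod 2)) t) := by
  revert i; decide +kernel

set_option maxRecDepth 100000 in
-- Together with `mem_words_of_inv_of_act` this shows that the signed permutations satisfying the
-- invariant with zero translation are all generated by `R₁` and `G₂`. The bounds 8 and 4 are word
-- lengths long enough for all eight complexes.
theorem mem_orbit_of_inv (i : Fin 8) :
    ∀ b, inv i b 0 → b.act 0 (p i) ∈ SPerm.orbit (r1 i :: s i) (p i) 8 := by
  revert i; decide +kernel

set_option maxRecDepth 100000 in
theorem mem_words_of_inv_of_act (i : Fin 8) :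
    ∀ b, inv i b 0 → b.act 0 (p i) = p i → b ∈ SPerm.words (s i) 4 := by
  revert i; decide +kernel

set_option maxRecDepth 100000 in
-- For the special group: a signed permutation outside the vertex stabilizer enters it after
-- multiplication by an element of the stabilizer and then by the linear part of `R₀`.
theorem inv_or_inv_comp (i : Fin 8) :
    ∀ b, inv i b 0 ∨ ∃ c, inv i c 0 ∧ inv i ((r0 i).comp (c.comp b)) 0 := by
  revert i; decide +kernel

set_option maxRecDepth 100000 in
theorem s_act (i : Fin 8) : ∀ b ∈ s i, b.act 0 (p i) = p i := by
  revert i; decide +kernel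

set_option maxRecDepth 100000 in
theorem card_stab_edge (i : Fin 8) :
    (Finset.univ.filter fun b => inv i b 0 ∧ b.act 0 (p i) = p i).card = r i := by
  revert i; decide +kernel

set_option maxRecDepth 100000 in
theorem card_nbrs (i : Fin 8) :
    ((Finset.univ.filter fun b => inv i b 0).image
      fun b : SPerm => b.act 0 (p i)).card = deg i := by
  revert i; decide +kernel

end K12

theorem inner_E3 (x y : E3) : inner ℝ x y = x 0 * y 0 + x 1 * y 1 + x 2 * y 2 := by
  simp [PiLp.inner_apply, Fin.sum_univ_three]; ring

/-- A set containing the origin that is orthogonal only to `0` spans the space. -/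
theorem affineSpan_eq_top_of_inner {s : Set E3} (h0 : (0 : E3) ∈ s)
    (h : ∀ w : E3, (∀ x ∈ s, inner ℝ x w = 0) → w = 0) : affineSpan ℝ s = ⊤ := by
  rw [← AffineSubspace.direction_eq_top_iff_of_nonempty ⟨0, subset_affineSpan ℝ s h0⟩,
    ← Submodule.orthogonal_eq_bot_iff, eq_bot_iff]
  intro w hw
  rw [Submodule.mem_orthogonal] at hw
  refine h w fun x hx => hw x ?_
  rw [direction_affineSpan]
  simpa using vsub_mem_vectorSpan ℝ hx h0

theorem finite_intVec {a : ℝ} (ha : a ≠ 0) (R : ℝ) :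
    {x : E3 | (∃ t, x = intVec a t) ∧ ‖x‖ ≤ R}.Finite := by
  set N : ℤ := ⌈R / |a|⌉ with hN
  refine ((Set.finite_Icc (fun _ : Fin 3 => -N) (fun _ => N)).image (intVec a)).subset ?_
  rintro _ ⟨⟨t, rfl⟩, h⟩
  have ha' : 0 < |a| := abs_pos.2 ha
  have hb : ∀ i, |t i| ≤ N := by
    intro i
    have h1 := (PiLp.norm_apply_le (intVec a t) i).trans h
    rw [intVec_apply, Real.norm_eq_abs, abs_mul, mul_comm, ← le_div_iff₀ ha'] at h1
    exact_mod_cast h1.trans (Int.le_ceil _)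
  exact ⟨t, ⟨fun i => (abs_le.1 (hb i)).1, fun i => (abs_le.1 (hb i)).2⟩, rfl⟩

/-! ### The groups of the eight complexes, their stabilizers and their base faces -/

namespace K12

variable {a : ℝ}

theorem genR0_eq (a : ℝ) (i : Fin 8) : genR0 a i = spIsom a (r0 i) (p i) := by
  have h0 : (!₂[a, 0, a] : E3) = intVec a ![1, 0, 1] := by
    ext j; fin_cases j <;> simp [intVec_apply]
  have h1 : (!₂[a, -a, a] : E3) = intVec a ![1, -1, 1] := by
    ext j; fin_cases j <;> simp [intVec_apply]
  have h2 : (!₂[0, a, 0] : E3) = intVec a ![0, 1, 0] := by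
    ext j; fin_cases j <;> simp [intVec_apply]
  fin_cases i <;> simp only [genR0, h0, h1, h2] <;> rfl

theorem genR1_eq (a : ℝ) (i : Fin 8) : genR1 i = spIsom a (r1 i) 0 := by
  fin_cases i <;> simp only [spIsom, intVec_zero] <;> rfl

theorem mem_genG2 (a : ℝ) (i : Fin 8) (g : Isom3) :
    g ∈ genG2 i ↔ ∃ b ∈ s i, g = spIsom a b 0 := by
  fin_cases i <;> simp [genG2, s, spIsom, intVec_zero]

theorem act_cast (b : SPerm) (t q : Fin 3 → ℤ) :
    (fun j => ((b.act t q j : ℤ) : ZMod 2)) =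
      b.act (fun j => (t j : ZMod 2)) (fun j => (q j : ZMod 2)) := by
  funext j; simp [SPerm.act]

/-- The group of the complex. -/
noncomputable abbrev H (a : ℝ) (i : Fin 8) : Subgroup Isom3 :=
  closure ({genR0 a i, genR1 i} ∪ genG2 i)

theorem exists_gens {i : Fin 8} {g : Isom3} (hg : g ∈ {genR0 a i, genR1 i} ∪ genG2 i) :
    ∃ x ∈ gens i, g = spIsom a x.1 x.2 := by
  rcases hg with (rfl | rfl) | hg
  · exact ⟨_, List.mem_cons_self, genR0_eq a i⟩
  · exact ⟨_, List.mem_cons_of_mem _ List.mem_cons_self, genR1_eq a i⟩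
  · obtain ⟨b, hb, rfl⟩ := (mem_genG2 a i g).1 hg
    exact ⟨(b, 0), List.mem_cons_of_mem _ (List.mem_cons_of_mem _ (List.mem_map.2 ⟨b, hb, rfl⟩)),
      rfl⟩

/-- Induction over left multiplication by generators, in the form provided by `inv_comp`. -/
theorem exists_inv {i : Fin 8} {g : Isom3} (hg : g ∈ H a i) :
    ∃ b t, g = spIsom a b t ∧ inv i b fun j => (t j : ZMod 2) := by
  induction hg using Subgroup.closure_induction_left with
  | one => exact ⟨(1, 1), 0, spIsom_one.symm, by convert inv_one i using 2; simp; rfl⟩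
  | mul_left x hx y _ ih =>
    obtain ⟨b, t, rfl, h⟩ := ih
    obtain ⟨z, hz, rfl⟩ := exists_gens hx
    refine ⟨_, _, spIsom_mul _ _ _ _, ?_⟩
    rw [act_cast]
    exact inv_comp i z (List.mem_append_left _ hz) _ _ h
  | inv_mul_cancel x hx y _ ih =>
    obtain ⟨b, t, rfl, h⟩ := ih
    obtain ⟨z, hz, rfl⟩ := exists_gens hx
    refine ⟨_, _, by rw [spIsom_inv, spIsom_mul], ?_⟩
    rw [act_cast]
    exact inv_comp i _ (List.mem_append_right _ (List.mem_map.2 ⟨z, hz, rfl⟩)) _ _ h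

theorem exists_inv_of_fix (ha : a ≠ 0) {i : Fin 8} {g : Isom3} (hg : g ∈ H a i) (h0 : g 0 = 0) :
    ∃ b, g = spIsom a b 0 ∧ inv i b 0 := by
  obtain ⟨b, t, rfl, h⟩ := exists_inv hg
  rw [spIsom_zero_apply_zero, ← intVec_zero a] at h0
  obtain rfl := intVec_injective ha h0
  exact ⟨b, rfl, by convert h using 2; simp; rfl⟩

theorem spIsom_mem_closure {i : Fin 8} {b : SPerm} (hb : inv i b 0) (hp : b.act 0 (p i) = p i) :
    spIsom a b 0 ∈ closure (genG2 i) :=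
  spIsom_mem_of_words (fun c hc => subset_closure ((mem_genG2 a i _).2 ⟨c, hc, rfl⟩)) 4 b
    (mem_words_of_inv_of_act i b hb hp)

theorem mem_closure_of_fix (ha : a ≠ 0) {i : Fin 8} {g : Isom3} (hg : g ∈ H a i) (h0 : g 0 = 0)
    (hp : g (intVec a (p i)) = intVec a (p i)) : g ∈ closure (genG2 i) := by
  obtain ⟨b, rfl, hb⟩ := exists_inv_of_fix ha hg h0
  rw [spIsom_intVec] at hp
  exact spIsom_mem_closure hb (intVec_injective ha hp)

theorem le_H (i : Fin 8) : closure ({genR1 i} ∪ genG2 i) ≤ H a i :=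
  closure_mono (Set.union_subset_union_left _ (by simp))

theorem fix_zero {i : Fin 8} {g : Isom3} (hg : g ∈ closure ({genR1 i} ∪ genG2 i)) : g 0 = 0 := by
  refine (closure_le (K := pointStab 0)).2 ?_ hg
  rintro x (rfl | hx)
  · rw [genR1_eq 1 i]
    exact (spIsom_zero_apply_zero _ _).trans (intVec_zero _)
  · obtain ⟨b, hb, rfl⟩ := (mem_genG2 1 i x).1 hx
    exact (spIsom_zero_apply_zero _ _).trans (intVec_zero _)

/-- Some `h` generated by `R₁` and `G₂` moves the end point of the base edge to the same place as
`g` does; then `h⁻¹ * g` fixes both end points and lies in the group generated by `G₂`. -/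
theorem mem_stab_of_fix (ha : a ≠ 0) {i : Fin 8} {g : Isom3} (hg : g ∈ H a i) (h0 : g 0 = 0) :
    g ∈ closure ({genR1 i} ∪ genG2 i) := by
  obtain ⟨b, hgb, hb⟩ := exists_inv_of_fix ha hg h0
  have hl : ∀ c ∈ r1 i :: s i, spIsom a c 0 ∈ closure ({genR1 i} ∪ genG2 i) := by
    intro c hc
    rcases List.mem_cons.1 hc with rfl | hc
    · rw [← genR1_eq]; exact subset_closure (by simp)
    · exact subset_closure (Or.inr ((mem_genG2 a i _).2 ⟨c, hc, rfl⟩))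
  obtain ⟨h, hh, e⟩ := exists_of_mem_orbit (a := a) hl (p i) 8 _ (mem_orbit_of_inv i b hb)
  have hs : h⁻¹ * g ∈ closure (genG2 i) := by
    refine mem_closure_of_fix ha (mul_mem (inv_mem (le_H i hh)) hg) ?_ ?_
    · rw [isom_mul_apply, h0]
      exact (pointStab 0).inv_mem (fix_zero hh)
    · rw [isom_mul_apply, hgb, spIsom_intVec, ← e, isom_inv_apply_self]
  have := mul_mem hh (closure_mono Set.subset_union_right hs : _ ∈ closure ({genR1 i} ∪ genG2 i))
  rwa [mul_inv_cancel_left] at this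

theorem genG2_fix (i : Fin 8) {g : Isom3} (hg : g ∈ closure (genG2 i)) :
    g 0 = 0 ∧ g (intVec a (p i)) = intVec a (p i) := by
  refine ⟨fix_zero (closure_mono Set.subset_union_right hg),
    (closure_le (K := pointStab (intVec a (p i)))).2 ?_ hg⟩
  intro x hx
  obtain ⟨b, hb, rfl⟩ := (mem_genG2 a i x).1 hx
  change spIsom a b 0 _ = _
  rw [spIsom_intVec, s_act i b hb]

theorem card_closure_genG2 (i : Fin 8) : Nat.card (closure (genG2 i)) = r i := by
  -- The generators do not involve the scale parameter, so the value 1 serves for counting.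
  have hset : (closure (genG2 i) : Set Isom3) = (fun b => spIsom 1 b 0) ''
      ((Finset.univ.filter fun b => inv i b 0 ∧ b.act 0 (p i) = p i : Finset SPerm) :
        Set SPerm) := by
    ext g
    constructor
    · intro hg
      obtain ⟨h0, hp⟩ := genG2_fix (a := 1) i hg
      obtain ⟨b, rfl, hb⟩ := exists_inv_of_fix one_ne_zero
        (le_H (a := 1) i (closure_mono Set.subset_union_right hg)) h0
      rw [spIsom_intVec] at hp
      exact ⟨b, by simpa using ⟨hb, intVec_injective one_ne_zero hp⟩, rfl⟩
    · rintro ⟨b, hb, rfl⟩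
      rw [Finset.mem_coe, Finset.mem_filter] at hb
      exact spIsom_mem_closure hb.2.1 hb.2.2
  rw [← card_stab_edge i, ← Set.ncard_coe_finset,
    ← Set.ncard_image_of_injective _ (spIsom_injective one_ne_zero 0), ← hset]
  exact Nat.card_coe_set_eq _

theorem ncard_nbrs (ha : a ≠ 0) (i : Fin 8) :
    {u | ∃ h ∈ closure ({genR1 i} ∪ genG2 i), u = h (intVec a (p i))}.ncard = deg i := by
  have hset : {u | ∃ h ∈ closure ({genR1 i} ∪ genG2 i), u = h (intVec a (p i))} = intVec a ''
      (((Finset.univ.filter fun b => inv i b 0).image fun b : SPerm => b.act 0 (p i) :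
        Finset (Fin 3 → ℤ)) : Set (Fin 3 → ℤ)) := by
    ext u
    constructor
    · rintro ⟨h, hh, rfl⟩
      obtain ⟨b, rfl, hb⟩ := exists_inv_of_fix ha (le_H i hh) (fix_zero hh)
      rw [spIsom_intVec]
      exact ⟨_, by simpa using ⟨b.1, b.2, hb, rfl⟩, rfl⟩
    · rintro ⟨q, hq, rfl⟩
      rw [Finset.mem_coe, Finset.mem_image] at hq
      obtain ⟨b, hb, rfl⟩ := hq
      rw [Finset.mem_filter] at hb
      have hl : ∀ c ∈ r1 i :: s i, spIsom a c 0 ∈ closure ({genR1 i} ∪ genG2 i) := by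
        intro c hc
        rcases List.mem_cons.1 hc with rfl | hc
        · rw [← genR1_eq]; exact subset_closure (by simp)
        · exact subset_closure (Or.inr ((mem_genG2 a i _).2 ⟨c, hc, rfl⟩))
      obtain ⟨h, hh, e⟩ := exists_of_mem_orbit (a := a) hl (p i) 8 _ (mem_orbit_of_inv i b hb.2)
      exact ⟨h, hh, e.symm⟩
  rw [hset, Set.ncard_image_of_injective _ (intVec_injective ha), Set.ncard_coe_finset, card_nbrs]

theorem three_le_r (i : Fin 8) : 3 ≤ r i := by
  revert i; decide

theorem wythoffData (ha : a ≠ 0) (i : Fin 8) {n : ℕ} (c : ZMod n → Fin 3 → ℤ) (hn : 3 ≤ n)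
    (hc : ∀ j k, c j = c k → j = k) (h0 : c 0 = 0) (h1 : c 1 = p i)
    (hR₀ : ∀ j, (r0 i).act (p i) (c j) = c (1 - j)) (hR₁ : ∀ j, (r1 i).act 0 (c j) = c (-j))
    (hspan : ∀ w : E3, (∀ j, c j 0 * w 0 + c j 1 * w 1 + c j 2 * w 2 = 0) → w = 0) :
    WythoffData (genR0 a i) (genR1 i) (genG2 i) (fun j => intVec a (c j)) where
  three_le := hn
  inj := fun j k h => hc j k (intVec_injective ha h)
  R₀_v j := by rw [genR0_eq, spIsom_intVec, hR₀]
  R₁_v j := by rw [genR1_eq a, spIsom_intVec, hR₁]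
  S_v_zero g hg := by
    rw [h0, intVec_zero]; exact (genG2_fix (a := a) i (subset_closure hg)).1
  S_v_one g hg := by
    rw [h1]; exact (genG2_fix (a := a) i (subset_closure hg)).2
  stab_vertex g hg := by
    rw [h0, intVec_zero]; exact mem_stab_of_fix ha hg
  stab_edge g hg := by
    rw [h1]; exact mem_closure_of_fix ha (le_H i hg) (fix_zero hg)
  span := by
    refine affineSpan_eq_top_of_inner ⟨0, by dsimp only; rw [h0, intVec_zero]⟩ fun w hw =>
      hspan w fun j => ?_
    have := hw _ ⟨j, rfl⟩
    simp only [inner_E3, intVec_apply] at this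
    refine mul_left_cancel₀ ha ?_
    linear_combination this
  three_le_card := by
    rw [card_closure_genG2]; exact three_le_r i
  locallyFinite R := by
    refine (finite_intVec ha R).subset ?_
    rintro _ ⟨⟨g, hg, rfl⟩, hR⟩
    refine ⟨?_, hR⟩
    obtain ⟨b, t, rfl, -⟩ := exists_inv hg
    rw [h0, intVec_zero]
    exact ⟨t, spIsom_zero_apply_zero _ _⟩

theorem eq_zero_of_coords {w : E3} (h0 : w 0 = 0) (h1 : w 1 = 0) (h2 : w 2 = 0) : w = 0 := by
  ext j; fin_cases j <;> simp [h0, h1, h2]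

/-- The integral vertex lists are the orbits of the origin under `R₀` and `R₁`, listed in cyclic
order: skew quadrangles and skew hexagons. In each case three vertices besides the origin are
linearly independent. -/
theorem exists_wythoffData (ha : a ≠ 0) (i : Fin 8) : ∃ (n : ℕ) (v : ZMod n → E3),
    n = faceSize i ∧ v 0 = 0 ∧ v 1 = intVec a (p i) ∧
      WythoffData (genR0 a i) (genR1 i) (genG2 i) v := by
  have fin : ∀ (n : ℕ) (c : ZMod n → Fin 3 → ℤ), n = faceSize i → 3 ≤ n →
      (∀ j k, c j = c k → j = k) →
      c 0 = 0 → c 1 = p i → (∀ j, (r0 i).act (p i) (c j) = c (1 - j)) →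
      (∀ j, (r1 i).act 0 (c j) = c (-j)) →
      (∀ w : E3, (∀ j, c j 0 * w 0 + c j 1 * w 1 + c j 2 * w 2 = 0) → w = 0) →
      ∃ (n : ℕ) (v : ZMod n → E3), n = faceSize i ∧ v 0 = 0 ∧ v 1 = intVec a (p i) ∧
        WythoffData (genR0 a i) (genR1 i) (genG2 i) v := by
    intro n c hn hn' hc h0 h1 hR₀ hR₁ hspan
    refine ⟨n, fun j => intVec a (c j), hn, ?_, ?_, wythoffData ha i c hn' hc h0 h1 hR₀ hR₁ hspan⟩
    · dsimp only; rw [h0, intVec_zero]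
    · dsimp only; rw [h1]
  match i with
  | 0 =>
    -- `ZMod 4` unfolds to `Fin 4`, so the conditions on the vertex list can be decided.
    refine fin 4 (![![0, 0, 0], ![1, 0, 1], ![1, 1, 0], ![0, 1, 1]] : Fin 4 → Fin 3 → ℤ) rfl
      (by norm_num) (by change ∀ j k : Fin 4, _ → j = k; decide) (by decide) (by decide)
      (by change ∀ j : Fin 4, _; decide) (by change ∀ j : Fin 4, _; decide) fun w hw => ?_
    have h1 := hw (1 : Fin 4)
    have h2 := hw (2 : Fin 4)
    have h3 := hw (3 : Fin 4)
    simp at h1 h2 h3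
    exact eq_zero_of_coords (by linarith) (by linarith) (by linarith)
  | 1 | 2 =>
    refine fin 4 (![![0, 0, 0], ![1, -1, 1], ![2, 0, 0], ![1, 1, 1]] : Fin 4 → Fin 3 → ℤ) rfl
      (by norm_num) (by change ∀ j k : Fin 4, _ → j = k; decide) (by decide) (by decide)
      (by change ∀ j : Fin 4, _; decide) (by change ∀ j : Fin 4, _; decide) fun w hw => ?_
    have h1 := hw (1 : Fin 4)
    have h2 := hw (2 : Fin 4)
    have h3 := hw (3 : Fin 4)
    simp at h1 h2 h3
    exact eq_zero_of_coords (by linarith) (by linarith) (by linarith)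
  | 3 | 4 | 5 =>
    refine fin 6 (![![0, 0, 0], ![0, 1, 0], ![0, 1, -1], ![1, 1, -1], ![1, 0, -1], ![1, 0, 0]] :
      Fin 6 → Fin 3 → ℤ) rfl
      (by norm_num) (by change ∀ j k : Fin 6, _ → j = k; decide) (by decide) (by decide)
      (by change ∀ j : Fin 6, _; decide) (by change ∀ j : Fin 6, _; decide) fun w hw => ?_
    have h1 := hw (1 : Fin 6)
    have h2 := hw (2 : Fin 6)
    have h3 := hw (5 : Fin 6)
    simp at h1 h2 h3
    exact eq_zero_of_coords (by linarith) (by linarith) (by linarith)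
  | 6 =>
    refine fin 6 (![![0, 0, 0], ![1, -1, 1], ![0, -2, 2], ![-1, -1, 3], ![-2, 0, 2], ![-1, 1, 1]] :
      Fin 6 → Fin 3 → ℤ) rfl
      (by norm_num) (by change ∀ j k : Fin 6, _ → j = k; decide) (by decide) (by decide)
      (by change ∀ j : Fin 6, _; decide) (by change ∀ j : Fin 6, _; decide) fun w hw => ?_
    have h1 := hw (1 : Fin 6)
    have h2 := hw (2 : Fin 6)
    have h3 := hw (5 : Fin 6)
    simp at h1 h2 h3
    exact eq_zero_of_coords (by linarith) (by linarith) (by linarith)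
  | 7 =>
    refine fin 6 (![![0, 0, 0], ![1, 0, 1], ![0, -1, 1], ![0, 0, 2], ![-1, 0, 1], ![0, 1, 1]] :
      Fin 6 → Fin 3 → ℤ) rfl
      (by norm_num) (by change ∀ j k : Fin 6, _ → j = k; decide) (by decide) (by decide)
      (by change ∀ j : Fin 6, _; decide) (by change ∀ j : Fin 6, _; decide) fun w hw => ?_
    have h1 := hw (1 : Fin 6)
    have h2 := hw (3 : Fin 6)
    have h3 := hw (5 : Fin 6)
    simp at h1 h2 h3
    exact eq_zero_of_coords (by linarith) (by linarith) (by linarith)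

end K12

/-! ### Mirrors -/

theorem hasMirrorDim_of_submodule {R : Isom3} {c : E3} {W : Submodule ℝ E3}
    (h : ∀ x, R x = x ↔ x - c ∈ W) : HasMirrorDim R (Module.finrank ℝ W) := by
  refine ⟨AffineSubspace.mk' c W, ?_, AffineSubspace.mk'_nonempty _ _, by
    rw [AffineSubspace.direction_mk']⟩
  ext x
  rw [SetLike.mem_coe, AffineSubspace.mem_mk', vsub_eq_sub]
  exact (h x).symm

theorem hasMirrorDim_one {R : Isom3} {c d : E3} (hd : d ≠ 0)
    (h : ∀ x, R x = x ↔ ∃ k : ℝ, ∀ i, x i = c i + k * d i) : HasMirrorDim R 1 := by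
  rw [← finrank_span_singleton (K := ℝ) hd]
  refine hasMirrorDim_of_submodule (c := c) fun x => (h x).trans ?_
  rw [Submodule.mem_span_singleton]
  refine exists_congr fun k => ⟨fun H => ?_, fun H i => ?_⟩
  · ext i
    rw [PiLp.smul_apply, PiLp.sub_apply, H i, smul_eq_mul]; ring
  · have := congrArg (fun y : E3 => y i) H
    simp only [PiLp.smul_apply, PiLp.sub_apply, smul_eq_mul] at this
    linarith

theorem hasMirrorDim_two {R : Isom3} {n : E3} (hn : n ≠ 0)
    (h : ∀ x, R x = x ↔ inner ℝ n x = 0) : HasMirrorDim R 2 := by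
  have h3 : Fact (Module.finrank ℝ E3 = 2 + 1) := ⟨by simp⟩
  rw [← Submodule.finrank_orthogonal_span_singleton (𝕜 := ℝ) (n := 2) hn]
  refine hasMirrorDim_of_submodule (c := 0) fun x => (h x).trans ?_
  rw [Submodule.mem_orthogonal_singleton_iff_inner_right, sub_zero]

theorem SPerm.symm_act_act (c : SPerm) (q : Fin 3 → ℤ) : c.symm.act 0 (c.act 0 q) = q := by
  funext j
  have h : (c.2 (c.1⁻¹ j) : ℤ) * (c.2 (c.1⁻¹ j) : ℤ) = 1 := by
    rw [← Units.val_mul, Int.units_mul_self, Units.val_one]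
  simp only [act, symm, Equiv.Perm.inv_def, Equiv.apply_symm_apply, Int.cast_id, Pi.zero_apply,
    add_zero] at h ⊢
  linear_combination (q j) * h

namespace K12

variable {a : ℝ}

theorem hasMirrorDim_R₀ (a : ℝ) (i : Fin 8) : HasMirrorDim (genR0 a i) 1 := by
  -- The mirror is the line through `c` with direction `d`; the function `k` reads the parameter of
  -- a fixed point off one of its coordinates.
  have key : ∀ (b : SPerm) (t : E3) (c d : Fin 3 → ℝ) (k : E3 → ℝ), d ≠ 0 →
      (∀ x : E3, (∀ j, ((b.2 j : ℤ) : ℝ) * x (b.1 j) + t j = x j) →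
        ∀ j, x j = c j + k x * d j) →
      (∀ (x : E3) (k : ℝ), (∀ j, x j = c j + k * d j) →
        ∀ j, ((b.2 j : ℤ) : ℝ) * x (b.1 j) + t j = x j) →
      HasMirrorDim (signedPerm b.1 b.2 t) 1 := by
    intro b t c d k hd h h'
    refine hasMirrorDim_one (c := WithLp.toLp 2 c) (d := WithLp.toLp 2 d)
      (fun h => hd (by simpa using h)) fun x => ⟨fun hx => ⟨k x, h x fun j => ?_⟩, ?_⟩
    · rw [← signedPerm_apply, hx]
    · rintro ⟨k, hx⟩
      ext j
      rw [signedPerm_apply, h' x k hx]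
  have hd1 : (![0, 1, 0] : Fin 3 → ℝ) ≠ 0 := fun h => by simpa using congrFun h 1
  have hd2 : (![1, 1, 0] : Fin 3 → ℝ) ≠ 0 := fun h => by simpa using congrFun h 1
  have hd3 : (![1, 0, -1] : Fin 3 → ℝ) ≠ 0 := fun h => by simpa using congrFun h 0
  have hs : Equiv.swap (0 : Fin 3) 2 1 = 1 := by decide
  have hs' : Equiv.swap (0 : Fin 3) 1 2 = 2 := by decide
  match i with
  | 0 =>
    refine key (1, ![-1, 1, -1]) !₂[a, 0, a] ![a / 2, 0, a / 2] _ (fun x => x 1) hd1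
      (fun x hx j => ?_) fun x k hx j => ?_
    all_goals
      have h0 := hx 0
      have h1 := hx 1
      have h2 := hx 2
      simp at h0 h1 h2
      fin_cases j <;> simp <;> linarith
  | 1 | 2 =>
    refine key (Equiv.swap 0 1, ![1, 1, -1]) !₂[a, -a, a] ![a, 0, a / 2] _ (fun x => x 1) hd2
      (fun x hx j => ?_) fun x k hx j => ?_
    all_goals
      have h0 := hx 0
      have h1 := hx 1
      have h2 := hx 2
      simp [hs'] at h0 h1 h2
      fin_cases j <;> simp [hs'] <;> linarith
  | 3 | 4 | 5 =>
    refine key (Equiv.swap 0 2, ![-1, -1, -1]) !₂[0, a, 0] ![0, a / 2, 0] _ (fun x => x 0) hd3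
      (fun x hx j => ?_) fun x k hx j => ?_
    all_goals
      have h0 := hx 0
      have h1 := hx 1
      have h2 := hx 2
      simp [hs] at h0 h1 h2
      fin_cases j <;> simp [hs] <;> linarith
  | 6 =>
    refine key (Equiv.swap 0 2, ![-1, -1, -1]) !₂[a, -a, a] ![a, -a / 2, 0] _ (fun x => x 0 - a) hd3
      (fun x hx j => ?_) fun x k hx j => ?_
    all_goals
      have h0 := hx 0
      have h1 := hx 1
      have h2 := hx 2
      simp [hs] at h0 h1 h2
      fin_cases j <;> simp [hs] <;> linarith
  | 7 =>
    refine key (Equiv.swap 0 2, ![-1, -1, -1]) !₂[a, 0, a] ![a, 0, 0] _ (fun x => x 0 - a) hd3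
      (fun x hx j => ?_) fun x k hx j => ?_
    all_goals
      have h0 := hx 0
      have h1 := hx 1
      have h2 := hx 2
      simp [hs] at h0 h1 h2
      fin_cases j <;> simp [hs] <;> linarith

theorem hasMirrorDim_R₁ (i : Fin 8) : HasMirrorDim (genR1 i) 2 := by
  have key : ∀ (b : SPerm) (n : Fin 3 → ℝ), n ≠ 0 →
      (∀ x : E3, (∀ j, ((b.2 j : ℤ) : ℝ) * x (b.1 j) = x j) →
        n 0 * x 0 + n 1 * x 1 + n 2 * x 2 = 0) →
      (∀ x : E3, n 0 * x 0 + n 1 * x 1 + n 2 * x 2 = 0 →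
        ∀ j, ((b.2 j : ℤ) : ℝ) * x (b.1 j) = x j) →
      HasMirrorDim (signedPerm b.1 b.2 0) 2 := by
    intro b n hn h h'
    refine hasMirrorDim_two (n := WithLp.toLp 2 n) (fun h => hn (by simpa using h)) fun x => ?_
    rw [inner_E3]
    constructor
    · intro hx
      refine h x fun j => ?_
      have := signedPerm_apply b.1 b.2 0 x j
      rw [hx] at this
      simpa using this.symm
    · intro hx
      ext j
      rw [signedPerm_apply, h' x hx]
      simp
  have hs' : Equiv.swap (0 : Fin 3) 1 2 = 2 := by decide
  have h1 : HasMirrorDim (signedPerm 1 ![1, -1, 1] 0) 2 := by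
    refine key (1, ![1, -1, 1]) ![0, 1, 0] (fun h => by simpa using congrFun h 1)
      (fun x hx => ?_) fun x hx j => ?_
    · have h1 := hx 1
      simp at h1 ⊢
      linarith
    · simp at hx
      fin_cases j <;> simp [hx]
  have h2 : HasMirrorDim (signedPerm (Equiv.swap 0 1) ![1, 1, 1] 0) 2 := by
    refine key (Equiv.swap 0 1, ![1, 1, 1]) ![1, -1, 0] (fun h => by simpa using congrFun h 1)
      (fun x hx => ?_) fun x hx j => ?_
    · have h1 := hx 1
      simp at h1 ⊢
      linarith
    · simp at hx
      fin_cases j <;> simp [hs'] <;> linarith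
  match i with
  | 1 | 2 => exact h1
  | 0 | 3 | 4 | 5 | 6 | 7 => exact h2

/-! ### The special group -/

/-- The linear isometry given by a signed permutation. -/
noncomputable def lin (b : SPerm) : E3 ≃ₗᵢ[ℝ] E3 := (spIsom 1 b 0).linearIsometryEquiv

theorem spIsom_linear (b : SPerm) (t : Fin 3 → ℤ) :
    (spIsom a b t).linearIsometryEquiv = lin b := by
  ext x : 1
  have h1 := (spIsom a b t).map_vsub x 0
  have h2 := (spIsom 1 b 0).map_vsub x 0
  simp only [vsub_eq_sub, sub_zero] at h1 h2
  rw [lin, h1, h2]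
  ext j
  simp [spIsom, signedPerm_apply, intVec_zero]

theorem lin_apply (b : SPerm) (x : E3) (j : Fin 3) : lin b x j = ((b.2 j : ℤ) : ℝ) * x (b.1 j) := by
  have h2 := (spIsom 1 b 0).map_vsub x 0
  simp only [vsub_eq_sub, sub_zero] at h2
  rw [lin, h2]
  simp [spIsom, signedPerm_apply, intVec_zero]

theorem lin_comp (b c : SPerm) : lin (b.comp c) = lin b * lin c := by
  ext x j
  rw [LinearIsometryEquiv.coe_mul, Function.comp_apply, lin_apply, lin_apply, lin_apply]
  simp [SPerm.comp]; ring

theorem lin_mem_octahedralGroup (b : SPerm) : lin b ∈ octahedralGroup := by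
  have hsub : ∀ b : SPerm, ∀ x ∈ {x : E3 | ∀ i, x i = 1 ∨ x i = -1},
      lin b x ∈ {x : E3 | ∀ i, x i = 1 ∨ x i = -1} := by
    intro b x hx j
    rw [lin_apply]
    rcases Int.units_eq_one_or (b.2 j) with h | h <;> rcases hx (b.1 j) with h' | h' <;>
      simp [h, h']
  have hone : lin (1, 1) = 1 := by
    ext x j; simp [lin_apply]
  refine Set.Subset.antisymm (by rintro _ ⟨x, hx, rfl⟩; exact hsub b x hx) fun x hx => ?_
  refine ⟨lin b.symm x, hsub _ x hx, ?_⟩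
  have : lin b * lin b.symm = 1 := by rw [← lin_comp, SPerm.comp_symm, hone]
  exact DFunLike.congr_fun this x

/-- A basis vector is half the difference of two vertices of the cube, so its image has coordinates
in `{0, 1, -1}`; having norm 1, it is plus or minus a basis vector. -/
theorem octahedralGroup_apply_single {A : E3 ≃ₗᵢ[ℝ] E3} (hA : A ∈ octahedralGroup) (j : Fin 3) :
    ∃ (k : Fin 3) (e : ℤˣ), A (EuclideanSpace.single j 1) =
      ((e : ℤ) : ℝ) • EuclideanSpace.single k 1 := by
  have hA' : A '' {x : E3 | ∀ i, x i = 1 ∨ x i = -1} = {x : E3 | ∀ i, x i = 1 ∨ x i = -1} := hA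
  have hmem : ∀ x : E3, (∀ i, x i = 1 ∨ x i = -1) → ∀ i, A x i = 1 ∨ A x i = -1 := by
    intro x hx
    have : A x ∈ A '' {x : E3 | ∀ i, x i = 1 ∨ x i = -1} := ⟨x, hx, rfl⟩
    rw [hA'] at this
    exact this
  set w : E3 := WithLp.toLp 2 fun _ => 1 with hw
  set w' : E3 := w - (2 : ℝ) • EuclideanSpace.single j 1 with hw'
  have h1 := hmem w fun i => Or.inl rfl
  have h2 := hmem w' fun i => by
    by_cases h : i = j <;> (simp [hw', hw, h]; try norm_num)
  have h3 : ∀ i, A w' i = A w i - 2 * A (EuclideanSpace.single j 1) i := by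
    intro i
    rw [hw', map_sub, map_smul]; simp
  set y := A (EuclideanSpace.single j 1) with hy
  have hcoord : ∀ i, y i = 0 ∨ y i = 1 ∨ y i = -1 := by
    intro i
    have := h3 i
    rcases h1 i with h | h <;> rcases h2 i with h' | h' <;> rw [h, h'] at this
    · left; linarith
    · right; left; linarith
    · right; right; linarith
    · left; linarith
  have hnorm : y 0 ^ 2 + y 1 ^ 2 + y 2 ^ 2 = 1 := by
    have h : ‖y‖ = 1 := by rw [hy, A.norm_map]; simp
    have h' : inner ℝ y y = (1 : ℝ) := by rw [real_inner_self_eq_norm_sq, h]; norm_num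
    rw [inner_E3] at h'
    linarith
  have fin : ∀ (k : Fin 3) (e : ℤˣ), (∀ i, y i = if i = k then ((e : ℤ) : ℝ) else 0) →
      ∃ (k : Fin 3) (e : ℤˣ), y = ((e : ℤ) : ℝ) • EuclideanSpace.single k 1 := by
    intro k e h
    refine ⟨k, e, ?_⟩
    ext i
    rw [h i]
    simp
  rcases hcoord 0 with h0 | h0 | h0 <;> rcases hcoord 1 with h1 | h1 | h1 <;>
    rcases hcoord 2 with h2 | h2 | h2 <;> rw [h0, h1, h2] at hnorm <;> norm_num at hnorm
  · exact fin 2 1 (by simp [Fin.forall_fin_succ, h0, h1, h2])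
  · exact fin 2 (-1) (by simp [Fin.forall_fin_succ, h0, h1, h2])
  · exact fin 1 1 (by simp [Fin.forall_fin_succ, h0, h1, h2])
  · exact fin 1 (-1) (by simp [Fin.forall_fin_succ, h0, h1, h2])
  · exact fin 0 1 (by simp [Fin.forall_fin_succ, h0, h1, h2])
  · exact fin 0 (-1) (by simp [Fin.forall_fin_succ, h0, h1, h2])

/-- The coordinates of `A x` are the inner products of `x` with the vectors `A⁻¹ eᵢ`, which are
signed basis vectors; their orthogonality makes the index map injective. -/
theorem exists_lin_eq {A : E3 ≃ₗᵢ[ℝ] E3} (hA : A ∈ octahedralGroup) : ∃ b, A = lin b := by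
  choose σ ε h using octahedralGroup_apply_single (inv_mem hA)
  have happ : ∀ x i, A x i = ((ε i : ℤ) : ℝ) * x (σ i) := by
    intro x i
    have h1 : A x i = inner ℝ (EuclideanSpace.single i (1 : ℝ)) (A x) := by
      rw [EuclideanSpace.inner_single_left]; simp
    have h2 : (EuclideanSpace.single i (1 : ℝ) : E3) = A (A⁻¹ (EuclideanSpace.single i 1)) :=
      (A.apply_symm_apply _).symm
    rw [h1, h2, A.inner_map_map, h, inner_smul_left, EuclideanSpace.inner_single_left]
    simp
  have hinj : Function.Injective σ := by
    intro i j hij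
    by_contra hne
    have h1 : inner ℝ (A⁻¹ (EuclideanSpace.single i (1 : ℝ)) : E3)
        (A⁻¹ (EuclideanSpace.single j (1 : ℝ)) : E3) = 0 := by
      rw [LinearIsometryEquiv.inner_map_map, EuclideanSpace.inner_single_left]
      simp [hne]
    rw [h, h, hij, inner_smul_left, inner_smul_right, EuclideanSpace.inner_single_left] at h1
    rcases Int.units_eq_one_or (ε i) with h | h <;> rcases Int.units_eq_one_or (ε j) with h' | h'
      <;>
      simp [h, h'] at h1
  refine ⟨(Equiv.ofBijective σ (Finite.injective_iff_bijective.1 hinj), ε), ?_⟩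
  ext x i
  rw [happ, lin_apply]
  rfl

set_option maxRecDepth 100000 in
theorem inv_symm_comp (i : Fin 8) :
    ∀ b c, inv i b 0 → inv i c 0 → inv i (c.symm.comp b) 0 := by
  revert i; decide +kernel

/-- Choose `c` in the vertex stabilizer with the same effect as `b` on the end point of the base
edge. Then `c⁻¹ b` satisfies the invariant and fixes that end point, so it comes from `G₂`. -/
theorem spIsom_mem_H (ha : a ≠ 0) {i : Fin 8} {b : SPerm} (hb : inv i b 0) :
    spIsom a b 0 ∈ H a i := by
  have hl : ∀ c ∈ r1 i :: s i, spIsom a c 0 ∈ closure ({genR1 i} ∪ genG2 i) := by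
    intro c hc
    rcases List.mem_cons.1 hc with rfl | hc
    · rw [← genR1_eq]; exact subset_closure (by simp)
    · exact subset_closure (Or.inr ((mem_genG2 a i _).2 ⟨c, hc, rfl⟩))
  obtain ⟨h, hh, e⟩ := exists_of_mem_orbit (a := a) hl (p i) 8 _ (mem_orbit_of_inv i b hb)
  obtain ⟨c, rfl, hc⟩ := exists_inv_of_fix ha (le_H i hh) (fix_zero hh)
  have hact : ∀ d e : SPerm, (d.comp e).act (R := ℤ) 0 (p i) = d.act 0 (e.act 0 (p i)) := by
    intro d e
    funext j
    simp [SPerm.act, SPerm.comp, mul_assoc]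
  rw [spIsom_intVec] at e
  have e := intVec_injective ha e
  have hid : spIsom a c 0 * spIsom a (c.symm.comp b) 0 = spIsom a b 0 := by
    have h1 : spIsom a (c.symm.comp b) 0 = (spIsom a c 0)⁻¹ * spIsom a b 0 := by
      rw [spIsom_inv, spIsom_mul]
      congr 1
      funext j; simp [SPerm.act, SPerm.symmTrans]
    rw [h1, mul_inv_cancel_left]
  rw [← hid]
  refine mul_mem (le_H i hh) (closure_mono Set.subset_union_right
    (spIsom_mem_closure (inv_symm_comp i b c hb hc) ?_))
  rw [hact, ← e, SPerm.symm_act_act]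

/-- Each signed permutation is a product of linear parts of stabilizer elements and of `R₀`, by
`inv_or_inv_comp`. -/
theorem specialGroup_eq (ha : a ≠ 0) (i : Fin 8) : specialGroup (H a i) = octahedralGroup := by
  apply le_antisymm
  · rintro _ ⟨g, hg, rfl⟩
    obtain ⟨b, t, rfl, -⟩ := exists_inv hg
    rw [spIsom_linear]
    exact lin_mem_octahedralGroup b
  · intro A hA
    obtain ⟨b, rfl⟩ := exists_lin_eq hA
    have h1 : ∀ c, inv i c 0 → lin c ∈ specialGroup (H a i) := fun c hc =>
      ⟨_, spIsom_mem_H ha hc, spIsom_linear _ _⟩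
    rcases inv_or_inv_comp i b with h | ⟨c, hc, h⟩
    · exact h1 b h
    · have h0 : lin (r0 i) ∈ specialGroup (H a i) :=
        ⟨genR0 a i, subset_closure (by simp), by rw [genR0_eq, spIsom_linear]⟩
      have h2 := h1 _ h
      rw [lin_comp, lin_comp] at h2
      exact ((specialGroup (H a i)).mul_mem_cancel_left (h1 c hc)).1
        (((specialGroup (H a i)).mul_mem_cancel_left h0).1 h2)

/-! ### Combinatorial invariants -/

theorem complexK12_faces_ncard (ha : a ≠ 0) (i : Fin 8) {e : Sym2 E3}
    (he : e ∈ (complexK12 i a).edges) :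
    {P ∈ (complexK12 i a).faces | e ∈ P}.ncard = r i := by
  obtain ⟨n, v, -, h0, -, D⟩ := exists_wythoffData ha i
  rw [complexK12, ← h0] at he ⊢
  rw [D.faces_at_edge he, card_closure_genG2]

theorem complexK12_face_ncard (ha : a ≠ 0) (i : Fin 8) {P : Set (Sym2 E3)}
    (hP : P ∈ (complexK12 i a).faces) : P.ncard = faceSize i := by
  obtain ⟨n, v, hn, h0, -, D⟩ := exists_wythoffData ha i
  rw [complexK12, ← h0] at hP
  obtain ⟨g, -, rfl⟩ := D.mem_faces.1 hP
  rw [Set.ncard_image_of_injective _ (Sym2.map.injective g.injective), ← hn]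
  rw [← Set.image_univ, Set.ncard_image_of_injective _ (polygon_edge_injective D.three_le D.inj),
    Set.ncard_univ, Nat.card_zmod]

theorem complexK12_nbrs_ncard (ha : a ≠ 0) (i : Fin 8) {x : E3}
    (hx : x ∈ (complexK12 i a).verts) : ((complexK12 i a).nbrs x).ncard = deg i := by
  obtain ⟨n, v, -, h0, h1, D⟩ := exists_wythoffData ha i
  rw [complexK12, ← h0] at hx ⊢
  obtain ⟨g, hg, rfl⟩ := hx
  have : (wythoff (genR0 a i) (genR1 i) (genG2 i) (v 0)).nbrs (g (v 0)) =
      g '' {u | ∃ h ∈ closure ({genR1 i} ∪ genG2 i), u = h (intVec a (p i))} := by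
    ext u
    rw [D.mem_nbrs hg, ← h1]
    constructor
    · rintro ⟨h, hh, rfl⟩; exact ⟨_, ⟨h, hh, rfl⟩, rfl⟩
    · rintro ⟨_, ⟨h, hh, rfl⟩, rfl⟩; exact ⟨h, hh, rfl⟩
  change ((wythoff (genR0 a i) (genR1 i) (genG2 i) (v 0)).nbrs (g (v 0))).ncard = _
  rw [this, Set.ncard_image_of_injective _ g.injective, ncard_nbrs ha]

theorem invariants_injective (i j : Fin 8) (h1 : r i = r j) (h2 : deg i = deg j)
    (h3 : faceSize i = faceSize j) : i = j := by
  revert i j; decide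

/-- A similarity is injective on points, edges and faces, so it transports the counts of faces at an
edge, neighbors of a vertex and edges of a face. -/
theorem not_similar {b : ℝ} (ha : a ≠ 0) (hb : b ≠ 0) {i j : Fin 8} (hij : i ≠ j) :
    ¬ (complexK12 i a).Similar (complexK12 j b) := by
  rintro ⟨f, hf⟩
  have hinj : Function.Injective (Sym2.map f) := Sym2.map.injective f.injective
  have hinj' : Function.Injective fun P : Set (Sym2 E3) => Sym2.map f '' P :=
    Set.image_injective.2 hinj
  obtain ⟨n, v, -, h0, h1, D⟩ := exists_wythoffData ha i
  obtain ⟨hv, he, hP, -, -⟩ := D.baseFlag_mem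
  rw [h0] at hv he hP
  set e := (wythoffFlag (genR0 a i) (genR1 i) 0).2.1
  set P := (wythoffFlag (genR0 a i) (genR1 i) 0).2.2
  have hv' : f (0 : E3) ∈ (complexK12 j b).verts := by rw [← hf]; exact ⟨_, hv, rfl⟩
  have he' : Sym2.map f e ∈ (complexK12 j b).edges := by rw [← hf]; exact ⟨_, he, rfl⟩
  have hP' : Sym2.map f '' P ∈ (complexK12 j b).faces := by rw [← hf]; exact ⟨_, hP, rfl⟩
  refine hij (invariants_injective i j ?_ ?_ ?_)
  · rw [← complexK12_faces_ncard ha i he, ← complexK12_faces_ncard hb j he',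
      ← Set.ncard_image_of_injective _ hinj', ← hf]
    congr 1
    ext Q
    constructor
    · rintro ⟨Q, ⟨hQ, heQ⟩, rfl⟩
      exact ⟨⟨Q, hQ, rfl⟩, ⟨_, heQ, rfl⟩⟩
    · rintro ⟨⟨Q, hQ, rfl⟩, ⟨e', heQ, h⟩⟩
      rw [hinj h] at heQ
      exact ⟨Q, ⟨hQ, heQ⟩, rfl⟩
  · rw [← complexK12_nbrs_ncard ha i hv, ← complexK12_nbrs_ncard hb j hv',
      ← Set.ncard_image_of_injective _ f.injective, ← hf]
    congr 1
    ext u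
    constructor
    · rintro ⟨u, ⟨hu, hue⟩, rfl⟩
      exact ⟨fun h => hu (f.injective h), ⟨_, hue, by rw [Sym2.map_mk]; rfl⟩⟩
    · rintro ⟨hu, ⟨e', heQ, h⟩⟩
      obtain ⟨u, rfl⟩ := f.surjective u
      have h' : e' = s(u, 0) := hinj (by rw [h, Sym2.map_mk])
      rw [h'] at heQ
      exact ⟨u, ⟨fun h => hu (congrArg f h), heQ⟩, rfl⟩
  · rw [← complexK12_face_ncard ha i hP, ← complexK12_face_ncard hb j hP',
      Set.ncard_image_of_injective _ hinj]

/-- The eight complexes have the required properties. -/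
theorem complexK12_spec (i : Fin 8) (a : ℝ) (ha : a ≠ 0) :
    (complexK12 i a).IsSimplyFlagTransitive ∧
      (complexK12 i a).HasFiniteFaces ∧
      (complexK12 i a).HasMirrorVector 1 2 ∧
      ¬ (complexK12 i a).IsPolyhedron ∧
      (complexK12 i a).symmetryGroup =
        Subgroup.closure ({genR0 a i, genR1 i} ∪ genG2 i) ∧
      baseFlagK12 i a ∈ (complexK12 i a).flags ∧
      (complexK12 i a).G0 (baseFlagK12 i a) = Subgroup.zpowers (genR0 a i) ∧
      (complexK12 i a).G1 (baseFlagK12 i a) = Subgroup.zpowers (genR1 i) ∧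
      (complexK12 i a).G2 (baseFlagK12 i a) = Subgroup.closure (genG2 i) ∧
      specialGroup (complexK12 i a).symmetryGroup = octahedralGroup := by
  obtain ⟨n, v, -, h0, h1, D⟩ := exists_wythoffData ha i
  rw [complexK12, baseFlagK12, ← h0]
  refine ⟨D.isSimplyFlagTransitive, D.hasFiniteFaces, ⟨_, D.baseFlag_mem, _, _, D.G0_eq, D.G1_eq,
    hasMirrorDim_R₀ a i, hasMirrorDim_R₁ i⟩, D.not_isPolyhedron, D.symmetryGroup_eq, D.baseFlag_mem,
    D.G0_eq, D.G1_eq, D.G2_eq, ?_⟩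
  rw [D.symmetryGroup_eq]
  exact specialGroup_eq ha i

end K12

/-! ### Finite polygons: the two edges at a vertex -/

theorem IsFinitePolygon.exists_other_edge {F : Set (Sym2 E3)} (hF : IsFinitePolygon F) {o p : E3}
    (h : s(o, p) ∈ F) : o ≠ p ∧ ∃ q, q ≠ p ∧ s(o, q) ∈ F ∧ ∀ x, s(o, x) ∈ F → x = p ∨ x = q := by
  obtain ⟨n, hn, v, hv, rfl⟩ := hF
  have h2 := two_ne_zero_zmod hn
  have key : ∀ k, ∀ x, s(v k, x) ∈ Set.range (fun i => s(v i, v (i + 1))) →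
      x = v (k + 1) ∨ x = v (k - 1) := by
    rintro k x ⟨i, hi⟩
    dsimp only at hi
    rcases Sym2.eq_iff.1 hi with ⟨h1, rfl⟩ | ⟨rfl, h1⟩
    · rw [hv h1]; exact Or.inl rfl
    · right; congr 1; linear_combination hv h1
  have hne : ∀ k, v (k + 1) ≠ v (k - 1) := fun k h' => h2 (by linear_combination hv h')
  have hmem : ∀ k, s(v k, v (k - 1)) ∈ Set.range (fun i => s(v i, v (i + 1))) :=
    fun k => ⟨k - 1, by dsimp only; rw [sub_add_cancel, Sym2.eq_swap]⟩
  obtain ⟨i, hi⟩ := h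
  dsimp only at hi
  rcases Sym2.eq_iff.1 hi with ⟨rfl, rfl⟩ | ⟨rfl, rfl⟩
  · exact ⟨polygon_edge_ne hn hv i, v (i - 1), (hne i).symm, hmem i, key i⟩
  · refine ⟨(polygon_edge_ne hn hv i).symm, v (i + 1 + 1), ?_, ⟨i + 1, rfl⟩, fun x hx => ?_⟩
    · have := hne (i + 1); rwa [add_sub_cancel_right] at this
    · have := key (i + 1) x hx
      rw [add_sub_cancel_right] at this
      exact this.symm

/-- From an edge of `Q` walk around the polygon: the only other edge at the forward end point must
again belong to `Q`. -/
theorem IsFinitePolygon.subset_of_closed {F Q : Set (Sym2 E3)} (hF : IsFinitePolygon F)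
    (hQF : Q ⊆ F) (hne : Q.Nonempty) (hQ : ∀ e ∈ Q, ∀ x ∈ e, ∃ e' ∈ Q, e' ≠ e ∧ x ∈ e') :
    F ⊆ Q := by
  obtain ⟨n, hn, v, hv, rfl⟩ := hF
  have : NeZero n := ⟨by omega⟩
  obtain ⟨e, he⟩ := hne
  obtain ⟨k, rfl⟩ := hQF he
  rintro _ ⟨j, rfl⟩
  refine zmod_induction (p := fun j => s(v j, v (j + 1)) ∈ Q) k he (fun i hi => ?_) j
  obtain ⟨e', he', hne, hx⟩ := hQ _ hi (v (i + 1)) (Sym2.mem_mk_right _ _)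
  obtain ⟨l, rfl⟩ := hQF he'
  rcases (polygon_mem_edge hv l (i + 1)).1 hx with rfl | h
  · exact he'
  · exact absurd (by rw [add_right_cancel h]) hne

theorem IsFinitePolygon.finite {F : Set (Sym2 E3)} (hF : IsFinitePolygon F) : F.Finite := by
  obtain ⟨n, hn, v, hv, rfl⟩ := hF
  have : NeZero n := ⟨by omega⟩
  exact Set.finite_range _

theorem IsFinitePolygon.nonempty {F : Set (Sym2 E3)} (hF : IsFinitePolygon F) : F.Nonempty := by
  obtain ⟨n, hn, v, hv, rfl⟩ := hF
  exact ⟨_, 0, rfl⟩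

/-! ### Regular complexes as Wythoff constructions -/

/-- A simply flag-transitive complex of mirror vector `(1, 2)`, not a polyhedron, with finite faces,
together with a base flag and the generators of the stabilizers `G₀` and `G₁`. -/
structure FlagData (K : PolygonalFigure) (o p : E3) (F : Set (Sym2 E3)) (R₀ R₁ : Isom3) :
    Prop where
  simple : K.IsSimplyFlagTransitive
  fin : K.HasFiniteFaces
  not_poly : ¬ K.IsPolyhedron
  flag : (o, s(o, p), F) ∈ K.flags
  G0_eq : K.G0 (o, s(o, p), F) = zpowers R₀
  G1_eq : K.G1 (o, s(o, p), F) = zpowers R₁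
  dim_R₀ : HasMirrorDim R₀ 1
  dim_R₁ : HasMirrorDim R₁ 2

theorem exists_flagData {K : PolygonalFigure} (hK : K.IsSimplyFlagTransitive)
    (hfin : K.HasFiniteFaces) (hm : K.HasMirrorVector 1 2) (hp : ¬ K.IsPolyhedron) :
    ∃ o p F R₀ R₁, FlagData K o p F R₀ R₁ := by
  obtain ⟨⟨o, e, F⟩, hΦ, R₀, R₁, h0, h1, d0, d1⟩ := hm
  obtain ⟨p, rfl⟩ : ∃ p, e = s(o, p) := Sym2.mem_iff_exists.1 hΦ.2.2.2.1
  exact ⟨o, p, F, R₀, R₁, hK, hfin, hp, hΦ, h0, h1, d0, d1⟩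

namespace FlagData

variable {K : PolygonalFigure} {o p : E3} {F : Set (Sym2 E3)} {R₀ R₁ : Isom3}
  (D : FlagData K o p F R₀ R₁)

include D

theorem o_mem : o ∈ K.verts := D.flag.1

theorem e_mem : s(o, p) ∈ K.edges := D.flag.2.1

theorem F_mem : F ∈ K.faces := D.flag.2.2.1

theorem e_mem_F : s(o, p) ∈ F := D.flag.2.2.2.2

theorem polygon : IsFinitePolygon F := D.fin F D.F_mem

theorem o_ne_p : o ≠ p := (D.polygon.exists_other_edge D.e_mem_F).1

theorem exists_complex : ∃ r, 3 ≤ r ∧ K.IsComplexWith r := by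
  obtain ⟨⟨r, hr⟩, -⟩ := D.simple
  have h2 : r ≠ 2 := by rintro rfl; exact D.not_poly hr
  exact ⟨r, by have := hr.two_le; omega, hr⟩

theorem map_eq {g : Isom3} (hg : g ∈ K.symmetryGroup) : K.map g = K := hg.1

theorem map_vert {g : Isom3} (hg : g ∈ K.symmetryGroup) {x : E3} (hx : x ∈ K.verts) :
    g x ∈ K.verts := by
  rw [← D.map_eq hg]; exact ⟨x, hx, rfl⟩

theorem map_edge {g : Isom3} (hg : g ∈ K.symmetryGroup) {e : Sym2 E3} (he : e ∈ K.edges) :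
    Sym2.map g e ∈ K.edges := by
  rw [← D.map_eq hg]; exact ⟨e, he, rfl⟩

theorem map_face {g : Isom3} (hg : g ∈ K.symmetryGroup) {P : Set (Sym2 E3)} (hP : P ∈ K.faces) :
    Sym2.map g '' P ∈ K.faces := by
  rw [← D.map_eq hg]; exact ⟨P, hP, rfl⟩

theorem eq_one_of_fix {g : Isom3} (hg : g ∈ K.symmetryGroup) (ho : g o = o) (hp : g p = p)
    (hF : Sym2.map g '' F = F) : g = 1 := by
  obtain ⟨k, -, hk⟩ := D.simple.2 _ D.flag _ D.flag
  have h1 := hk g ⟨hg, by rw [flagImage, Sym2.map_mk, ho, hp, hF]⟩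
  have h2 := hk 1 ⟨one_mem _, flagImage_one _⟩
  rw [h1, h2]

theorem exists_map {x : E3} {e : Sym2 E3} {P : Set (Sym2 E3)} (h : (x, e, P) ∈ K.flags) :
    ∃ g ∈ K.symmetryGroup, g o = x ∧ Sym2.map g s(o, p) = e ∧ Sym2.map g '' F = P := by
  obtain ⟨g, ⟨hg, h⟩, -⟩ := D.simple.2 _ D.flag _ h
  exact ⟨g, hg, congrArg Prod.fst h, congrArg (fun Φ => Φ.2.1) h, congrArg (fun Φ => Φ.2.2) h⟩

theorem mem_G0 {g : Isom3} (hg : g ∈ zpowers R₀) :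
    g ∈ K.symmetryGroup ∧ Sym2.map g s(o, p) = s(o, p) ∧ Sym2.map g '' F = F := by
  rw [← D.G0_eq] at hg
  exact ⟨hg.1.1, hg.1.2, hg.2⟩

theorem mem_G1 {g : Isom3} (hg : g ∈ zpowers R₁) :
    g ∈ K.symmetryGroup ∧ g o = o ∧ Sym2.map g '' F = F := by
  rw [← D.G1_eq] at hg
  exact ⟨hg.1.1, hg.1.2, hg.2⟩

theorem R₀_mem : R₀ ∈ K.symmetryGroup := (D.mem_G0 (mem_zpowers _)).1

theorem R₁_mem : R₁ ∈ K.symmetryGroup := (D.mem_G1 (mem_zpowers _)).1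

theorem R₀_F : Sym2.map R₀ '' F = F := (D.mem_G0 (mem_zpowers _)).2.2

theorem R₁_F : Sym2.map R₁ '' F = F := (D.mem_G1 (mem_zpowers _)).2.2

theorem R₁_o : R₁ o = o := (D.mem_G1 (mem_zpowers _)).2.1

/-- If `R₀` fixed both end points, it would be 1 and `G₀` trivial. But flag-transitivity provides an
element of `G₀` taking the flag at `o` to the one at `p`. -/
theorem R₀_o_p : R₀ o = p ∧ R₀ p = o := by
  have he := (D.mem_G0 (mem_zpowers R₀)).2.1
  rw [Sym2.map_mk] at he
  rcases Sym2.eq_iff.1 he with ⟨h1, h2⟩ | h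
  · exfalso
    have h1 := D.eq_one_of_fix D.R₀_mem h1 h2 D.R₀_F
    have hp : p ∈ K.verts := by
      obtain ⟨r, -, hr⟩ := D.exists_complex
      exact hr.edge_verts _ D.e_mem p (Sym2.mem_mk_right _ _)
    obtain ⟨g, hg, hgo, hge, hgF⟩ := D.exists_map (x := p) (e := s(o, p)) (P := F)
      ⟨hp, D.e_mem, D.F_mem, Sym2.mem_mk_right _ _, D.e_mem_F⟩
    have : g ∈ zpowers R₀ := by rw [← D.G0_eq]; exact ⟨⟨hg, hge⟩, hgF⟩
    rw [h1, zpowers_one_eq_bot, mem_bot] at this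
    rw [this] at hgo
    exact D.o_ne_p hgo
  · exact h

theorem R₀_o : R₀ o = p := D.R₀_o_p.1

theorem R₀_p : R₀ p = o := D.R₀_o_p.2

theorem R₀_mul_self : R₀ * R₀ = 1 := by
  refine D.eq_one_of_fix (mul_mem D.R₀_mem D.R₀_mem) ?_ ?_ ?_
  · rw [isom_mul_apply, D.R₀_o, D.R₀_p]
  · rw [isom_mul_apply, D.R₀_p, D.R₀_o]
  · rw [face_map_mul, D.R₀_F, D.R₀_F]

/-- The two edges of the base face at the base vertex are interchanged by `R₁`. -/
theorem R₁_p : R₁ p ≠ p ∧ R₁ (R₁ p) = p ∧ s(o, R₁ p) ∈ F ∧ ∀ x, s(o, x) ∈ F → x = p ∨ x = R₁ p := by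
  obtain ⟨-, q, hqp, hq, hall⟩ := D.polygon.exists_other_edge D.e_mem_F
  have hedge : ∀ x, s(o, x) ∈ F → s(o, R₁ x) ∈ F := by
    intro x hx
    have : Sym2.map R₁ s(o, x) ∈ Sym2.map R₁ '' F := ⟨_, hx, rfl⟩
    rwa [Sym2.map_mk, D.R₁_F, D.R₁_o] at this
  have hpq : R₁ p = q := by
    rcases hall _ (hedge p D.e_mem_F) with h | h
    -- Otherwise `R₁` is 1 and `G₁` trivial, against transitivity on the two flags formed by `o`,
    -- `F` and an edge of `F` at `o`.
    · exfalso
      have h1 := D.eq_one_of_fix D.R₁_mem D.R₁_o h D.R₁_F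
      obtain ⟨r, -, hr⟩ := D.exists_complex
      obtain ⟨g, hg, hgo, hge, hgF⟩ := D.exists_map (x := o) (e := s(o, q)) (P := F)
        ⟨D.o_mem, hr.face_edges F D.F_mem hq, D.F_mem, Sym2.mem_mk_left _ _, hq⟩
      have : g ∈ zpowers R₁ := by rw [← D.G1_eq]; exact ⟨⟨hg, hgo⟩, hgF⟩
      rw [h1, zpowers_one_eq_bot, mem_bot] at this
      rw [this, edge_map_one, Sym2.congr_right] at hge
      exact hqp hge.symm
    · exact h
  have hqq : R₁ q = p := by
    rcases hall _ (hedge q hq) with h | h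
    · exact h
    · exact absurd (R₁.injective (h.trans hpq.symm)) hqp
  rw [hpq]
  exact ⟨hqp, hqq, hq, hall⟩

theorem R₁_mul_self : R₁ * R₁ = 1 := by
  refine D.eq_one_of_fix (mul_mem D.R₁_mem D.R₁_mem) ?_ ?_ ?_
  · rw [isom_mul_apply, D.R₁_o, D.R₁_o]
  · rw [isom_mul_apply, D.R₁_p.2.1]
  · rw [face_map_mul, D.R₁_F, D.R₁_F]

/-- The orbit of the base edge under the face group lies in the polygon, and it continues at every
end point: at `g o` with the image of the base edge under `g * R₁`, and at `g p` after replacing `g`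
by `g * R₀`. Hence it is the whole polygon. -/
theorem face_eq : F = (wythoffFlag R₀ R₁ o).2.2 := by
  have hpres : ∀ g ∈ closure {R₀, R₁}, Sym2.map g '' F = F := by
    intro g hg
    refine (closure_le (K := polygonStab F)).2 ?_ hg
    rintro x (rfl | rfl)
    · exact D.R₀_F
    · exact D.R₁_F
  have hsub : (wythoffFlag R₀ R₁ o).2.2 ⊆ F := by
    rintro _ ⟨g, hg, rfl⟩
    rw [← hpres g hg, D.R₀_o]
    exact ⟨_, D.e_mem_F, rfl⟩
  have h0 : R₀ ∈ closure {R₀, R₁} := subset_closure (by simp)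
  have h1 : R₁ ∈ closure {R₀, R₁} := subset_closure (by simp)
  refine Set.Subset.antisymm (D.polygon.subset_of_closed hsub ⟨_, 1, one_mem _, rfl⟩ ?_) hsub
  rintro _ ⟨g, hg, rfl⟩ x hx
  have key : ∀ g ∈ closure {R₀, R₁}, ∃ e' ∈ (wythoffFlag R₀ R₁ o).2.2,
      e' ≠ Sym2.map g s(o, p) ∧ g o ∈ e' := by
    intro g hg
    refine ⟨_, ⟨g * R₁, mul_mem hg h1, rfl⟩, ?_, ?_⟩
    · rw [D.R₀_o, edge_map_mul]
      intro h
      have := Sym2.map.injective g.injective h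
      rw [Sym2.map_mk, D.R₁_o, Sym2.congr_right] at this
      exact D.R₁_p.1 this
    · rw [edge_map_mul, mem_edge_map, Sym2.map_mk, D.R₁_o]
      exact Sym2.mem_mk_left _ _
  rw [D.R₀_o] at hx ⊢
  rw [Sym2.map_mk, Sym2.mem_iff] at hx
  rcases hx with rfl | rfl
  · exact key g hg
  · obtain ⟨e', he', hne, hx⟩ := key (g * R₀) (mul_mem hg h0)
    rw [isom_mul_apply, D.R₀_o] at hx
    rw [edge_map_mul, Sym2.map_mk R₀, D.R₀_o, D.R₀_p, Sym2.eq_swap] at hne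
    exact ⟨e', he', hne, hx⟩

/-- The stabilizer of the base vertex and the base edge. -/
theorem mem_G2 {g : Isom3} :
    g ∈ K.G2 (o, s(o, p), F) ↔ g ∈ K.symmetryGroup ∧ g o = o ∧ g p = p := by
  constructor
  · rintro ⟨⟨hg, ho⟩, he⟩
    replace ho : g o = o := ho
    replace he : Sym2.map g s(o, p) = s(o, p) := he
    rw [Sym2.map_mk, ho, Sym2.congr_right] at he
    exact ⟨hg, ho, he⟩
  · rintro ⟨hg, ho, hp⟩
    refine ⟨⟨hg, ho⟩, ?_⟩
    change Sym2.map g s(o, p) = s(o, p)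
    rw [Sym2.map_mk, ho, hp]

theorem exists_G2_of_face {P : Set (Sym2 E3)} (hP : P ∈ K.faces) (he : s(o, p) ∈ P) :
    ∃ g ∈ K.G2 (o, s(o, p), F), Sym2.map g '' F = P := by
  obtain ⟨g, hg, hgo, hge, hgF⟩ := D.exists_map (x := o) (e := s(o, p)) (P := P)
    ⟨D.o_mem, D.e_mem, hP, Sym2.mem_mk_left _ _, he⟩
  exact ⟨g, ⟨⟨hg, hgo⟩, hge⟩, hgF⟩

/-- Besides the identity, `G₂` has at least two elements. -/
theorem exists_two_G2 : ∃ g ∈ K.G2 (o, s(o, p), F), ∃ h ∈ K.G2 (o, s(o, p), F),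
    g ≠ 1 ∧ h ≠ 1 ∧ g ≠ h := by
  obtain ⟨r, hr3, hr⟩ := D.exists_complex
  have hcard := hr.faces_at_edge _ D.e_mem
  have h2 : 2 < {P ∈ K.faces | s(o, p) ∈ P}.ncard := by omega
  have hfin : {P ∈ K.faces | s(o, p) ∈ P}.Finite := Set.finite_of_ncard_pos (by omega)
  have h1 : ∃ P ∈ {P ∈ K.faces | s(o, p) ∈ P}, ∃ Q ∈ {P ∈ K.faces | s(o, p) ∈ P},
      P ≠ F ∧ Q ≠ F ∧ P ≠ Q := by
    obtain ⟨A, hA, B, hB, C, hC, hAB, hAC, hBC⟩ := (Set.two_lt_ncard hfin).1 h2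
    by_cases hAF : A = F
    · exact ⟨B, hB, C, hC, fun h => hAB (hAF.trans h.symm), fun h => hAC (hAF.trans h.symm), hBC⟩
    · by_cases hBF : B = F
      · exact ⟨A, hA, C, hC, hAF, fun h => hBC (hBF.trans h.symm), hAC⟩
      · exact ⟨A, hA, B, hB, hAF, hBF, hAB⟩
  obtain ⟨P, hP, Q, hQ, hPF, hQF, hPQ⟩ := h1
  obtain ⟨g, hg, rfl⟩ := D.exists_G2_of_face hP.1 hP.2
  obtain ⟨h, hh, rfl⟩ := D.exists_G2_of_face hQ.1 hQ.2
  refine ⟨g, hg, h, hh, ?_, ?_, ?_⟩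
  · rintro rfl; exact hPF (face_map_one F)
  · rintro rfl; exact hQF (face_map_one F)
  · rintro rfl; exact hPQ rfl

theorem gen_le : closure ({R₀, R₁} ∪ (K.G2 (o, s(o, p), F) : Set Isom3)) ≤ K.symmetryGroup := by
  rw [closure_le]
  rintro x ((rfl | rfl) | hx)
  · exact D.R₀_mem
  · exact D.R₁_mem
  · exact (D.mem_G2.1 hx).1

/-- Follow a path in the connected vertex-figure. If `h p` has been reached and the next step runs
through the face `P`, then `P` is the image of `F` under `h * g` for some `g` in `G₂`, and the step
ends at the image of `p` under `h * g * R₁`. -/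
theorem exists_nbr {u : E3} (hu : u ∈ K.nbrs o) :
    ∃ h ∈ closure ({R₀, R₁} ∪ (K.G2 (o, s(o, p), F) : Set Isom3)), h o = o ∧ h p = u := by
  set H := closure ({R₀, R₁} ∪ (K.G2 (o, s(o, p), F) : Set Isom3)) with hH
  obtain ⟨r, -, hr⟩ := D.exists_complex
  have hp : p ∈ K.nbrs o := ⟨D.o_ne_p.symm, by rw [Sym2.eq_swap]; exact D.e_mem⟩
  have hreach := (hr.vertexFigure_connected o D.o_mem).preconnected ⟨p, hp⟩ ⟨u, hu⟩
  rw [SimpleGraph.reachable_iff_reflTransGen] at hreach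
  have key : ∀ w : K.nbrs o, Relation.ReflTransGen (K.vertexFigure o).Adj ⟨p, hp⟩ w →
      ∃ h ∈ H, h o = o ∧ h p = w := by
    intro w hw
    induction hw with
    | refl => exact ⟨1, one_mem _, rfl, rfl⟩
    | @tail b c _ hbc ih =>
      obtain ⟨h, hh, ho, hb⟩ := ih
      obtain ⟨hne, P, hP, h1, h2⟩ := hbc
      have hhG := D.gen_le hh
      have hP' : Sym2.map (h⁻¹ : Isom3) '' P ∈ K.faces := D.map_face (inv_mem hhG) hP
      have he' : s(o, p) ∈ Sym2.map (h⁻¹ : Isom3) '' P := by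
        rw [mem_face_map, inv_inv, Sym2.map_mk, ho, hb, Sym2.eq_swap]; exact h1
      obtain ⟨g, hg, hgF⟩ := D.exists_G2_of_face hP' he'
      have hgo := (D.mem_G2.1 hg).2.1
      have hgp := (D.mem_G2.1 hg).2.2
      have hPF : P = Sym2.map (h * g : Isom3) '' F := by
        rw [face_map_mul, hgF, ← face_map_mul, mul_inv_cancel, face_map_one]
      rw [hPF, mem_face_map, Sym2.map_mk] at h2
      have hfix : (h * g)⁻¹ o = o := (pointStab o).inv_mem
        (show (h * g) o = o by rw [isom_mul_apply, hgo, ho])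
      rw [hfix] at h2
      refine ⟨h * g * R₁, mul_mem (mul_mem hh (subset_closure (Or.inr hg)))
        (subset_closure (by simp)), ?_, ?_⟩
      · rw [isom_mul_apply, D.R₁_o, isom_mul_apply, hgo, ho]
      · rcases D.R₁_p.2.2.2 _ h2 with h3 | h3
        · exfalso
          apply hne
          apply Subtype.ext
          rw [← hb, ← isom_apply_inv_self (h * g) c, h3, isom_mul_apply, hgp]
        · rw [isom_mul_apply, ← h3, isom_apply_inv_self]
  exact key _ hreach

/-- Follow a path in the connected edge graph, moving each step back to the base vertex, where
`exists_nbr` applies. -/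
theorem exists_vert {x : E3} (hx : x ∈ K.verts) :
    ∃ h ∈ closure ({R₀, R₁} ∪ (K.G2 (o, s(o, p), F) : Set Isom3)), h o = x := by
  set H := closure ({R₀, R₁} ∪ (K.G2 (o, s(o, p), F) : Set Isom3)) with hH
  obtain ⟨r, -, hr⟩ := D.exists_complex
  have hreach := hr.connected.preconnected ⟨o, D.o_mem⟩ ⟨x, hx⟩
  rw [SimpleGraph.reachable_iff_reflTransGen] at hreach
  have key : ∀ w : K.verts, Relation.ReflTransGen K.edgeGraph.Adj ⟨o, D.o_mem⟩ w →
      ∃ h ∈ H, h o = w := by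
    intro w hw
    induction hw with
    | refl => exact ⟨1, one_mem _, rfl⟩
    | @tail b c _ hbc ih =>
      obtain ⟨h, hh, hb⟩ := ih
      have hn : h⁻¹ (c : E3) ∈ K.nbrs o := by
        refine ⟨fun h' => hbc.1 (Subtype.ext ?_), ?_⟩
        · rw [← hb, ← h', isom_apply_inv_self]
        · have := D.map_edge (inv_mem (D.gen_le hh)) hbc.2
          rwa [Sym2.map_mk, ← hb, isom_inv_apply_self, Sym2.eq_swap] at this
      obtain ⟨k, hk, -, hkp⟩ := D.exists_nbr hn
      refine ⟨h * (k * R₀), mul_mem hh (mul_mem hk (subset_closure (by simp))), ?_⟩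
      rw [isom_mul_apply, isom_mul_apply, D.R₀_o, hkp, isom_apply_inv_self]
  exact key _ hreach

theorem edge_ne {x y : E3} (h : s(x, y) ∈ K.edges) : x ≠ y := by
  obtain ⟨r, hr3, hr⟩ := D.exists_complex
  have : {P ∈ K.faces | s(x, y) ∈ P}.Nonempty := by
    rw [← Set.ncard_pos (Set.finite_of_ncard_pos (by rw [hr.faces_at_edge _ h]; omega)),
      hr.faces_at_edge _ h]
    omega
  obtain ⟨P, hP, he⟩ := this
  exact ((D.fin P hP).exists_other_edge he).1

theorem exists_edge {e : Sym2 E3} (he : e ∈ K.edges) :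
    ∃ h ∈ closure ({R₀, R₁} ∪ (K.G2 (o, s(o, p), F) : Set Isom3)), Sym2.map h s(o, p) = e := by
  obtain ⟨r, -, hr⟩ := D.exists_complex
  induction e with | _ x y =>
  obtain ⟨h, hh, rfl⟩ := D.exists_vert (hr.edge_verts _ he x (Sym2.mem_mk_left _ _))
  have hn : h⁻¹ y ∈ K.nbrs o := by
    refine ⟨fun h' => D.edge_ne he ?_, ?_⟩
    · rw [← h', isom_apply_inv_self]
    · have := D.map_edge (inv_mem (D.gen_le hh)) he
      rwa [Sym2.map_mk, isom_inv_apply_self, Sym2.eq_swap] at this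
  obtain ⟨k, hk, hko, hkp⟩ := D.exists_nbr hn
  exact ⟨h * k, mul_mem hh hk, by
    rw [edge_map_mul, Sym2.map_mk, hko, hkp, Sym2.map_mk, isom_apply_inv_self]⟩

theorem exists_face {P : Set (Sym2 E3)} (hP : P ∈ K.faces) :
    ∃ h ∈ closure ({R₀, R₁} ∪ (K.G2 (o, s(o, p), F) : Set Isom3)), Sym2.map h '' F = P := by
  obtain ⟨r, -, hr⟩ := D.exists_complex
  obtain ⟨e, he⟩ := (D.fin P hP).nonempty
  obtain ⟨h, hh, rfl⟩ := D.exists_edge (hr.face_edges P hP he)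
  obtain ⟨g, hg, hgF⟩ := D.exists_G2_of_face (P := Sym2.map (h⁻¹ : Isom3) '' P)
    (D.map_face (inv_mem (D.gen_le hh)) hP) (by rw [mem_face_map, inv_inv]; exact he)
  exact ⟨h * g, mul_mem hh (subset_closure (Or.inr hg)), by
    rw [face_map_mul, hgF, ← face_map_mul, mul_inv_cancel, face_map_one]⟩

/-- A regular complex is obtained by Wythoff's construction from its distinguished generators. -/
theorem eq_wythoff : K = wythoff R₀ R₁ (K.G2 (o, s(o, p), F)) o := by
  have he : (wythoffFlag R₀ R₁ o).2.1 = s(o, p) := by rw [← D.R₀_o]; rfl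
  refine PolygonalFigure.ext ?_ ?_ ?_
  · ext x
    constructor
    · intro hx
      obtain ⟨h, hh, rfl⟩ := D.exists_vert hx
      exact ⟨h, hh, rfl⟩
    · rintro ⟨h, hh, rfl⟩
      exact D.map_vert (D.gen_le hh) D.o_mem
  · ext e
    constructor
    · intro hx
      obtain ⟨h, hh, rfl⟩ := D.exists_edge hx
      exact ⟨h, hh, by rw [he]⟩
    · rintro ⟨h, hh, rfl⟩
      rw [he]
      exact D.map_edge (D.gen_le hh) D.e_mem
  · ext P
    constructor
    · intro hx
      obtain ⟨h, hh, rfl⟩ := D.exists_face hx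
      exact ⟨h, hh, by rw [← D.face_eq]⟩
    · rintro ⟨h, hh, rfl⟩
      rw [← D.face_eq]
      exact D.map_face (D.gen_le hh) D.F_mem

end FlagData

/-! ### Linear isometries of Euclidean 3-space -/

theorem finrank_E3 : Module.finrank ℝ E3 = 3 := by simp

theorem det_adjoint_E3 (f : E3 →ₗ[ℝ] E3) :
    LinearMap.det (LinearMap.adjoint f) = LinearMap.det f := by
  have b := EuclideanSpace.basisFun (Fin 3) ℝ
  rw [← LinearMap.det_toMatrix b.toBasis, LinearMap.toMatrix_adjoint,
    ← LinearMap.det_toMatrix b.toBasis f, Matrix.det_conjTranspose]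
  simp

theorem LinearMap.exists_ne_zero_of_det_eq_zero_E3 {f : E3 →ₗ[ℝ] E3} (h : LinearMap.det f = 0) :
    ∃ u, u ≠ 0 ∧ f u = 0 := by
  have := LinearMap.bot_lt_ker_of_det_eq_zero h
  obtain ⟨u, hu, hu0⟩ := Submodule.exists_mem_ne_zero_of_ne_bot this.ne'
  exact ⟨u, hu0, hu⟩

/-- A linear isometry of 3-space has an eigenvector with eigenvalue `1` or `-1`. -/
theorem LinearIsometryEquiv.exists_eigenvector_E3 (A : E3 ≃ₗᵢ[ℝ] E3) :
    ∃ u, u ≠ 0 ∧ (A u = u ∨ A u = -u) := by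
  set f : E3 →ₗ[ℝ] E3 := (A.toLinearEquiv : E3 →ₗ[ℝ] E3) with hf
  have hadj : LinearMap.adjoint f * f = 1 := by
    ext1 x
    refine ext_inner_left ℝ fun y => ?_
    rw [Module.End.mul_apply, LinearMap.adjoint_inner_right]
    exact A.inner_map_map y x
  have hdet : LinearMap.det f * LinearMap.det f = 1 := by
    have := congrArg LinearMap.det hadj
    rwa [map_mul, det_adjoint_E3, map_one] at this
  have hadj1 : LinearMap.adjoint (1 : E3 →ₗ[ℝ] E3) = 1 := LinearMap.adjoint_id
  -- For an isometry `f - 1 = -(f - 1)ᵀ f` and `f + 1 = (f + 1)ᵀ f`. In odd dimension the first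
  -- makes `det (f - 1)` vanish when `det f = 1`, and the second makes `det (f + 1)` vanish when
  -- `det f = -1`.
  have hm : LinearMap.det (f - 1) = -(LinearMap.det (f - 1) * LinearMap.det f) := by
    have h1 : f - 1 = (-(LinearMap.adjoint (f - 1))) * f := by
      have hs : LinearMap.adjoint (f - 1) = LinearMap.adjoint f - LinearMap.adjoint 1 := by
        rw [eq_sub_iff_add_eq, ← LinearEquiv.map_add, sub_add_cancel]
      rw [hs, neg_mul, sub_mul, hadj, hadj1, one_mul]; abel
    conv_lhs => rw [h1, map_mul, ← neg_one_smul ℝ, LinearMap.det_smul, det_adjoint_E3, finrank_E3]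
    ring
  have hp : LinearMap.det (f + 1) = LinearMap.det (f + 1) * LinearMap.det f := by
    have h1 : f + 1 = (LinearMap.adjoint (f + 1)) * f := by
      rw [LinearEquiv.map_add, add_mul, hadj, hadj1, one_mul]; abel
    conv_lhs => rw [h1, map_mul, det_adjoint_E3]
  rcases mul_self_eq_one_iff.1 hdet with h | h
  · rw [h, mul_one] at hm
    obtain ⟨u, hu, h0⟩ := LinearMap.exists_ne_zero_of_det_eq_zero_E3
      (f := f - 1) (by linarith)
    exact ⟨u, hu, Or.inl (sub_eq_zero.1 h0)⟩
  · rw [h] at hp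
    obtain ⟨u, hu, h0⟩ := LinearMap.exists_ne_zero_of_det_eq_zero_E3
      (f := f + 1) (by linarith)
    exact ⟨u, hu, Or.inr (eq_neg_of_add_eq_zero_left h0)⟩

theorem smul_eq_of_norm_eq {u : E3} {k : ℝ} (h : ‖k • u‖ = ‖u‖) : k • u = u ∨ k • u = -u := by
  rcases eq_or_ne u 0 with rfl | hu
  · simp
  · rw [norm_smul, mul_eq_right₀ (norm_ne_zero_iff.2 hu), Real.norm_eq_abs] at h
    rcases eq_or_eq_neg_of_abs_eq h with rfl | rfl
    · simp
    · simp

theorem finrank_span_pair {u x : E3} (hu : u ≠ 0) (hx : ∀ k : ℝ, x ≠ k • u) :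
    Module.finrank ℝ (Submodule.span ℝ {u, x}) = 2 := by
  have hli : LinearIndependent ℝ ![u, x] :=
    (LinearIndependent.pair_iff' hu).2 fun k hk => hx k hk.symm
  have := finrank_span_eq_card hli
  have hr : Set.range ![u, x] = {u, x} := by
    simp only [Matrix.range_cons, Matrix.range_empty, Set.union_empty]; rfl
  rwa [hr, Fintype.card_fin] at this

/-- A linear isometry fixing two independent vectors is determined by a sign. -/
theorem exists_normal_of_pair {u x : E3} (hu : u ≠ 0) (hx : ∀ k : ℝ, x ≠ k • u) :
    ∃ w : E3, w ≠ 0 ∧ (∀ A : E3 ≃ₗᵢ[ℝ] E3, A u = u → A x = x → A w = w ∨ A w = -w) ∧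
      ∀ A B : E3 ≃ₗᵢ[ℝ] E3, A u = u → A x = x → B u = u → B x = x → A w = B w → A = B := by
  set S := Submodule.span ℝ ({u, x} : Set E3) with hS
  have h1 : Module.finrank ℝ Sᗮ = 1 := by
    have := S.finrank_add_finrank_orthogonal
    rw [finrank_span_pair hu hx, finrank_E3] at this
    omega
  obtain ⟨⟨w, hwS⟩, hw0, hw⟩ := finrank_eq_one_iff'.1 h1
  have hfix : ∀ A : E3 ≃ₗᵢ[ℝ] E3, A u = u → A x = x → ∀ y ∈ S, A y = y := by
    intro A hAu hAx y hy
    refine Submodule.span_induction ?_ (map_zero A) ?_ ?_ hy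
    · rintro z (rfl | rfl)
      · exact hAu
      · exact hAx
    · intro a b _ _ ha hb; rw [map_add, ha, hb]
    · intro k a _ ha; rw [map_smul, ha]
  refine ⟨w, fun h => hw0 (Subtype.ext h), ?_, ?_⟩
  · intro A hAu hAx
    have hmem : A w ∈ Sᗮ := by
      rw [Submodule.mem_orthogonal]
      intro y hy
      rw [← hfix A hAu hAx y hy, A.inner_map_map]
      exact hwS y hy
    obtain ⟨k, hk⟩ := hw ⟨A w, hmem⟩
    have hk' : k • w = A w := congrArg Subtype.val hk
    rw [← hk']
    exact smul_eq_of_norm_eq (by rw [hk', A.norm_map])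
  · intro A B hAu hAx hBu hBx hAB
    ext1 z
    obtain ⟨y, hy, y', hy', rfl⟩ := S.exists_add_mem_mem_orthogonal z
    obtain ⟨k, hk⟩ := hw ⟨y', hy'⟩
    have hk' : k • w = y' := congrArg Subtype.val hk
    rw [map_add, map_add, hfix A hAu hAx y hy, hfix B hBu hBx y hy, ← hk', map_smul, map_smul, hAB]

/-! ### Linear isometries close to the identity -/

/-- The linear isometry `A` is within `ε` of the identity, in the operator norm. -/
def NearOne (ε : ℝ) (A : E3 ≃ₗᵢ[ℝ] E3) : Prop := ∀ x, ‖A x - x‖ ≤ ε * ‖x‖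

namespace NearOne

/-- With `y = A⁻¹ B⁻¹ x`, the difference in question is `(AB - BA) y`, and `AB - BA = (A - 1)(B - 1)
- (B - 1)(A - 1)`. -/
theorem commutator {ε δ : ℝ} {A B : E3 ≃ₗᵢ[ℝ] E3} (hA : NearOne ε A) (hB : NearOne δ B)
    (hε : 0 ≤ ε) (hδ : 0 ≤ δ) : NearOne (2 * ε * δ) (A * B * A⁻¹ * B⁻¹) := by
  intro x
  set y := A⁻¹ (B⁻¹ x) with hy
  have hx : x = B (A y) := by
    change x = B (A (A.symm (B.symm x))); simp
  have hn : ‖x‖ = ‖y‖ := by rw [hx, B.norm_map, A.norm_map]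
  have h1 : (A * B * A⁻¹ * B⁻¹) x - x = (A (B y - y) - (B y - y)) - (B (A y - y) - (A y - y)) := by
    have : (A * B * A⁻¹ * B⁻¹) x = A (B y) := rfl
    rw [this, hx, map_sub, map_sub]; abel
  rw [h1, hn]
  refine (norm_sub_le _ _).trans ?_
  have h2 := (hA (B y - y)).trans (mul_le_mul_of_nonneg_left (hB y) hε)
  have h3 := (hB (A y - y)).trans (mul_le_mul_of_nonneg_left (hA y) hδ)
  linarith

theorem conj {ε : ℝ} {A : E3 ≃ₗᵢ[ℝ] E3} (hA : NearOne ε A) (B : E3 ≃ₗᵢ[ℝ] E3) :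
    NearOne ε (B * A * B⁻¹) := by
  intro x
  set y := B⁻¹ x with hy
  have hx : x = B y := by change x = B (B.symm x); simp
  have : (B * A * B⁻¹) x = B (A y) := rfl
  rw [this, hx, ← map_sub, B.norm_map, B.norm_map]
  exact hA y

theorem mono {ε δ : ℝ} {A : E3 ≃ₗᵢ[ℝ] E3} (hA : NearOne ε A) (h : ε ≤ δ) : NearOne δ A :=
  fun x => (hA x).trans (mul_le_mul_of_nonneg_right h (norm_nonneg x))

theorem ne_neg {A : E3 ≃ₗᵢ[ℝ] E3} (hA : NearOne (1 / 4) A) {u : E3} (hu : u ≠ 0) : A u ≠ -u := by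
  intro h
  have := hA u
  have hn := norm_pos_iff.2 hu
  rw [h, ← neg_add', norm_neg, ← two_smul ℝ u, norm_smul] at this
  norm_num at this
  linarith

/-- A nontrivial linear isometry close to the identity is a rotation about an axis. -/
theorem exists_axis {A : E3 ≃ₗᵢ[ℝ] E3} (hA : NearOne (1 / 4) A) (h1 : A ≠ 1) :
    ∃ u, u ≠ 0 ∧ ∀ x, A x = x ↔ ∃ k : ℝ, x = k • u := by
  obtain ⟨u, hu, h⟩ := A.exists_eigenvector_E3
  have hAu : A u = u := h.resolve_right (hA.ne_neg hu)
  refine ⟨u, hu, fun x => ⟨fun hx => ?_, ?_⟩⟩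
  · by_contra hk
    push Not at hk
    obtain ⟨w, hw, hs, heq⟩ := exists_normal_of_pair hu hk
    have hAw : A w = w := (hs A hAu hx).resolve_right (hA.ne_neg hw)
    exact h1 (heq A 1 hAu hx rfl rfl hAw)
  · rintro ⟨k, rfl⟩
    rw [map_smul, hAu]

end NearOne

theorem isom_apply_eq (g : Isom3) (o x : E3) : g x = g.linearIsometryEquiv (x - o) + g o := by
  have := g.map_vadd o (x - o)
  simpa using this

/-! ### Discrete groups of isometries -/

section Discrete

variable {G : Subgroup Isom3} {o : E3} (hfin : ∀ R : ℝ, {g ∈ G | ‖g o - o‖ ≤ R}.Finite)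

/-- Compare the two sides of `c b a = a b` at `o`, where `c` is the commutator. Its linear part is
within `2 · 1/4 · 1/4 = 1/8` of the identity, so its displacement is at most `(1/4 + 1/8 + 1/8 +
1/4) R`, which is below `R`. -/
theorem commutator_displacement {a b : Isom3} (o : E3) {R : ℝ}
    (ha : NearOne (1 / 4) a.linearIsometryEquiv) (hb : NearOne (1 / 4) b.linearIsometryEquiv)
    (hRa : ‖a o - o‖ ≤ R) (hRb : ‖b o - o‖ ≤ R) : ‖(a * b * a⁻¹ * b⁻¹) o - o‖ ≤ R := by
  set c := a * b * a⁻¹ * b⁻¹ with hc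
  have hcn : NearOne (1 / 8) c.linearIsometryEquiv :=
    (ha.commutator hb (by norm_num) (by norm_num)).mono (by norm_num)
  have h1 : c (b (a o)) = a (b o) := by
    rw [← isom_mul_apply, ← isom_mul_apply, ← isom_mul_apply, hc]; congr 1; group
  have h2 := isom_apply_eq c o (b (a o))
  have h3 := isom_apply_eq b o (a o)
  have h4 := isom_apply_eq a o (b o)
  set A := a.linearIsometryEquiv
  set B := b.linearIsometryEquiv
  set C := c.linearIsometryEquiv
  have h5 : c o - o = ((A (b o - o) - (b o - o)) - (C (b o - o) - (b o - o)))
      - ((C (B (a o - o)) - B (a o - o)) + (B (a o - o) - (a o - o))) := by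
    rw [h1, h4, h3] at h2
    have : B (a o - o) + b o - o = B (a o - o) + (b o - o) := by abel
    rw [this, map_add] at h2
    have : c o = A (b o - o) + a o - (C (B (a o - o)) + C (b o - o)) := by rw [h2]; abel
    rw [this]; abel
  have k1 := ha (b o - o)
  have k2 := hcn (b o - o)
  have k3 := hcn (B (a o - o))
  have k4 := hb (a o - o)
  rw [B.norm_map] at k3
  rw [h5]
  have e1 := norm_sub_le ((A (b o - o) - (b o - o)) - (C (b o - o) - (b o - o)))
    ((C (B (a o - o)) - B (a o - o)) + (B (a o - o) - (a o - o)))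
  have e2 := norm_sub_le (A (b o - o) - (b o - o)) (C (b o - o) - (b o - o))
  have e3 := norm_add_le (C (B (a o - o)) - B (a o - o)) (B (a o - o) - (a o - o))
  have e4 := norm_nonneg (a o - o)
  linarith

theorem eq_one_of_forall_nearOne {A : E3 ≃ₗᵢ[ℝ] E3}
    (h : ∀ N : ℕ, ∃ i, N ≤ i ∧ NearOne (1 / 4 * (1 / 2) ^ i) A) : A = 1 := by
  ext1 x
  rw [← sub_eq_zero, ← norm_le_zero_iff]
  have hlim : Filter.Tendsto (fun i : ℕ => 1 / 4 * (1 / 2 : ℝ) ^ i * ‖x‖) Filter.atTop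
      (nhds 0) := by
    have := (tendsto_pow_atTop_nhds_zero_of_lt_one (r := (1 / 2 : ℝ)) (by norm_num)
      (by norm_num)).const_mul (1 / 4 : ℝ) |>.mul_const ‖x‖
    simpa using this
  refine ge_of_tendsto hlim ?_
  refine Filter.Eventually.of_forall fun N => ?_
  obtain ⟨i, hi, hn⟩ := h N
  refine (hn x).trans (mul_le_mul_of_nonneg_right ?_ (norm_nonneg x))
  exact mul_le_mul_of_nonneg_left (pow_le_pow_of_le_one (by norm_num) (by norm_num) hi)
    (by norm_num)

/-- Iterated commutators with `a`. -/
noncomputable def iterComm (a b : Isom3) : ℕ → Isom3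
  | 0 => b
  | i + 1 => a * iterComm a b i * a⁻¹ * (iterComm a b i)⁻¹

include hfin

/-- In a discrete group, elements with linear part close to the identity have a common axis. -/
theorem fix_axis_of_nearOne {a b : Isom3} (haG : a ∈ G) (hbG : b ∈ G)
    (ha : NearOne (1 / 4) a.linearIsometryEquiv) (hb : NearOne (1 / 4) b.linearIsometryEquiv)
    {u : E3} (hu : u ≠ 0) (hax : ∀ x, a.linearIsometryEquiv x = x ↔ ∃ k : ℝ, x = k • u) :
    b.linearIsometryEquiv u = u := by
  set R := max ‖a o - o‖ ‖b o - o‖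
  have hle : ∀ i : ℕ, (1 / 4 * (1 / 2) ^ i : ℝ) ≤ 1 / 4 := fun i => by
    have : (1 / 2 : ℝ) ^ i ≤ 1 := pow_le_one₀ (by norm_num) (by norm_num)
    linarith
  have key : ∀ i, iterComm a b i ∈ G ∧ ‖iterComm a b i o - o‖ ≤ R ∧
      NearOne (1 / 4 * (1 / 2) ^ i) (iterComm a b i).linearIsometryEquiv := by
    intro i
    induction i with
    | zero => exact ⟨hbG, le_max_right _ _, by simpa [iterComm] using hb⟩
    | succ i ih =>
      obtain ⟨h1, h2, h3⟩ := ih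
      refine ⟨mul_mem (mul_mem (mul_mem haG h1) (inv_mem haG)) (inv_mem h1),
        commutator_displacement o ha (h3.mono (hle i)) (le_max_left _ _) h2, ?_⟩
      refine (ha.commutator h3 (by norm_num) (by positivity)).mono (le_of_eq ?_)
      rw [pow_succ]; ring
  -- All iterated commutators lie in the finite set of elements displacing `o` by at most `R`, so
  -- one of them recurs infinitely often; its linear part is arbitrarily close to the identity,
  -- hence equal to it.
  obtain ⟨i, hi⟩ : ∃ i, (iterComm a b i).linearIsometryEquiv = 1 := by
    have : Finite {g ∈ G | ‖g o - o‖ ≤ R} := hfin R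
    obtain ⟨⟨g, hg⟩, hy⟩ := Finite.exists_infinite_fiber
      (fun i : ℕ => (⟨iterComm a b i, (key i).1, (key i).2.1⟩ : {g ∈ G | ‖g o - o‖ ≤ R}))
    rw [Set.infinite_coe_iff] at hy
    have hval : ∀ i ∈ (fun i : ℕ => (⟨iterComm a b i, (key i).1, (key i).2.1⟩ :
        {g ∈ G | ‖g o - o‖ ≤ R})) ⁻¹' {⟨g, hg⟩}, iterComm a b i = g :=
      fun i hi => congrArg Subtype.val hi
    obtain ⟨i, hi⟩ := hy.nonempty
    refine ⟨i, ?_⟩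
    rw [hval i hi]
    refine eq_one_of_forall_nearOne fun N => ?_
    obtain ⟨j, hj, hNj⟩ := hy.exists_gt N
    exact ⟨j, hNj.le, by rw [← hval j hj]; exact (key j).2.2⟩
  -- If the commutator of `A` and `B` fixes `u`, then `A` fixes `B⁻¹ u`. So `B⁻¹ u` lies on the axis
  -- of `A` and is `u` or `-u`, the latter being too far from `u`.
  have hback : ∀ j, (iterComm a b (j + 1)).linearIsometryEquiv u = u →
      (iterComm a b j).linearIsometryEquiv u = u := by
    intro j hj
    have hn := (key j).2.2.mono (hle j)
    set B := (iterComm a b j).linearIsometryEquiv with hB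
    set A := a.linearIsometryEquiv with hA
    have h1 : A (B (A.symm (B.symm u))) = u := hj
    have hAu : A u = u := (hax u).2 ⟨1, (one_smul _ _).symm⟩
    have h2 : A (B.symm u) = B.symm u := by
      rw [← A.eq_symm_apply, ← B.eq_symm_apply] at h1
      rw [A.symm_apply_eq.2 hAu.symm, A.symm_apply_eq] at h1
      exact h1.symm
    obtain ⟨k, hk⟩ := (hax _).1 h2
    rcases smul_eq_of_norm_eq (u := u) (k := k) (by rw [← hk, B.symm.norm_map]) with h | h
    · rw [h, B.symm_apply_eq] at hk; exact hk.symm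
    · rw [h, B.symm_apply_eq, map_neg] at hk
      exact absurd (neg_eq_iff_eq_neg.1 hk.symm) (hn.ne_neg hu)
  have hdesc : ∀ j, (iterComm a b j).linearIsometryEquiv u = u → b.linearIsometryEquiv u = u := by
    intro j
    induction j with
    | zero => exact id
    | succ j ih => exact fun h => ih (hback j h)
  exact hdesc i (by rw [hi]; rfl)

variable (hirr : ∀ u : E3, u ≠ 0 → ∃ g ∈ G, ∀ k : ℝ, g.linearIsometryEquiv u ≠ k • u)
include hirr

/-- A nontrivial such `g` has an axis. All conjugates of `g` are as close to the identity and so fix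
the axis of `g`; hence every element of the group preserves that line, against irreducibility. -/
theorem linear_eq_one_of_nearOne {g : Isom3} (hg : g ∈ G)
    (hn : NearOne (1 / 4) g.linearIsometryEquiv) : g.linearIsometryEquiv = 1 := by
  by_contra h1
  obtain ⟨u, hu, hax⟩ := hn.exists_axis h1
  obtain ⟨h, hh, hk⟩ := hirr u hu
  have hbn : NearOne (1 / 4) (h⁻¹ * g * h).linearIsometryEquiv := by
    have := hn.conj h.linearIsometryEquiv⁻¹
    rw [inv_inv] at this
    exact this
  have hb := fix_axis_of_nearOne hfin hg (mul_mem (mul_mem (inv_mem hh) hg) hh) hn hbn hu hax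
  have hb' : h.linearIsometryEquiv.symm (g.linearIsometryEquiv (h.linearIsometryEquiv u)) = u := hb
  rw [LinearIsometryEquiv.symm_apply_eq] at hb'
  obtain ⟨k, hk'⟩ := (hax _).1 hb'
  exact hk k hk'

/-- The linear parts lie in a compact ball for the operator norm. Near an accumulation point two
different ones would have a quotient close to, but different from, the identity. -/
theorem finite_linear_parts :
    {A : E3 →L[ℝ] E3 | ∃ g ∈ G, A = (g.linearIsometryEquiv : E3 →L[ℝ] E3)}.Finite := by
  by_contra hinf
  obtain ⟨A, -, hA⟩ := Set.Infinite.exists_accPt_of_subset_isCompact hinf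
    (isCompact_closedBall (0 : E3 →L[ℝ] E3) 1) (by
      rintro _ ⟨g, -, rfl⟩
      rw [mem_closedBall_zero_iff]
      refine ContinuousLinearMap.opNorm_le_bound _ zero_le_one fun x => ?_
      rw [one_mul]
      exact (g.linearIsometryEquiv.norm_map x).le)
  rw [accPt_iff_nhds] at hA
  obtain ⟨B, ⟨hB, g, hg, rfl⟩, hBA⟩ := hA _ (Metric.ball_mem_nhds A (ε := 1 / 8) (by norm_num))
  -- Choosing the second point strictly closer to the limit guarantees that it differs from the
  -- first.
  obtain ⟨C, ⟨hC, h, hh, rfl⟩, hCA⟩ := hA _ (Metric.ball_mem_nhds A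
    (ε := min (1 / 8) (dist (g.linearIsometryEquiv : E3 →L[ℝ] E3) A))
    (lt_min (by norm_num) (dist_pos.2 hBA)))
  rw [Metric.mem_ball, lt_min_iff] at hC
  have hd : dist (g.linearIsometryEquiv : E3 →L[ℝ] E3) (h.linearIsometryEquiv : E3 →L[ℝ] E3)
      ≤ 1 / 4 := by
    have := dist_triangle_right (g.linearIsometryEquiv : E3 →L[ℝ] E3)
      (h.linearIsometryEquiv : E3 →L[ℝ] E3) A
    rw [Metric.mem_ball] at hB
    linarith [hC.1]
  have hn : NearOne (1 / 4) (g * h⁻¹).linearIsometryEquiv := by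
    intro x
    set y := h.linearIsometryEquiv.symm x
    have hx : x = h.linearIsometryEquiv y := by simp [y]
    have h1 : (g * h⁻¹).linearIsometryEquiv x = g.linearIsometryEquiv y := rfl
    rw [h1, hx, LinearIsometryEquiv.norm_map]
    rw [dist_eq_norm] at hd
    exact (((g.linearIsometryEquiv : E3 →L[ℝ] E3) -
      (h.linearIsometryEquiv : E3 →L[ℝ] E3)).le_opNorm y).trans
        (mul_le_mul_of_nonneg_right hd (norm_nonneg y))
  have h1 := linear_eq_one_of_nearOne hfin hirr (mul_mem hg (inv_mem hh)) hn
  have h2 : g.linearIsometryEquiv = h.linearIsometryEquiv := by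
    ext1 x
    have := congrArg (fun A : E3 ≃ₗᵢ[ℝ] E3 => A (h.linearIsometryEquiv x)) h1
    have h3 : g.linearIsometryEquiv (h.linearIsometryEquiv.symm (h.linearIsometryEquiv x))
      = h.linearIsometryEquiv x := this
    rwa [LinearIsometryEquiv.symm_apply_apply] at h3
  rw [h2] at hC
  exact lt_irrefl _ hC.2

/-- An irreducible discrete infinite group contains a nontrivial translation. -/
theorem exists_translation (hinf : (G : Set Isom3).Infinite) :
    ∃ v : E3, v ≠ 0 ∧ AffineIsometryEquiv.constVAdd ℝ E3 v ∈ G := by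
  -- With infinitely many elements and finitely many linear parts, two elements share a linear part;
  -- their quotient is a translation.
  have hni : ¬ Set.InjOn (fun g : Isom3 => (g.linearIsometryEquiv : E3 →L[ℝ] E3)) G := by
    intro hinj
    refine hinf (Set.Finite.of_finite_image ((finite_linear_parts hfin hirr).subset ?_) hinj)
    rintro _ ⟨g, hg, rfl⟩
    exact ⟨g, hg, rfl⟩
  simp only [Set.InjOn, not_forall] at hni
  obtain ⟨g, hg, h, hh, heq, hne⟩ := hni
  have heq' : ∀ x, g.linearIsometryEquiv x = h.linearIsometryEquiv x :=
    fun x => congrArg (fun A : E3 →L[ℝ] E3 => A x) heq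
  have htr : AffineIsometryEquiv.constVAdd ℝ E3 (g o - h o) = g * h⁻¹ := by
    ext1 x
    have h1 := isom_apply_eq g o (h⁻¹ x)
    have h2 := isom_apply_eq h o (h⁻¹ x)
    rw [isom_apply_inv_self] at h2
    rw [isom_mul_apply, h1, heq']
    change g o - h o + x = _
    conv_lhs => rw [h2]
    abel
  refine ⟨g o - h o, fun h0 => hne ?_, by rw [htr]; exact mul_mem hg (inv_mem hh)⟩
  rw [h0, AffineIsometryEquiv.constVAdd_zero] at htr
  exact (mul_inv_eq_one.1 htr.symm)

omit hfin hirr in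
/-- The lattice of translations in `G`. -/
def translationLattice (G : Subgroup Isom3) : AddSubgroup E3 where
  carrier := {v | AffineIsometryEquiv.constVAdd ℝ E3 v ∈ G}
  zero_mem' := by
    change AffineIsometryEquiv.constVAdd ℝ E3 0 ∈ G
    rw [AffineIsometryEquiv.constVAdd_zero]; exact one_mem G
  add_mem' {v w} hv hw := by
    have : AffineIsometryEquiv.constVAdd ℝ E3 (v + w) = AffineIsometryEquiv.constVAdd ℝ E3 v *
        AffineIsometryEquiv.constVAdd ℝ E3 w := by
      ext1 x; simp [add_assoc]
    change AffineIsometryEquiv.constVAdd ℝ E3 (v + w) ∈ G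
    rw [this]; exact mul_mem hv hw
  neg_mem' {v} hv := by
    have : AffineIsometryEquiv.constVAdd ℝ E3 (-v) = (AffineIsometryEquiv.constVAdd ℝ E3 v)⁻¹ := by
      rw [eq_inv_iff_mul_eq_one]; ext1 x; simp
    change AffineIsometryEquiv.constVAdd ℝ E3 (-v) ∈ G
    rw [this]; exact inv_mem hv

omit hfin hirr in
-- Conjugation by `g` turns the translation by `v` into the translation by the image of `v` under
-- the linear part of `g`.
theorem map_mem_translationLattice {g : Isom3} (hg : g ∈ G) {v : E3}
    (hv : v ∈ translationLattice G) : g.linearIsometryEquiv v ∈ translationLattice G := by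
  have : AffineIsometryEquiv.constVAdd ℝ E3 (g.linearIsometryEquiv v) =
      g * AffineIsometryEquiv.constVAdd ℝ E3 v * g⁻¹ := by
    ext1 x
    rw [isom_mul_apply, isom_mul_apply, AffineIsometryEquiv.coe_constVAdd,
      AffineIsometryEquiv.coe_constVAdd, g.map_vadd, isom_apply_inv_self]
  change AffineIsometryEquiv.constVAdd ℝ E3 (g.linearIsometryEquiv v) ∈ G
  rw [this]
  exact mul_mem (mul_mem hg hv) (inv_mem hg)

omit hirr in
-- Only finitely many translations in the group have length at most 1; removing the nonzero ones
-- from the unit ball leaves a neighborhood isolating 0.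
theorem discreteTopology_translationLattice :
    DiscreteTopology (AddSubgroup.toIntSubmodule (translationLattice G)) := by
  have hf : {v : E3 | v ∈ translationLattice G ∧ ‖v‖ ≤ 1}.Finite := by
    refine Set.Finite.of_finite_image (f := fun v => AffineIsometryEquiv.constVAdd ℝ E3 v)
      ((hfin 1).subset ?_) ?_
    · rintro _ ⟨v, ⟨hv, hv1⟩, rfl⟩
      exact ⟨hv, by simpa using hv1⟩
    · intro v _ w _ h
      have := congrArg (fun g : Isom3 => g 0) h
      simpa using this
  apply discreteTopology_of_isOpen_singleton_zero
  have hopen : IsOpen (Metric.ball (0 : E3) 1 ∩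
      ({v : E3 | v ∈ translationLattice G ∧ ‖v‖ ≤ 1} \ {0})ᶜ) :=
    Metric.isOpen_ball.inter (hf.subset Set.sdiff_subset).isClosed.isOpen_compl
  convert hopen.preimage (continuous_subtype_val
    (p := fun v => v ∈ AddSubgroup.toIntSubmodule (translationLattice G))) using 1
  ext ⟨v, hv⟩
  simp only [Set.mem_singleton_iff, Set.mem_preimage, Set.mem_inter_iff, mem_ball_zero_iff,
    Set.mem_compl_iff, Set.mem_sdiff, Set.mem_ofPred_eq, not_and, not_not]
  constructor
  · intro h
    have : v = 0 := congrArg Subtype.val h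
    rw [this]; simp
  · rintro ⟨h1, h2⟩
    exact Subtype.ext (h2 ⟨hv, h1.le⟩)

/-- The span and its orthogonal complement are both invariant, so irreducibility forbids dimension 1
for either. The span is nonzero because there is a nontrivial translation; hence its dimension is 3.
-/
theorem span_translationLattice (hinf : (G : Set Isom3).Infinite) :
    Submodule.span ℝ (translationLattice G : Set E3) = ⊤ := by
  set W := Submodule.span ℝ (translationLattice G : Set E3) with hW
  have hinv : ∀ g ∈ G, ∀ x ∈ W, g.linearIsometryEquiv x ∈ W := by
    intro g hg x hx
    refine Submodule.span_induction ?_ ?_ ?_ ?_ hx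
    · exact fun v hv => Submodule.subset_span (map_mem_translationLattice hg hv)
    · rw [map_zero]; exact W.zero_mem
    · intro a b _ _ ha hb; rw [map_add]; exact W.add_mem ha hb
    · intro k a _ ha; rw [map_smul]; exact W.smul_mem k ha
  have hinv' : ∀ g ∈ G, ∀ x ∈ Wᗮ, g.linearIsometryEquiv x ∈ Wᗮ := by
    intro g hg x hx
    rw [Submodule.mem_orthogonal]
    intro y hy
    have := hx _ (hinv g⁻¹ (inv_mem hg) y hy)
    rw [← g.linearIsometryEquiv.inner_map_map] at this
    have h2 : g.linearIsometryEquiv (g⁻¹.linearIsometryEquiv y) = y :=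
      g.linearIsometryEquiv.apply_symm_apply y
    rwa [h2] at this
  have hline : ∀ V : Submodule ℝ E3, (∀ g ∈ G, ∀ x ∈ V, g.linearIsometryEquiv x ∈ V) →
      Module.finrank ℝ V ≠ 1 := by
    intro V hV h1
    obtain ⟨⟨u, huV⟩, hu0, hu⟩ := finrank_eq_one_iff'.1 h1
    obtain ⟨g, hg, hk⟩ := hirr u fun h => hu0 (Subtype.ext h)
    obtain ⟨k, hk'⟩ := hu ⟨_, hV g hg u huV⟩
    exact hk k (congrArg Subtype.val hk').symm
  have h1 := hline W hinv
  have h2 := hline Wᗮ hinv'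
  have h3 := W.finrank_add_finrank_orthogonal
  rw [finrank_E3] at h3
  have h0 : Module.finrank ℝ W ≠ 0 := by
    intro h0
    obtain ⟨v, hv, hvG⟩ := exists_translation hfin hirr hinf
    rw [Submodule.finrank_eq_zero] at h0
    have : v ∈ W := Submodule.subset_span hvG
    rw [h0] at this
    exact hv this
  apply Submodule.eq_top_of_finrank_eq
  rw [finrank_E3]
  omega

/-- The crystallographic restriction: the linear parts of an irreducible infinite discrete group
have integral traces. -/
theorem trace_linear_int (hinf : (G : Set Isom3).Infinite) {g : Isom3} (hg : g ∈ G) :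
    ∃ m : ℤ, LinearMap.trace ℝ E3 (g.linearIsometryEquiv.toLinearEquiv : E3 →ₗ[ℝ] E3) = m := by
  set T := AddSubgroup.toIntSubmodule (translationLattice G) with hT
  have := discreteTopology_translationLattice hfin
  have hz : IsZLattice ℝ T := ⟨span_translationLattice hfin hirr hinf⟩
  have := ZLattice.module_finite ℝ T
  have := ZLattice.module_free ℝ T
  set b := Module.Free.chooseBasis ℤ T
  set B := b.ofZLatticeBasis ℝ T with hB
  classical
  -- The linear part preserves the lattice, so its matrix in a lattice basis is integral.
  refine ⟨∑ i, b.repr ⟨g.linearIsometryEquiv (b i), map_mem_translationLattice hg (b i).2⟩ i, ?_⟩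
  rw [LinearMap.trace_eq_matrix_trace ℝ B, Matrix.trace, Int.cast_sum]
  refine Finset.sum_congr rfl fun i _ => ?_
  rw [Matrix.diag_apply, LinearMap.toMatrix_apply, ← b.ofZLatticeBasis_repr_apply ℝ T]
  simp [hB]

end Discrete

/-! ### Linear parts -/

local notation "𝓛" => AffineIsometryEquiv.linearIsometryEquiv

theorem lin_sub (g : Isom3) (x y : E3) : 𝓛 g (x - y) = g x - g y := g.map_vsub x y

theorem lin_mul (g h : Isom3) (x : E3) : 𝓛 (g * h) x = 𝓛 g (𝓛 h x) := rfl

theorem lin_apply_inv (g : Isom3) (x : E3) : 𝓛 g (𝓛 g⁻¹ x) = x := (𝓛 g).apply_symm_apply x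

theorem isom_eq_of_lin {g h : Isom3} {o : E3} (hl : 𝓛 g = 𝓛 h) (ho : g o = h o) : g = h := by
  ext1 x
  rw [isom_apply_eq g o x, isom_apply_eq h o x, hl, ho]

/-- The fixed space of the linear part, for an isometry with mirror of dimension `d`. -/
theorem HasMirrorDim.exists_fixed {g : Isom3} {d : ℕ} (h : HasMirrorDim g d) :
    ∃ W : Submodule ℝ E3, Module.finrank ℝ W = d ∧ ∀ x, x ∈ W ↔ 𝓛 g x = x := by
  obtain ⟨M, hM, ⟨c, hc⟩, hd⟩ := h
  refine ⟨M.direction, hd, fun x => ?_⟩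
  have hgc : g c = c := by
    have : c ∈ {x | g x = x} := hM ▸ hc
    exact this
  have h1 : x ∈ M.direction ↔ x +ᵥ c ∈ M :=
    ⟨fun hx => AffineSubspace.vadd_mem_of_mem_direction hx hc,
     fun hx => by simpa using AffineSubspace.vsub_mem_direction hx hc⟩
  have h2 : x +ᵥ c ∈ M ↔ g (x +ᵥ c) = x +ᵥ c := by
    rw [← SetLike.mem_coe, hM]; rfl
  rw [h1, h2, g.map_vadd, hgc]
  exact ⟨fun h => by simpa using h, fun h => by rw [h]⟩

theorem exists_unit_of_finrank_eq_one {W : Submodule ℝ E3} (h : Module.finrank ℝ W = 1) :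
    ∃ n : E3, n ∈ W ∧ inner ℝ n n = (1 : ℝ) ∧ ∀ x ∈ W, x = inner ℝ n x • n := by
  obtain ⟨⟨u, huW⟩, hu0, hu⟩ := finrank_eq_one_iff'.1 h
  have hu0' : u ≠ 0 := fun h => hu0 (Subtype.ext h)
  have hn : ‖u‖ ≠ 0 := norm_ne_zero_iff.2 hu0'
  have h1 : inner ℝ (‖u‖⁻¹ • u) (‖u‖⁻¹ • u) = (1 : ℝ) := by
    rw [real_inner_smul_left, real_inner_smul_right, real_inner_self_eq_norm_sq]
    field_simp
  refine ⟨‖u‖⁻¹ • u, W.smul_mem _ huW, h1, fun x hx => ?_⟩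
  obtain ⟨k, hk⟩ := hu ⟨x, hx⟩
  have hk' : k • u = x := congrArg Subtype.val hk
  have hk2 : x = (k * ‖u‖) • (‖u‖⁻¹ • u) := by
    rw [smul_smul, mul_assoc, mul_inv_cancel₀ hn, mul_one, hk']
  conv_rhs => rw [hk2]
  rw [real_inner_smul_right, h1, mul_one, ← hk2]

section Involution

variable {A : E3 ≃ₗᵢ[ℝ] E3} {W : Submodule ℝ E3} (hA : ∀ x, A (A x) = x)
  (hW : ∀ x, x ∈ W ↔ A x = x)
include hA hW

theorem involution_mem (x : E3) : x + A x ∈ W ∧ x - A x ∈ Wᗮ := by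
  refine ⟨?_, ?_⟩
  · rw [hW, map_add, hA, add_comm]
  · rw [Submodule.mem_orthogonal]
    intro w hw
    rw [inner_sub_right]
    nth_rewrite 2 [← (hW w).1 hw]
    rw [A.inner_map_map, sub_self]

/-- For a unit normal `n` of the fixed plane, `x - A x` is a multiple of `n` and `x + A x` is
orthogonal to `n`. The half-turn case exchanges the two roles. -/
theorem exists_reflection (hd : Module.finrank ℝ W = 2) :
    ∃ n : E3, inner ℝ n n = (1 : ℝ) ∧ ∀ x, A x = x - (2 * inner ℝ n x) • n := by
  have h1 : Module.finrank ℝ Wᗮ = 1 := by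
    have := W.finrank_add_finrank_orthogonal
    rw [hd, finrank_E3] at this
    omega
  obtain ⟨n, hnW, hn, hx⟩ := exists_unit_of_finrank_eq_one h1
  refine ⟨n, hn, fun x => ?_⟩
  have h2 := hx _ (involution_mem hA hW x).2
  have h3 := Submodule.inner_left_of_mem_orthogonal (involution_mem hA hW x).1 hnW
  rw [inner_sub_right] at h2
  rw [inner_add_right] at h3
  rw [show 2 * inner ℝ n x = inner ℝ n x - inner ℝ n (A x) by linarith, ← h2]
  abel

theorem exists_halfturn (hd : Module.finrank ℝ W = 1) :
    ∃ n : E3, inner ℝ n n = (1 : ℝ) ∧ ∀ x, A x = (2 * inner ℝ n x) • n - x := by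
  obtain ⟨n, hnW, hn, hx⟩ := exists_unit_of_finrank_eq_one hd
  refine ⟨n, hn, fun x => ?_⟩
  have h2 := hx _ (involution_mem hA hW x).1
  have h3 := Submodule.inner_right_of_mem_orthogonal hnW (involution_mem hA hW x).2
  rw [inner_add_right] at h2
  rw [inner_sub_right] at h3
  rw [show 2 * inner ℝ n x = inner ℝ n x + inner ℝ n (A x) by linarith, ← h2]
  abel

end Involution

/-! ### The symmetry group of a regular complex is irreducible and crystallographic -/

namespace FlagData

variable {K : PolygonalFigure} {o p : E3} {F : Set (Sym2 E3)} {R₀ R₁ : Isom3}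
  (D : FlagData K o p F R₀ R₁)

include D

theorem vec_ne_zero : p - o ≠ 0 := sub_ne_zero.2 D.o_ne_p.symm

theorem lin_G2 {g : Isom3} (hg : g ∈ K.G2 (o, s(o, p), F)) : 𝓛 g (p - o) = p - o := by
  rw [lin_sub, (D.mem_G2.1 hg).2.1, (D.mem_G2.1 hg).2.2]

theorem G2_ext {g h : Isom3} (hg : g ∈ K.G2 (o, s(o, p), F)) (hh : h ∈ K.G2 (o, s(o, p), F))
    (hl : 𝓛 g = 𝓛 h) : g = h :=
  isom_eq_of_lin hl ((D.mem_G2.1 hg).2.1.trans (D.mem_G2.1 hh).2.1.symm)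

/-- Only the vectors along the base edge are fixed by all of `G₂`. -/
theorem eq_smul_of_fixed {x : E3} (hx : ∀ g ∈ K.G2 (o, s(o, p), F), 𝓛 g x = x) :
    ∃ k : ℝ, x = k • (p - o) := by
  by_contra hk
  push Not at hk
  obtain ⟨w, hw, hs, heq⟩ := exists_normal_of_pair D.vec_ne_zero hk
  obtain ⟨g, hg, h, hh, hg1, hh1, hgh⟩ := D.exists_two_G2
  -- If a second independent vector were fixed, every nontrivial element of `G₂` would be the
  -- reflection in the plane of both vectors, leaving room for only one.
  have h1 : ∀ g ∈ K.G2 (o, s(o, p), F), g ≠ 1 → 𝓛 g w = -w := by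
    intro g hg hg1
    refine (hs _ (D.lin_G2 hg) (hx g hg)).resolve_left fun hgw => hg1 ?_
    exact D.G2_ext hg (one_mem _) (heq _ _ (D.lin_G2 hg) (hx g hg) rfl rfl hgw)
  exact hgh (D.G2_ext hg hh (heq _ _ (D.lin_G2 hg) (hx g hg) (D.lin_G2 hh) (hx h hh)
    ((h1 g hg hg1).trans (h1 h hh hh1).symm)))

theorem p_mem : p ∈ K.verts := D.R₀_o ▸ D.map_vert D.R₀_mem D.o_mem

theorem vec_mem_direction : p - o ∈ (affineSpan ℝ K.verts).direction :=
  AffineSubspace.vsub_mem_direction (subset_affineSpan ℝ _ D.p_mem)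
    (subset_affineSpan ℝ _ D.o_mem)

/-- A vector orthogonal to the hull is fixed by all symmetries, by the convention on their
extension. Being fixed by `G₂` it is parallel to the base edge, which lies in the hull, so it is 0.
-/
theorem direction_eq_top : (affineSpan ℝ K.verts).direction = ⊤ := by
  by_contra h
  have hne : (affineSpan ℝ K.verts).directionᗮ ≠ ⊥ := fun h' =>
    h (Submodule.orthogonal_eq_bot_iff.1 h')
  obtain ⟨w, hw, hw0⟩ := Submodule.exists_mem_ne_zero_of_ne_bot hne
  obtain ⟨k, hk⟩ := D.eq_smul_of_fixed (x := w) fun g hg => (D.mem_G2.1 hg).1.2 w hw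
  have h1 : inner ℝ w w = (0 : ℝ) := by
    nth_rewrite 1 [hk]
    rw [real_inner_smul_left, Submodule.inner_right_of_mem_orthogonal D.vec_mem_direction hw,
      mul_zero]
  exact hw0 (inner_self_eq_zero.1 h1)

/-- No proper subspace containing the direction of the base edge is invariant. -/
theorem invariant_eq_top {W : Submodule ℝ E3} (hp : p - o ∈ W) (h0 : ∀ x ∈ W, 𝓛 R₀ x ∈ W)
    (h1 : ∀ x ∈ W, 𝓛 R₁ x ∈ W) (h2 : ∀ g ∈ K.G2 (o, s(o, p), F), ∀ x ∈ W, 𝓛 g x ∈ W) : W = ⊤ := by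
  -- The displacement of a product is `𝓛 g (h o - o) + (g o - o)`, so invariance of `W` under linear
  -- parts and their inverses propagates; in the end all vertices lie in `o + W`.
  have key : ∀ g ∈ closure ({R₀, R₁} ∪ (K.G2 (o, s(o, p), F) : Set Isom3)),
      (∀ x ∈ W, 𝓛 g x ∈ W) ∧ (∀ x ∈ W, 𝓛 g⁻¹ x ∈ W) ∧ g o - o ∈ W := by
    intro g hg
    induction hg using closure_induction with
    | mem g hg =>
      rcases hg with (rfl | rfl) | hg
      · exact ⟨h0, by rwa [inv_eq_of_mul_eq_one_left D.R₀_mul_self], by rwa [D.R₀_o]⟩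
      · refine ⟨h1, by rwa [inv_eq_of_mul_eq_one_left D.R₁_mul_self], ?_⟩
        rw [D.R₁_o, sub_self]; exact W.zero_mem
      · refine ⟨h2 g hg, h2 _ (inv_mem hg), ?_⟩
        rw [(D.mem_G2.1 hg).2.1, sub_self]; exact W.zero_mem
    | one =>
      refine ⟨fun x hx => hx, fun x hx => hx, ?_⟩
      change o - o ∈ W
      rw [sub_self]; exact W.zero_mem
    | mul g h _ _ hg hh =>
      refine ⟨fun x hx => hg.1 _ (hh.1 x hx), fun x hx => ?_, ?_⟩
      · rw [mul_inv_rev]; exact hh.2.1 _ (hg.2.1 x hx)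
      · have : (g * h) o - o = 𝓛 g (h o - o) + (g o - o) := by
          rw [lin_sub, isom_mul_apply]; abel
        rw [this]
        exact W.add_mem (hg.1 _ hh.2.2) hg.2.2
    | inv g _ hg =>
      refine ⟨hg.2.1, by rw [inv_inv]; exact hg.1, ?_⟩
      have : g⁻¹ o - o = -𝓛 g⁻¹ (g o - o) := by
        rw [lin_sub, isom_inv_apply_self]; abel
      rw [this]
      exact W.neg_mem (hg.2.1 _ hg.2.2)
  rw [eq_top_iff, ← D.direction_eq_top, direction_affineSpan, vectorSpan_def, Submodule.span_le]
  rintro _ ⟨x, hx, y, hy, rfl⟩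
  obtain ⟨g, hg, rfl⟩ := D.exists_vert hx
  obtain ⟨h, hh, rfl⟩ := D.exists_vert hy
  have := W.sub_mem (key g hg).2.2 (key h hh).2.2
  rw [sub_sub_sub_cancel_right] at this
  exact this

/-- Otherwise the line spanned by the base edge would be invariant under `R₀`, `R₁` and `G₂`, hence
be the whole space. -/
theorem vec_ne_of_R₁ : ∀ k : ℝ, 𝓛 R₁ (p - o) ≠ k • (p - o) := by
  intro k hk
  have hR0 : 𝓛 R₀ (p - o) = -(p - o) := by rw [lin_sub, D.R₀_o, D.R₀_p]; abel
  have htop : Submodule.span ℝ {p - o} = ⊤ := by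
    refine D.invariant_eq_top (Submodule.mem_span_singleton_self _) ?_ ?_ ?_
    · intro x hx
      obtain ⟨c, rfl⟩ := Submodule.mem_span_singleton.1 hx
      rw [map_smul, hR0]
      exact Submodule.smul_mem _ _ (Submodule.neg_mem _ (Submodule.mem_span_singleton_self _))
    · intro x hx
      obtain ⟨c, rfl⟩ := Submodule.mem_span_singleton.1 hx
      rw [map_smul, hk]
      exact Submodule.smul_mem _ _ (Submodule.smul_mem _ _ (Submodule.mem_span_singleton_self _))
    · intro g hg x hx
      obtain ⟨c, rfl⟩ := Submodule.mem_span_singleton.1 hx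
      rw [map_smul, D.lin_G2 hg]
      exact hx
  have := finrank_span_singleton (K := ℝ) D.vec_ne_zero
  rw [htop, finrank_top, finrank_E3] at this
  norm_num at this

/-- Suppose every symmetry sends `u` to `u` or `-u`. If `u` is orthogonal to the base edge, its
orthogonal plane is invariant and contains the edge direction, which is impossible. If not, `G₂`
must fix `u`, so `u` is parallel to the edge, and `R₁` moves that line. -/
theorem irreducible (u : E3) (hu : u ≠ 0) :
    ∃ g ∈ K.symmetryGroup, ∀ k : ℝ, 𝓛 g u ≠ k • u := by
  by_contra! hcon
  have hsign : ∀ g ∈ K.symmetryGroup, 𝓛 g u = u ∨ 𝓛 g u = -u := by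
    intro g hg
    obtain ⟨k, hk⟩ := hcon g hg
    rw [hk]
    exact smul_eq_of_norm_eq (by rw [← hk, LinearIsometryEquiv.norm_map])
  by_cases hperp : inner ℝ u (p - o) = (0 : ℝ)
  · have hinv : ∀ g ∈ K.symmetryGroup, ∀ x ∈ (Submodule.span ℝ {u})ᗮ,
        𝓛 g x ∈ (Submodule.span ℝ {u})ᗮ := by
      intro g hg x hx
      rw [Submodule.mem_orthogonal_singleton_iff_inner_right] at hx ⊢
      have h1 : inner ℝ (𝓛 g u) (𝓛 g x) = (0 : ℝ) := by rw [LinearIsometryEquiv.inner_map_map, hx]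
      rcases hsign g hg with h | h
      · rwa [h] at h1
      · rwa [h, inner_neg_left, neg_eq_zero] at h1
    have htop := D.invariant_eq_top (W := (Submodule.span ℝ {u})ᗮ)
      ((Submodule.mem_orthogonal_singleton_iff_inner_right).2 hperp)
      (hinv _ D.R₀_mem) (hinv _ D.R₁_mem) fun g hg => hinv g (D.mem_G2.1 hg).1
    have : u ∈ (Submodule.span ℝ {u})ᗮ := htop ▸ Submodule.mem_top
    rw [Submodule.mem_orthogonal_singleton_iff_inner_right] at this
    exact hu (inner_self_eq_zero.1 this)
  · obtain ⟨k, hk⟩ := D.eq_smul_of_fixed (x := u) fun g hg => by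
      refine (hsign g (D.mem_G2.1 hg).1).resolve_right fun h => hperp ?_
      have h1 := (𝓛 g).inner_map_map u (p - o)
      rw [h, D.lin_G2 hg, inner_neg_left] at h1
      linarith
    have hk0 : k ≠ 0 := by rintro rfl; exact hu (by rw [hk, zero_smul])
    obtain ⟨c, hc⟩ := hcon R₁ D.R₁_mem
    refine D.vec_ne_of_R₁ c ?_
    rw [hk, map_smul, smul_comm] at hc
    exact smul_right_injective _ hk0 hc

/-- An element is determined by the image of the base flag. If it moves `o` only a little, the image
face meets a fixed ball, and there are finitely many such faces, each with finitely many edges. -/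
theorem finite_of_norm_le (R : ℝ) : {g ∈ K.symmetryGroup | ‖g o - o‖ ≤ R}.Finite := by
  obtain ⟨r, -, hr⟩ := D.exists_complex
  set Q := {P ∈ K.faces | (polygonCarrier P ∩ Metric.closedBall o R).Nonempty}
  have hP : Q.Finite := hr.discrete _ (isCompact_closedBall o R)
  set E := ⋃ P ∈ Q, P
  have hE : E.Finite := hP.biUnion fun P hP => (D.fin P hP.1).finite
  set V := ⋃ e ∈ E, {x | x ∈ e}
  have hV : V.Finite := hE.biUnion fun e _ => by
    induction e with | _ a b =>
    refine (Set.toFinite {a, b}).subset fun x hx => ?_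
    exact Sym2.mem_iff.1 hx
  refine Set.Finite.of_finite_image (f := fun g => flagImage g (o, s(o, p), F))
    ((hV.prod (hE.prod hP)).subset ?_) ?_
  · rintro _ ⟨g, ⟨hg, hR⟩, rfl⟩
    have hmem : Sym2.map g s(o, p) ∈ Sym2.map g '' F := ⟨_, D.e_mem_F, rfl⟩
    have h1 : Sym2.map g '' F ∈ Q := by
      refine ⟨D.map_face hg D.F_mem, g o, ⟨g o, g p, hmem, left_mem_segment ℝ _ _⟩, ?_⟩
      rwa [Metric.mem_closedBall, dist_eq_norm]
    have h2 : Sym2.map g s(o, p) ∈ E := Set.mem_biUnion h1 hmem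
    exact ⟨Set.mem_biUnion h2 (Sym2.mem_mk_left _ _), h2, h1⟩
  · rintro g ⟨hg, -⟩ h ⟨hh, -⟩ heq
    exact (D.simple.2 _ D.flag _ (flagImage_mem (D.map_eq hg) D.flag)).unique
      ⟨hg, rfl⟩ ⟨hh, heq.symm⟩

/-- A finite group fixes the centroid of the orbit of `o`. Being fixed by `G₂`, the centroid lies on
the line of the base edge; `R₁` then forces it to be `o`, which `R₀` moves. -/
theorem infinite_symmetryGroup : (K.symmetryGroup : Set Isom3).Infinite := by
  intro hfin
  have : Fintype K.symmetryGroup := hfin.fintype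
  set N : ℝ := (Fintype.card K.symmetryGroup : ℝ) with hN
  have hN0 : N ≠ 0 := by simp [hN]
  set c : E3 := N⁻¹ • ∑ g : K.symmetryGroup, ((g : Isom3) o - o) with hc
  have hfix : ∀ h ∈ K.symmetryGroup, 𝓛 h c + (h o - o) = c := by
    intro h hh
    have h1 : ∑ g : K.symmetryGroup, ((g : Isom3) o - o) =
        ∑ g : K.symmetryGroup, (𝓛 h ((g : Isom3) o - o) + (h o - o)) := by
      rw [← Equiv.sum_comp (Equiv.mulLeft (⟨h, hh⟩ : K.symmetryGroup))]
      refine Finset.sum_congr rfl fun g _ => ?_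
      rw [lin_sub, sub_add_sub_cancel]
      rfl
    have h2 : ∑ g : K.symmetryGroup, (h o - o) = N • (h o - o) := by
      rw [Finset.sum_const, Finset.card_univ, hN, Nat.cast_smul_eq_nsmul]
    have h3 : N⁻¹ • (N • (h o - o)) = h o - o := by rw [smul_smul, inv_mul_cancel₀ hN0, one_smul]
    conv_rhs => rw [hc, h1, Finset.sum_add_distrib, h2, smul_add, h3]
    rw [hc, map_smul, map_sum]
  obtain ⟨k, hk⟩ := D.eq_smul_of_fixed (x := c) fun g hg => by
    have := hfix g (D.mem_G2.1 hg).1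
    rwa [(D.mem_G2.1 hg).2.1, sub_self, add_zero] at this
  have h1 := hfix R₁ D.R₁_mem
  rw [D.R₁_o, sub_self, add_zero] at h1
  have hk0 : k = 0 := by
    by_contra hk0
    rw [hk, map_smul] at h1
    exact D.vec_ne_of_R₁ 1 (by rw [one_smul]; exact smul_right_injective _ hk0 h1)
  rw [hk0, zero_smul] at hk
  have h0 := hfix R₀ D.R₀_mem
  rw [hk, map_zero, zero_add, D.R₀_o] at h0
  exact D.vec_ne_zero h0

theorem trace_int {g : Isom3} (hg : g ∈ K.symmetryGroup) :
    ∃ m : ℤ, LinearMap.trace ℝ E3 ((𝓛 g).toLinearEquiv : E3 →ₗ[ℝ] E3) = m :=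
  trace_linear_int D.finite_of_norm_le D.irreducible D.infinite_symmetryGroup hg

theorem lin_R₀_R₀ (x : E3) : 𝓛 R₀ (𝓛 R₀ x) = x := by
  rw [← lin_mul, D.R₀_mul_self]; rfl

theorem lin_R₁_R₁ (x : E3) : 𝓛 R₁ (𝓛 R₁ x) = x := by
  rw [← lin_mul, D.R₁_mul_self]; rfl

theorem lin_R₀_vec : 𝓛 R₀ (p - o) = -(p - o) := by rw [lin_sub, D.R₀_o, D.R₀_p]; abel

theorem exists_axis_R₀ : ∃ d : E3, inner ℝ d d = (1 : ℝ) ∧ inner ℝ d (p - o) = (0 : ℝ) ∧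
    ∀ x, 𝓛 R₀ x = (2 * inner ℝ d x) • d - x := by
  obtain ⟨W, hd, hW⟩ := D.dim_R₀.exists_fixed
  obtain ⟨d, h1, h⟩ := exists_halfturn D.lin_R₀_R₀ hW hd
  refine ⟨d, h1, ?_, h⟩
  have := h (p - o)
  rw [D.lin_R₀_vec, eq_comm, sub_eq_neg_self] at this
  rcases smul_eq_zero.1 this with h2 | h2
  · linarith
  · rw [h2, inner_zero_left]

theorem exists_normal_R₁ : ∃ n : E3, inner ℝ n n = (1 : ℝ) ∧
    ∀ x, 𝓛 R₁ x = x - (2 * inner ℝ n x) • n := by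
  obtain ⟨W, hd, hW⟩ := D.dim_R₁.exists_fixed
  exact exists_reflection D.lin_R₁_R₁ hW hd

/-- A linear isometry compatible with the generators is trivial. -/
theorem eq_one_of_commutes {H : E3 ≃ₗᵢ[ℝ] E3} (hHH : ∀ x, H (H x) = x) (hp : H (p - o) = p - o)
    (h0 : ∀ x, H (𝓛 R₀ x) = 𝓛 R₀ (H x)) (h1 : ∀ x, H (𝓛 R₁ x) = 𝓛 R₁ (H x))
    (h2 : ∀ g ∈ K.G2 (o, s(o, p), F), ∃ g' ∈ K.G2 (o, s(o, p), F), ∀ x, H (𝓛 g x) = 𝓛 g' (H x)) :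
    ∀ x, H x = x := by
  -- The isometry fixing `o` with linear part `H` conjugates the generators among themselves, so it
  -- preserves `K`. It also fixes the base flag, and simple transitivity makes it trivial.
  obtain ⟨h, hh, hho⟩ : ∃ h : Isom3, 𝓛 h = H ∧ h o = o := by
    refine ⟨(AffineIsometryEquiv.constVAdd ℝ E3 (-o)).trans
      (H.toAffineIsometryEquiv.trans (AffineIsometryEquiv.constVAdd ℝ E3 o)), ?_, ?_⟩
    · ext1 x; rfl
    · simp
  have hitw : ∀ g g' : Isom3, H (g o - o) = g' o - o → (∀ x, H (𝓛 g x) = 𝓛 g' (H x)) →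
      Intertwines h g g' := by
    intro g g' ho hl x
    rw [isom_apply_eq h o (g x), isom_apply_eq g' o (h x), isom_apply_eq h o x,
      isom_apply_eq g o x, hho, hh, add_sub_cancel_right, ← hl, add_sub_assoc, map_add, ho]
    abel
  have hi0 : Intertwines h R₀ R₀ := hitw _ _ (by rw [D.R₀_o, hp]) h0
  have hi1 : Intertwines h R₁ R₁ := hitw _ _ (by rw [D.R₁_o, sub_self, map_zero]) h1
  have hi2 : ∀ g g' : Isom3, g ∈ K.G2 (o, s(o, p), F) → g' ∈ K.G2 (o, s(o, p), F) →
      (∀ x, H (𝓛 g x) = 𝓛 g' (H x)) → Intertwines h g g' := fun g g' hg hg' =>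
    hitw _ _ (by rw [(D.mem_G2.1 hg).2.1, (D.mem_G2.1 hg').2.1, sub_self, map_zero])
  have hmap : K.map h = K := by
    conv_lhs => rw [D.eq_wythoff]
    conv_rhs => rw [D.eq_wythoff]
    refine wythoff_map hho hi0 hi1 (fun g hg => ?_) fun g hg => ?_
    · obtain ⟨g', hg', hl⟩ := h2 g hg
      exact ⟨g', subset_closure hg', hi2 g g' hg hg' hl⟩
    · obtain ⟨g', hg', hl⟩ := h2 g hg
      refine ⟨g', subset_closure hg', hi2 g' g hg' hg fun x => ?_⟩
      rw [← hHH (𝓛 g (H x)), hl, hHH]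
  have hsym : h ∈ K.symmetryGroup := by
    refine ⟨hmap, fun w hw => ?_⟩
    rw [D.direction_eq_top, Submodule.top_orthogonal_eq_bot, Submodule.mem_bot] at hw
    rw [hw, map_zero]
  have hhp : h p = p := by rw [← D.R₀_o, hi0, hho]
  have hcl : ∀ g ∈ closure {R₀, R₁}, Intertwines h g g := by
    intro g hg
    induction hg using closure_induction with
    | mem g hg => rcases hg with rfl | rfl <;> assumption
    | one => exact Intertwines.one
    | mul g k _ _ hg hk => exact hg.mul hk
    | inv g _ hg => exact hg.inv
  have hF : Sym2.map h '' F = F := by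
    have : ∀ e ∈ F, Sym2.map h e = e := by
      intro e he
      rw [D.face_eq] at he
      obtain ⟨g, hg, rfl⟩ := he
      rw [(hcl g hg).edge_map, Sym2.map_mk h, hi0, hho]
    conv_rhs => rw [← Set.image_id F]
    exact Set.image_congr this
  have h1 := D.eq_one_of_fix hsym hho hhp hF
  intro x
  rw [← hh, h1]
  rfl

end FlagData

/-! ### Coordinates adapted to a flag -/

section Basis

variable (b : OrthonormalBasis (Fin 3) ℝ E3)

theorem basis_inner (i j : Fin 3) : inner ℝ (b i) (b j) = if i = j then (1 : ℝ) else 0 :=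
  orthonormal_iff_ite.1 b.orthonormal i j

theorem basis_sum (z : E3) :
    z = inner ℝ (b 0) z • b 0 + inner ℝ (b 1) z • b 1 + inner ℝ (b 2) z • b 2 := by
  conv_lhs => rw [← b.sum_repr' z, Fin.sum_univ_three]

theorem basis_ext {A B : E3 ≃ₗᵢ[ℝ] E3} (h : ∀ i, A (b i) = B (b i)) : A = B := by
  ext1 z
  rw [basis_sum b z]
  simp only [map_add, map_smul, h]

theorem trace_eq_basis (A : E3 ≃ₗᵢ[ℝ] E3) : LinearMap.trace ℝ E3 (A.toLinearEquiv : E3 →ₗ[ℝ] E3) =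
    inner ℝ (b 0) (A (b 0)) + inner ℝ (b 1) (A (b 1)) + inner ℝ (b 2) (A (b 2)) := by
  rw [LinearMap.trace_eq_sum_inner _ b, Fin.sum_univ_three]
  rfl

/-- The isometry `A` fixes `b 2` and acts on the plane of `b 0` and `b 1` as the rotation (`ε = 1`)
or the reflection (`ε = -1`) taking `b 0` to `C • b 0 + S • b 1`. -/
structure PlaneForm (A : E3 ≃ₗᵢ[ℝ] E3) (C S ε : ℝ) : Prop where
  sign : ε = 1 ∨ ε = -1
  map_zero : A (b 0) = C • b 0 + S • b 1
  map_one : A (b 1) = (-(ε * S)) • b 0 + (ε * C) • b 1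
  map_two : A (b 2) = b 2

namespace PlaneForm

variable {b} {A B : E3 ≃ₗᵢ[ℝ] E3} {C S ε C' S' ε' : ℝ}

theorem one : PlaneForm b 1 1 0 1 := ⟨Or.inl rfl, by simp, by simp, by simp⟩

theorem mul (hA : PlaneForm b A C S ε) (hB : PlaneForm b B C' S' ε') :
    PlaneForm b (A * B) (C * C' - ε * S * S') (S * C' + ε * C * S') (ε * ε') := by
  refine ⟨?_, ?_, ?_, ?_⟩
  · rcases hA.sign with rfl | rfl <;> rcases hB.sign with rfl | rfl <;> norm_num
  · rw [LinearIsometryEquiv.coe_mul, Function.comp_apply, hB.map_zero]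
    simp only [_root_.map_add, _root_.map_smul, hA.map_zero, hA.map_one]
    module
  · rw [LinearIsometryEquiv.coe_mul, Function.comp_apply, hB.map_one]
    simp only [_root_.map_add, _root_.map_smul, hA.map_zero, hA.map_one]
    rcases hA.sign with rfl | rfl <;> module
  · rw [LinearIsometryEquiv.coe_mul, Function.comp_apply, hB.map_two, hA.map_two]

theorem eq (hA : PlaneForm b A C S ε) (hB : PlaneForm b B C S ε) : A = B := by
  refine basis_ext b fun i => ?_
  fin_cases i
  · exact hA.map_zero.trans hB.map_zero.symm
  · exact hA.map_one.trans hB.map_one.symm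
  · exact hA.map_two.trans hB.map_two.symm

/-- The sign `ε` is the determinant of the block acting on the plane of `b 0` and `b 1`;
orthonormality of the first column then determines the second. -/
theorem exists_of_fix (h : A (b 2) = b 2) :
    ∃ C S ε : ℝ, C ^ 2 + S ^ 2 = 1 ∧ PlaneForm b A C S ε := by
  have hz : ∀ i, i ≠ 2 → inner ℝ (b 2) (A (b i)) = (0 : ℝ) := by
    intro i hi
    nth_rewrite 1 [← h]
    rw [A.inner_map_map, basis_inner, if_neg (Ne.symm hi)]
  have h0 := basis_sum b (A (b 0))
  have h1 := basis_sum b (A (b 1))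
  rw [hz 0 (by decide), zero_smul, add_zero] at h0
  rw [hz 1 (by decide), zero_smul, add_zero] at h1
  set C := inner ℝ (b 0) (A (b 0))
  set S := inner ℝ (b 1) (A (b 0))
  set C' := inner ℝ (b 0) (A (b 1))
  set S' := inner ℝ (b 1) (A (b 1))
  have e1 : C ^ 2 + S ^ 2 = 1 := by
    have := A.inner_map_map (b 0) (b 0)
    rw [h0] at this
    simp only [inner_add_left, inner_add_right, real_inner_smul_left, real_inner_smul_right,
      basis_inner,
      Fin.reduceEq, if_true, if_false] at this
    linarith
  have e2 : C' ^ 2 + S' ^ 2 = 1 := by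
    have := A.inner_map_map (b 1) (b 1)
    rw [h1] at this
    simp only [inner_add_left, inner_add_right, real_inner_smul_left, real_inner_smul_right,
      basis_inner,
      Fin.reduceEq, if_true, if_false] at this
    linarith
  have e3 : C * C' + S * S' = 0 := by
    have := A.inner_map_map (b 0) (b 1)
    rw [h0, h1] at this
    simp only [inner_add_left, inner_add_right, real_inner_smul_left, real_inner_smul_right,
      basis_inner,
      Fin.reduceEq, if_true, if_false] at this
    linarith
  have e4 : (C * S' - S * C') ^ 2 = 1 := by
    linear_combination (C' ^ 2 + S' ^ 2) * e1 + e2 - (C * C' + S * S') * e3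
  have e5 : C' = -((C * S' - S * C') * S) := by linear_combination (-C') * e1 + C * e3
  have e6 : S' = (C * S' - S * C') * C := by linear_combination (-S') * e1 + S * e3
  refine ⟨C, S, C * S' - S * C', e1, ?_, h0, ?_, h⟩
  · exact mul_self_eq_one_iff.1 (by rw [← sq]; exact e4)
  · rw [← e5, ← e6]; exact h1

end PlaneForm

end Basis

/-- An orthonormal basis adapted to the base flag: `b 2` is the direction of the base edge,
`s • b 0 + c • b 2` a unit normal of the mirror of `R₁`, and `R₀` acts on the plane of `b 0` and
`b 1` as the reflection taking `b 0` to `x • b 0 + y • b 1`. -/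
structure FlagFrame (K : PolygonalFigure) (o p : E3) (F : Set (Sym2 E3)) (R₀ R₁ : Isom3)
    (b : OrthonormalBasis (Fin 3) ℝ E3) (l s c x y : ℝ) : Prop extends
    FlagData K o p F R₀ R₁ where
  p_eq : p - o = l • b 2
  l_ne : l ≠ 0
  sc : s ^ 2 + c ^ 2 = 1
  s_ne : s ≠ 0
  c_ne : c ≠ 0
  xy : x ^ 2 + y ^ 2 = 1
  lin_R₁ : ∀ z, 𝓛 R₁ z = z - (2 * inner ℝ (s • b 0 + c • b 2) z) • (s • b 0 + c • b 2)
  lin_R₀_zero : 𝓛 R₀ (b 0) = x • b 0 + y • b 1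
  lin_R₀_one : 𝓛 R₀ (b 1) = y • b 0 - x • b 1
  lin_R₀_two : 𝓛 R₀ (b 2) = -b 2

/-- Gram–Schmidt applied to the edge direction and the normal of the mirror of `R₁`. The normal is
neither parallel nor orthogonal to the edge, because `R₁` does not preserve the line of the edge;
this gives `s ≠ 0` and `c ≠ 0`. -/
theorem FlagData.exists_frame {K : PolygonalFigure} {o p : E3} {F : Set (Sym2 E3)} {R₀ R₁ : Isom3}
    (D : FlagData K o p F R₀ R₁) : ∃ b l s c x y, FlagFrame K o p F R₀ R₁ b l s c x y := by
  obtain ⟨d, hd1, hdp, hd⟩ := D.exists_axis_R₀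
  obtain ⟨n, hn1, hn⟩ := D.exists_normal_R₁
  set l := ‖p - o‖ with hl
  have hl0 : l ≠ 0 := norm_ne_zero_iff.2 D.vec_ne_zero
  set u := l⁻¹ • (p - o) with hu
  have hpu : p - o = l • u := by rw [hu, smul_smul, mul_inv_cancel₀ hl0, one_smul]
  have huu : inner ℝ u u = (1 : ℝ) := by
    rw [hu, real_inner_smul_left, real_inner_smul_right, real_inner_self_eq_norm_sq, ← hl]
    field_simp
  set c := inner ℝ n u with hc
  set m := n - c • u with hm
  have hmu : inner ℝ m u = (0 : ℝ) := by
    rw [hm, inner_sub_left, real_inner_smul_left, huu, hc]; ring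
  have hR1 : ∀ k : ℝ, 𝓛 R₁ u ≠ k • u := by
    intro k hk
    refine D.vec_ne_of_R₁ k ?_
    rw [hpu, map_smul, hk, smul_comm]
  have hc0 : c ≠ 0 := by
    intro h0
    refine hR1 1 ?_
    rw [hn, ← hc, h0, mul_zero, zero_smul, sub_zero, one_smul]
  have hm0 : m ≠ 0 := by
    intro h0
    refine hR1 (1 - 2 * c * c) ?_
    have : n = c • u := sub_eq_zero.1 h0
    rw [hn, ← hc]
    nth_rewrite 1 [this]
    module
  set s := ‖m‖ with hs
  have hs0 : s ≠ 0 := norm_ne_zero_iff.2 hm0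
  have horth : Orthonormal ℝ (({0, 2} : Set (Fin 3)).domRestrict ![s⁻¹ • m, 0, u]) := by
    have h1 : inner ℝ (s⁻¹ • m) (s⁻¹ • m) = (1 : ℝ) := by
      rw [real_inner_smul_left, real_inner_smul_right, real_inner_self_eq_norm_sq, ← hs]
      field_simp
    rw [orthonormal_iff_ite]
    rintro ⟨i, hi⟩ ⟨j, hj⟩
    rcases hi with rfl | rfl <;> rcases hj with rfl | rfl
    · simpa [Set.domRestrict] using h1
    · rw [if_neg fun h => absurd (congrArg Subtype.val h) (by decide : (0 : Fin 3) ≠ 2)]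
      simp [Set.domRestrict, real_inner_smul_left, hmu]
    · rw [if_neg fun h => absurd (congrArg Subtype.val h) (by decide : (2 : Fin 3) ≠ 0),
        real_inner_comm]
      simp [Set.domRestrict, real_inner_smul_left, hmu]
    · simpa [Set.domRestrict] using huu
  obtain ⟨b, hb⟩ := horth.exists_orthonormalBasis_extension_of_card_eq (by simp)
  have hb0 : b 0 = s⁻¹ • m := hb 0 (by simp)
  have hb2 : b 2 = u := hb 2 (by simp)
  have hnb : n = s • b 0 + c • b 2 := by
    rw [hb0, hb2, smul_smul, mul_inv_cancel₀ hs0, one_smul, hm]; abel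
  have hdb2 : inner ℝ (b 2) d = (0 : ℝ) := by
    rw [hb2, hu, real_inner_smul_left, real_inner_comm, hdp, mul_zero]
  have hdb := basis_sum b d
  rw [hdb2, zero_smul, add_zero] at hdb
  set α := inner ℝ (b 0) d with hα
  set β := inner ℝ (b 1) d with hβ
  have hαβ : α ^ 2 + β ^ 2 = 1 := by
    rw [hdb] at hd1
    simp only [inner_add_left, inner_add_right, real_inner_smul_left, real_inner_smul_right,
      basis_inner,
      Fin.reduceEq, if_true, if_false] at hd1
    linarith
  -- The half-turn about `d = α • b 0 + β • b 1` takes `b 0` to `(2α) • d - b 0`.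
  refine ⟨b, l, s, c, 2 * α ^ 2 - 1, 2 * α * β, D, by rw [hb2, hpu], hl0, ?_, hs0, hc0, ?_,
    ?_, ?_, ?_, ?_⟩
  · rw [hnb] at hn1
    simp only [inner_add_left, inner_add_right, real_inner_smul_left, real_inner_smul_right,
      basis_inner,
      Fin.reduceEq, if_true, if_false] at hn1
    linarith
  · linear_combination (4 * α ^ 2) * hαβ
  · rw [← hnb]; exact hn
  · rw [hd, real_inner_comm, ← hα]
    nth_rewrite 1 [hdb]
    module
  · rw [hd, real_inner_comm, ← hβ]
    nth_rewrite 1 [hdb]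
    have : 2 * β ^ 2 - 1 = -(2 * α ^ 2 - 1) := by linarith
    have h2 : (2 * β) • (α • b 0 + β • b 1) - b 1 = (2 * α * β) • b 0 + (2 * β ^ 2 - 1) • b 1 := by
      module
    rw [h2, this]
    module
  · rw [hd, real_inner_comm, hdb2, mul_zero, zero_smul, zero_sub]

/-! ### Integrality constraints on the frame and on `G₂` -/

namespace FlagFrame

variable {K : PolygonalFigure} {o p : E3} {F : Set (Sym2 E3)} {R₀ R₁ : Isom3}
  {b : OrthonormalBasis (Fin 3) ℝ E3} {l s c x y : ℝ} (D : FlagFrame K o p F R₀ R₁ b l s c x y)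

include D

/-- The coordinate forms of the elements of `G₂`. -/
def Rep (_ : FlagFrame K o p F R₀ R₁ b l s c x y) (C S ε : ℝ) : Prop :=
  ∃ g ∈ K.G2 (o, s(o, p), F), PlaneForm b (𝓛 g) C S ε

/-- Since `R₁` acts as `1 - 2 n nᵀ` for the unit normal `n`, the number is the difference of the
traces of `g` and `g * R₁`. -/
theorem inner_normal_int {g : Isom3} (hg : g ∈ K.symmetryGroup) :
    ∃ m : ℤ, 2 * inner ℝ (s • b 0 + c • b 2) (𝓛 g (s • b 0 + c • b 2)) = (m : ℝ) := by
  obtain ⟨m, hm⟩ := D.trace_int hg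
  obtain ⟨m', hm'⟩ := D.trace_int (mul_mem hg D.R₁_mem)
  refine ⟨m - m', ?_⟩
  rw [Int.cast_sub, ← hm, ← hm', trace_eq_basis b, trace_eq_basis b, lin_mul, lin_mul, lin_mul,
    D.lin_R₁, D.lin_R₁, D.lin_R₁]
  simp only [map_sub, map_smul, map_add, inner_sub_right, inner_add_left, inner_add_right,
    real_inner_smul_left, real_inner_smul_right, basis_inner]
  simp
  ring

theorem lin_two {g : Isom3} (hg : g ∈ K.G2 (o, s(o, p), F)) : 𝓛 g (b 2) = b 2 := by
  have := D.lin_G2 hg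
  rw [D.p_eq, map_smul] at this
  exact smul_right_injective _ D.l_ne this

theorem exists_form {g : Isom3} (hg : g ∈ K.G2 (o, s(o, p), F)) :
    ∃ C S ε : ℝ, C ^ 2 + S ^ 2 = 1 ∧ PlaneForm b (𝓛 g) C S ε :=
  PlaneForm.exists_of_fix (D.lin_two hg)

theorem rep_one : D.Rep 1 0 1 := ⟨1, one_mem _, PlaneForm.one⟩

end FlagFrame

namespace FlagFrame

variable {K : PolygonalFigure} {o p : E3} {F : Set (Sym2 E3)} {R₀ R₁ : Isom3}
  {b : OrthonormalBasis (Fin 3) ℝ E3} {l s c x y : ℝ} {D : FlagFrame K o p F R₀ R₁ b l s c x y}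

theorem Rep.mul {C S ε C' S' ε' : ℝ} (h : D.Rep C S ε) (h' : D.Rep C' S' ε') :
    D.Rep (C * C' - ε * S * S') (S * C' + ε * C * S') (ε * ε') := by
  obtain ⟨g, hg, hf⟩ := h
  obtain ⟨g', hg', hf'⟩ := h'
  exact ⟨g * g', mul_mem hg hg', hf.mul hf'⟩

theorem Rep.eq_one (D : FlagFrame K o p F R₀ R₁ b l s c x y) {g : Isom3}
    (hg : g ∈ K.G2 (o, s(o, p), F)) (h : PlaneForm b (𝓛 g) 1 0 1) : g = 1 :=
  D.G2_ext hg (one_mem _) (h.eq PlaneForm.one)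

theorem Rep.sq {C S ε : ℝ} (h : D.Rep C S ε) : C ^ 2 + S ^ 2 = 1 := by
  obtain ⟨g, hg, hf⟩ := h
  have := (𝓛 g).inner_map_map (b 0) (b 0)
  rw [hf.map_zero] at this
  simp only [inner_add_left, inner_add_right, real_inner_smul_left, real_inner_smul_right,
    basis_inner,
      Fin.reduceEq, if_true, if_false] at this
  linarith

/-- For the unit normal `n`, `⟨n, g n⟩ = s² C + c² = 1 - s² (1 - C)`. -/
theorem Rep.int_normal {C S ε : ℝ} (h : D.Rep C S ε) : ∃ m : ℤ, 2 * s ^ 2 * (1 - C) = m := by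
  obtain ⟨g, hg, hf⟩ := h
  obtain ⟨m, hm⟩ := D.inner_normal_int (D.mem_G2.1 hg).1
  refine ⟨2 - m, ?_⟩
  rw [map_add, map_smul, map_smul, hf.map_zero, hf.map_two] at hm
  simp only [inner_add_left, inner_add_right, real_inner_smul_left, real_inner_smul_right,
    basis_inner,
      Fin.reduceEq, if_true, if_false] at hm
  rw [Int.cast_sub, ← hm]
  push_cast
  linear_combination 2 * D.sc

theorem Rep.int_rotation {C S : ℝ} (h : D.Rep C S 1) : ∃ m : ℤ, 2 * C = m := by
  obtain ⟨g, hg, hf⟩ := h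
  obtain ⟨m, hm⟩ := D.trace_int (D.mem_G2.1 hg).1
  refine ⟨m - 1, ?_⟩
  rw [trace_eq_basis b, hf.map_zero, hf.map_one, hf.map_two] at hm
  simp only [inner_add_right, real_inner_smul_right, basis_inner,
      Fin.reduceEq, if_true, if_false] at hm
  rw [Int.cast_sub, ← hm]
  push_cast
  ring

/-- Apply `inner_normal_int` to `R₀ * g`: there `⟨n, R₀ g n⟩ = s² (Cx + Sy) - c²`. -/
theorem Rep.int_halfturn {C S ε : ℝ} (h : D.Rep C S ε) :
    ∃ m : ℤ, 2 * s ^ 2 * (1 + (C * x + S * y)) = m := by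
  obtain ⟨g, hg, hf⟩ := h
  obtain ⟨m, hm⟩ := D.inner_normal_int (mul_mem D.R₀_mem (D.mem_G2.1 hg).1)
  refine ⟨2 + m, ?_⟩
  rw [lin_mul, map_add, map_smul, map_smul, hf.map_zero, hf.map_two, map_add, map_smul, map_smul,
    map_add, map_smul, map_smul, D.lin_R₀_zero, D.lin_R₀_one, D.lin_R₀_two] at hm
  simp only [inner_add_left, inner_add_right, inner_sub_right, inner_neg_right,
    real_inner_smul_left, real_inner_smul_right, basis_inner,
      Fin.reduceEq, if_true, if_false] at hm
  rw [Int.cast_add, ← hm]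
  push_cast
  linear_combination 2 * D.sc

/-- The linear part of `R₀ * g` is a rotation of the plane with cosine `Cx + Sy`, combined with `-1`
on `b 2`. -/
theorem Rep.int_reflection {C S : ℝ} (h : D.Rep C S (-1)) : ∃ m : ℤ, 2 * (C * x + S * y) = m := by
  obtain ⟨g, hg, hf⟩ := h
  obtain ⟨m, hm⟩ := D.trace_int (mul_mem D.R₀_mem (D.mem_G2.1 hg).1)
  refine ⟨m + 1, ?_⟩
  rw [trace_eq_basis b, lin_mul, lin_mul, lin_mul, hf.map_zero, hf.map_one, hf.map_two] at hm
  simp only [map_add, map_smul, D.lin_R₀_zero, D.lin_R₀_one, D.lin_R₀_two] at hm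
  simp only [inner_add_right, inner_sub_right, inner_neg_right, real_inner_smul_right, basis_inner,
      Fin.reduceEq, if_true, if_false] at hm
  rw [Int.cast_add, ← hm]
  push_cast
  ring

/-- Conjugating `R₁` produces further reflections in `G₂`. -/
theorem Rep.reflection_of_rotation {C S : ℝ} (h : D.Rep C S 1) (hC : 2 * s ^ 2 * (1 - C) = 1) :
    D.Rep C S (-1) := by
  obtain ⟨g, hg, hf⟩ := h
  obtain ⟨hgG, hgo, hgp⟩ := D.mem_G2.1 hg
  have hsq : C ^ 2 + S ^ 2 = 1 := Rep.sq (D := D) ⟨g, hg, hf⟩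
  have hinv : g⁻¹ o = o := by rw [← hgo, isom_inv_apply_self, hgo]
  set n := s • b 0 + c • b 2 with hn
  -- By `hC` the unit vectors `n` and `𝓛 g n` enclose 60°, so `R₁` sends `𝓛 g n` to `w`, which is
  -- orthogonal to the edge. Conjugating by `R₁` the reflection with normal `𝓛 g n` therefore gives
  -- a reflection in `G₂`.
  set w := 𝓛 g n - n with hw
  have hw' : w = (s * (C - 1)) • b 0 + (s * S) • b 1 := by
    rw [hw, hn, map_add, map_smul, map_smul, hf.map_zero, hf.map_two]; module
  have hnn : inner ℝ n n = (1 : ℝ) := by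
    rw [hn]
    simp only [inner_add_left, inner_add_right, real_inner_smul_left, real_inner_smul_right,
      basis_inner,
      Fin.reduceEq, if_true, if_false]
    linear_combination D.sc
  have hgn : 2 * inner ℝ (𝓛 g n) n = (1 : ℝ) := by
    rw [hn, map_add, map_smul, map_smul, hf.map_zero, hf.map_two]
    simp only [inner_add_left, inner_add_right, real_inner_smul_left, real_inner_smul_right,
      basis_inner,
      Fin.reduceEq, if_true, if_false]
    linear_combination 2 * D.sc - hC
  have hconj : ∀ z, 𝓛 (g * R₁ * g⁻¹) z = z - (2 * inner ℝ (𝓛 g n) z) • 𝓛 g n := by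
    intro z
    rw [lin_mul, lin_mul, D.lin_R₁, map_sub, map_smul, lin_apply_inv, ← (𝓛 g).inner_map_map n,
      lin_apply_inv]
  set k := R₁ * (g * R₁ * g⁻¹) * R₁ with hk
  have hkl : ∀ z, 𝓛 k z = z - (2 * inner ℝ w z) • w := by
    intro z
    have hR1n : 𝓛 R₁ (𝓛 g n) = w := by
      rw [D.lin_R₁, real_inner_comm, hgn, one_smul]
    rw [hk, lin_mul, lin_mul, hconj, map_sub, D.lin_R₁_R₁, map_smul, hR1n,
      ← (𝓛 R₁).inner_map_map (𝓛 g n), D.lin_R₁_R₁, hR1n]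
  have hko : k o = o := by
    rw [hk, isom_mul_apply, isom_mul_apply, isom_mul_apply, isom_mul_apply, D.R₁_o, hinv, D.R₁_o,
      hgo, D.R₁_o]
  have hkG : k ∈ K.symmetryGroup :=
    mul_mem (mul_mem D.R₁_mem (mul_mem (mul_mem hgG D.R₁_mem) (inv_mem hgG))) D.R₁_mem
  have hform : PlaneForm b (𝓛 k) C S (-1) := by
    refine ⟨Or.inr rfl, ?_, ?_, ?_⟩
    · rw [hkl, hw']
      simp only [inner_add_left, real_inner_smul_left, basis_inner]
      simp
      have e1 : 2 * (s * (C - 1)) * (s * (C - 1)) = 1 - C := by linear_combination (1 - C) * hC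
      have e2 : 2 * (s * (C - 1)) * (s * S) = -S := by linear_combination (-S) * hC
      rw [smul_smul, smul_smul, e1, e2]
      module
    · rw [hkl, hw']
      simp only [inner_add_left, real_inner_smul_left, basis_inner]
      simp
      have e1 : 2 * (s * S) * (s * (C - 1)) = -S := by linear_combination (-S) * hC
      have e2 : 2 * (s * S) * (s * S) = 1 + C := by
        linear_combination (1 + C) * hC + (2 * s ^ 2) * hsq
      rw [smul_smul, smul_smul, e1, e2]
      module
    · rw [hkl, hw']
      simp only [inner_add_left, real_inner_smul_left, basis_inner]
      simp
  refine ⟨k, D.mem_G2.2 ⟨hkG, hko, ?_⟩, hform⟩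
  have h1 := lin_sub k p o
  rw [D.p_eq, map_smul, hform.map_two, ← D.p_eq, hko] at h1
  exact (sub_left_injective h1).symm

/-- If the plane of `b 0` and `b 2` contains the axis of `R₀`, some element of `G₂` is not
compatible with the reflection in that plane. -/
theorem not_symmetric (D : FlagFrame K o p F R₀ R₁ b l s c x y) (hy : y = 0) :
    ∃ C S ε, D.Rep C S ε ∧ ¬ D.Rep C (-S) ε := by
  by_contra! hcon
  -- Conjugation by the reflection with normal `b 1` turns the form `(C, S, ε)` into `(C, -S, ε)`,
  -- and for `y = 0` it commutes with both linear generators. If it also preserved `G₂`,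
  -- `eq_one_of_commutes` would make it trivial.
  obtain ⟨H, hH⟩ : ∃ H : E3 ≃ₗᵢ[ℝ] E3, ∀ z, H z = z - (2 * inner ℝ (b 1) z) • b 1 := by
    refine ⟨(Submodule.span ℝ {b 1})ᗮ.reflection, fun z => ?_⟩
    rw [Submodule.reflection_orthogonal_apply, Submodule.reflection_singleton_apply]
    have : ‖b 1‖ = 1 := b.norm_eq_one 1
    rw [this]
    simp
    module
  have hH0 : H (b 0) = b 0 := by rw [hH]; simp
  have hH1 : H (b 1) = -b 1 := by
    rw [hH]; simp only [basis_inner, if_true]; module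
  have hH2 : H (b 2) = b 2 := by rw [hH]; simp
  have hext : ∀ A B : E3 ≃ₗᵢ[ℝ] E3, (∀ i, H (A (b i)) = B (H (b i))) → ∀ z, H (A z) = B (H z) := by
    intro A B h z
    have : H * A = B * H := basis_ext b h
    exact congrArg (fun L : E3 ≃ₗᵢ[ℝ] E3 => L z) this
  have key := D.eq_one_of_commutes (H := H) ?_ ?_ ?_ ?_ ?_ (b 1)
  · rw [hH1] at key
    have h1 := basis_inner b 1 1
    nth_rewrite 1 [← key] at h1
    rw [inner_neg_left, basis_inner, if_pos rfl] at h1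
    norm_num at h1
  · have : H * H = 1 := basis_ext b fun i => by
      fin_cases i
      · change H (H (b 0)) = b 0; rw [hH0, hH0]
      · change H (H (b 1)) = b 1; rw [hH1, map_neg, hH1, neg_neg]
      · change H (H (b 2)) = b 2; rw [hH2, hH2]
    exact fun z => congrArg (fun L : E3 ≃ₗᵢ[ℝ] E3 => L z) this
  · rw [D.p_eq, map_smul, hH2]
  · refine hext _ _ fun i => ?_
    fin_cases i
    · change H (𝓛 R₀ (b 0)) = 𝓛 R₀ (H (b 0))
      rw [hH0, D.lin_R₀_zero, hy, zero_smul, add_zero, map_smul, hH0]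
    · change H (𝓛 R₀ (b 1)) = 𝓛 R₀ (H (b 1))
      rw [hH1, map_neg, D.lin_R₀_one, hy, zero_smul, zero_sub, map_neg, map_smul, hH1]
      module
    · change H (𝓛 R₀ (b 2)) = 𝓛 R₀ (H (b 2))
      rw [hH2, D.lin_R₀_two, map_neg, hH2]
  · intro z
    have hHn : H (s • b 0 + c • b 2) = s • b 0 + c • b 2 := by
      rw [map_add, map_smul, map_smul, hH0, hH2]
    rw [D.lin_R₁, D.lin_R₁, map_sub, map_smul, hHn]
    congr 3
    nth_rewrite 2 [← hHn]
    rw [H.inner_map_map]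
  · intro g hg
    obtain ⟨C, S, ε, -, hf⟩ := D.exists_form hg
    obtain ⟨g', hg', hf'⟩ := hcon C S ε ⟨g, hg, hf⟩
    refine ⟨g', hg', hext _ _ fun i => ?_⟩
    fin_cases i
    · change H (𝓛 g (b 0)) = 𝓛 g' (H (b 0))
      rw [hH0, hf.map_zero, hf'.map_zero, map_add, map_smul, map_smul, hH0, hH1]
      module
    · change H (𝓛 g (b 1)) = 𝓛 g' (H (b 1))
      rw [hH1, map_neg, hf.map_one, hf'.map_one, map_add, map_smul, map_smul, hH0, hH1]
      module
    · change H (𝓛 g (b 2)) = 𝓛 g' (H (b 2))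
      rw [hH2, hf.map_two, hf'.map_two, hH2]

/-- The axis of `R₀` is not parallel to the mirror of `R₁`, since the faces are finite. -/
theorem x_ne (D : FlagFrame K o p F R₀ R₁ b l s c x y) : x ≠ -1 := by
  intro hx
  have hy : y = 0 := by have := D.xy; rw [hx] at this; nlinarith
  set n := s • b 0 + c • b 2 with hn
  -- If `x = -1`, `R₀` reverses the normal `n`, the linear parts of `R₀` and `R₁` commute, and `τ`
  -- is the translation by `(2 l c) • n`. Its powers move `o` to infinitely many vertices of the
  -- finite face `F`.
  set τ := R₀ * R₁ * (R₀ * R₁) with hτ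
  have h0n : 𝓛 R₀ n = -n := by
    rw [hn, map_add, map_smul, map_smul, D.lin_R₀_zero, D.lin_R₀_two, hx, hy]; module
  have hcomm : ∀ z, 𝓛 (R₀ * R₁) z = 𝓛 R₀ z + (2 * inner ℝ n z) • n := by
    intro z
    rw [lin_mul, D.lin_R₁, map_sub, map_smul, h0n]; module
  have hlin : ∀ z, 𝓛 τ z = z := by
    intro z
    rw [hτ, lin_mul, hcomm z, map_add, map_smul, hcomm, hcomm n, h0n, D.lin_R₀_R₀]
    have h1 : inner ℝ n (𝓛 R₀ z) = -inner ℝ n z := by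
      rw [← (𝓛 R₀).inner_map_map, D.lin_R₀_R₀, h0n, inner_neg_left]
    have h2 : inner ℝ n n = (1 : ℝ) := by
      rw [hn]
      simp only [inner_add_left, inner_add_right, real_inner_smul_left, real_inner_smul_right,
        basis_inner,
      Fin.reduceEq, if_true, if_false]
      linear_combination D.sc
    rw [h1, h2]
    module
  have hinn : inner ℝ n (p - o) = l * c := by
    rw [hn, D.p_eq]
    simp only [inner_add_left, real_inner_smul_left, real_inner_smul_right, basis_inner,
      Fin.reduceEq, if_true, if_false]
    ring
  have hRo : (R₀ * R₁) o = p := by rw [isom_mul_apply, D.R₁_o, D.R₀_o]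
  have hτo : τ o = o + (2 * (l * c)) • n := by
    rw [hτ, isom_mul_apply, hRo, isom_apply_eq (R₀ * R₁) o p, hRo, hcomm, D.lin_R₀_vec, hinn]
    abel
  have hτF : Sym2.map τ '' F = F := by
    rw [hτ, face_map_mul]
    simp only [face_map_mul, D.R₁_F, D.R₀_F]
  have hpow : ∀ k : ℕ, Sym2.map (τ ^ k : Isom3) '' F = F ∧
      (τ ^ k) o = o + (k * (2 * (l * c))) • n := by
    intro k
    induction k with
    | zero => rw [pow_zero, face_map_one]; exact ⟨rfl, by simp⟩
    | succ k ih =>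
      rw [pow_succ', face_map_mul, ih.1, hτF]
      refine ⟨rfl, ?_⟩
      rw [isom_mul_apply, ih.2, isom_apply_eq τ o, hlin, hτo]
      push_cast
      module
  set V := ⋃ e ∈ F, {z | z ∈ e}
  have hV : V.Finite := D.polygon.finite.biUnion fun e _ => by
    induction e with | _ a b =>
    refine (Set.toFinite {a, b}).subset fun z hz => ?_
    exact Sym2.mem_iff.1 hz
  have hmem : ∀ k : ℕ, (τ ^ k) o ∈ V := by
    intro k
    refine Set.mem_biUnion (x := Sym2.map (τ ^ k : Isom3) s(o, p)) ?_ (Sym2.mem_mk_left _ _)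
    rw [← (hpow k).1]
    exact ⟨_, D.e_mem_F, rfl⟩
  refine Set.infinite_of_injective_forall_mem (f := fun k : ℕ => (τ ^ k) o) ?_ hmem hV
  intro i j hij
  dsimp only at hij
  rw [(hpow i).2, (hpow j).2, add_right_inj] at hij
  have hn0 : n ≠ 0 := by
    intro h0
    rw [h0, inner_zero_left] at hinn
    exact mul_ne_zero D.l_ne D.c_ne hinn.symm
  have := smul_left_injective ℝ hn0 hij
  have hne : 2 * (l * c) ≠ 0 := mul_ne_zero two_ne_zero (mul_ne_zero D.l_ne D.c_ne)
  exact_mod_cast mul_right_cancel₀ hne this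

end FlagFrame

/-! ### The possible groups `G₂` -/

namespace FlagFrame

variable {K : PolygonalFigure} {o p : E3} {F : Set (Sym2 E3)} {R₀ R₁ : Isom3}
  {b : OrthonormalBasis (Fin 3) ℝ E3} {l s c x y : ℝ} {D : FlagFrame K o p F R₀ R₁ b l s c x y}

theorem Rep.bounds {C S ε : ℝ} (h : D.Rep C S ε) : -1 ≤ C ∧ C ≤ 1 := by
  have := h.sq
  constructor <;> nlinarith [sq_nonneg S]

theorem Rep.sign {C S ε : ℝ} (h : D.Rep C S ε) : ε = 1 ∨ ε = -1 := by
  obtain ⟨g, -, hf⟩ := h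
  exact hf.sign

theorem Rep.congr {C S ε C' S' ε' : ℝ} (h : D.Rep C S ε) (hC : C = C') (hS : S = S')
    (hε : ε = ε') : D.Rep C' S' ε' := by
  rw [← hC, ← hS, ← hε]; exact h

theorem sq_pos (D : FlagFrame K o p F R₀ R₁ b l s c x y) : 0 < s ^ 2 := by
  have := D.s_ne; positivity

theorem sq_lt_one (D : FlagFrame K o p F R₀ R₁ b l s c x y) : s ^ 2 < 1 := by
  have h := D.c_ne
  have : 0 < c ^ 2 := by positivity
  linarith [D.sc]

theorem x_bounds (D : FlagFrame K o p F R₀ R₁ b l s c x y) : -1 < x ∧ x ≤ 1 := by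
  have := D.xy
  refine ⟨lt_of_le_of_ne ?_ D.x_ne.symm, ?_⟩ <;> nlinarith [sq_nonneg y]

/-- `G₂` contains at least two nontrivial elements. -/
theorem exists_two_rep (D : FlagFrame K o p F R₀ R₁ b l s c x y) :
    ∃ C S ε C' S' ε', D.Rep C S ε ∧ D.Rep C' S' ε' ∧ ¬ (C = 1 ∧ S = 0 ∧ ε = 1) ∧
      ¬ (C' = 1 ∧ S' = 0 ∧ ε' = 1) ∧ ¬ (C = C' ∧ S = S' ∧ ε = ε') := by
  obtain ⟨g, hg, h, hh, hg1, hh1, hgh⟩ := D.exists_two_G2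
  obtain ⟨C, S, ε, -, hf⟩ := D.exists_form hg
  obtain ⟨C', S', ε', -, hf'⟩ := D.exists_form hh
  refine ⟨C, S, ε, C', S', ε', ⟨g, hg, hf⟩, ⟨h, hh, hf'⟩, ?_, ?_, ?_⟩
  · rintro ⟨rfl, rfl, rfl⟩
    exact hg1 (Rep.eq_one D hg hf)
  · rintro ⟨rfl, rfl, rfl⟩
    exact hh1 (Rep.eq_one D hh hf')
  · rintro ⟨rfl, rfl, rfl⟩
    exact hgh (D.G2_ext hg hh (hf.eq hf'))

/-- Of two distinct nontrivial elements either one is a rotation, or both are reflections and their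
product is a nontrivial rotation. -/
theorem exists_rotation (D : FlagFrame K o p F R₀ R₁ b l s c x y) :
    ∃ C S, D.Rep C S 1 ∧ ¬ (C = 1 ∧ S = 0) := by
  obtain ⟨C, S, ε, C', S', ε', h, h', h1, h1', hne⟩ := D.exists_two_rep
  rcases h.sign with rfl | rfl
  · exact ⟨C, S, h, fun hc => h1 ⟨hc.1, hc.2, rfl⟩⟩
  rcases h'.sign with rfl | rfl
  · exact ⟨C', S', h', fun hc => h1' ⟨hc.1, hc.2, rfl⟩⟩
  refine ⟨_, _, (h.mul h').congr rfl rfl (by norm_num), fun hc => hne ?_⟩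
  have e1 := h.sq
  have e2 := h'.sq
  have e3 : (C - C') ^ 2 + (S - S') ^ 2 = 0 := by linear_combination e1 + e2 - 2 * hc.1
  have e4 : C - C' = 0 := by nlinarith [sq_nonneg (C - C'), sq_nonneg (S - S')]
  have e5 : S - S' = 0 := by nlinarith [sq_nonneg (C - C'), sq_nonneg (S - S')]
  exact ⟨by linarith, by linarith, rfl⟩

theorem exists_reflection (D : FlagFrame K o p F R₀ R₁ b l s c x y)
    (hrot : ∀ C S, D.Rep C S 1 → S = 0 ∧ (C = 1 ∨ C = -1)) : ∃ C S, D.Rep C S (-1) := by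
  obtain ⟨C, S, ε, C', S', ε', h, h', h1, h1', hne⟩ := D.exists_two_rep
  rcases h.sign with rfl | rfl
  · rcases h'.sign with rfl | rfl
    · exfalso
      obtain ⟨rfl, hC⟩ := hrot _ _ h
      obtain ⟨rfl, hC'⟩ := hrot _ _ h'
      rcases hC with rfl | rfl
      · exact h1 ⟨rfl, rfl, rfl⟩
      rcases hC' with rfl | rfl
      · exact h1' ⟨rfl, rfl, rfl⟩
      exact hne ⟨rfl, rfl, rfl⟩
    · exact ⟨C', S', h'⟩
  · exact ⟨C, S, h⟩

/-- The rotations in `G₂`. -/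
theorem Rep.rotation_cases {C S : ℝ} (h : D.Rep C S 1) :
    (C = 1 ∧ S = 0) ∨ (C = -1 ∧ S = 0 ∧ (s ^ 2 = 1 / 4 ∨ s ^ 2 = 1 / 2 ∨ s ^ 2 = 3 / 4)) ∨
    (C = -1 / 2 ∧ S ^ 2 = 3 / 4 ∧ (s ^ 2 = 1 / 3 ∨ s ^ 2 = 2 / 3)) ∨
    (C = 0 ∧ S ^ 2 = 1 ∧ s ^ 2 = 1 / 2) := by
  obtain ⟨m, hm⟩ := h.int_rotation
  obtain ⟨k, hk⟩ := h.int_normal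
  have hsq := h.sq
  have h0 := D.sq_pos
  have h1 := D.sq_lt_one
  obtain ⟨hl, hu⟩ := h.bounds
  have m1 : -2 ≤ m := by have : ((-2 : ℤ) : ℝ) ≤ m := by push_cast; linarith
                         exact_mod_cast this
  have m2 : m ≤ 2 := by have : (m : ℝ) ≤ (2 : ℤ) := by push_cast; linarith
                        exact_mod_cast this
  have k1 : 0 ≤ k := by have : ((0 : ℤ) : ℝ) ≤ k := by push_cast; rw [← hk]; nlinarith
                        exact_mod_cast this
  have k2 : k < 4 := by have : (k : ℝ) < (4 : ℤ) := by push_cast; rw [← hk]; nlinarith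
                        exact_mod_cast this
  interval_cases m
  · have hC : C = -1 := by push_cast at hm; linarith
    subst hC
    refine Or.inr (Or.inl ⟨rfl, by nlinarith, ?_⟩)
    interval_cases k <;> push_cast at hk
    · linarith
    · left; linarith
    · right; left; linarith
    · right; right; linarith
  · have hC : C = -1 / 2 := by push_cast at hm; linarith
    subst hC
    refine Or.inr (Or.inr (Or.inl ⟨rfl, by nlinarith, ?_⟩))
    interval_cases k <;> push_cast at hk
    · linarith
    · left; linarith
    · right; linarith
    · linarith
  · have hC : C = 0 := by push_cast at hm; linarith
    subst hC
    refine Or.inr (Or.inr (Or.inr ⟨rfl, by nlinarith, ?_⟩))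
    interval_cases k <;> push_cast at hk <;> linarith
  -- A rotation of order six would make `s²` itself an integer, although `0 < s² < 1`.
  · have hC : C = 1 / 2 := by push_cast at hm; linarith
    subst hC
    exfalso
    interval_cases k <;> push_cast at hk <;> linarith
  · have hC : C = 1 := by push_cast at hm; linarith
    subst hC
    exact Or.inl ⟨rfl, by nlinarith⟩

/-- The angle between the axis of `R₀` and the normal of the mirror of `R₁`. -/
theorem halfturn_cases (D : FlagFrame K o p F R₀ R₁ b l s c x y) :
    2 * s ^ 2 * (1 + x) = 1 ∨ 2 * s ^ 2 * (1 + x) = 2 ∨ 2 * s ^ 2 * (1 + x) = 3 := by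
  obtain ⟨q, hq⟩ := D.rep_one.int_halfturn
  have h0 := D.sq_pos
  have h1 := D.sq_lt_one
  obtain ⟨hl, hu⟩ := D.x_bounds
  have hq' : 2 * s ^ 2 * (1 + x) = q := by rw [← hq]; ring
  have q1 : 0 < q := by have : ((0 : ℤ) : ℝ) < q := by push_cast; rw [← hq']; nlinarith
                        exact_mod_cast this
  have q2 : q < 4 := by have : (q : ℝ) < (4 : ℤ) := by push_cast; rw [← hq']; nlinarith
                        exact_mod_cast this
  interval_cases q <;> push_cast at hq' <;> simp [hq']

theorem inner_bounds {C S x y : ℝ} (h : C ^ 2 + S ^ 2 = 1) (h' : x ^ 2 + y ^ 2 = 1) :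
    -1 ≤ C * x + S * y ∧ C * x + S * y ≤ 1 := by
  constructor <;> nlinarith [sq_nonneg (C - x), sq_nonneg (S - y), sq_nonneg (C + x),
    sq_nonneg (S + y)]

theorem eq_of_inner_eq_one {C S x y : ℝ} (h : C ^ 2 + S ^ 2 = 1) (h' : x ^ 2 + y ^ 2 = 1)
    (h1 : C * x + S * y = 1) : C = x ∧ S = y := by
  have e : (C - x) ^ 2 + (S - y) ^ 2 = 0 := by linear_combination h + h' - 2 * h1
  have e4 : C - x = 0 := by nlinarith [sq_nonneg (C - x), sq_nonneg (S - y)]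
  have e5 : S - y = 0 := by nlinarith [sq_nonneg (C - x), sq_nonneg (S - y)]
  exact ⟨by linarith, by linarith⟩

/-- Here the half-turn condition forces `x = 1`, so `y = 0`, and integrality forces `S = 0` for
every element of `G₂`. Then `G₂` is closed under `S ↦ -S`, which `not_symmetric` forbids. -/
theorem sq_ne_one_quarter (D : FlagFrame K o p F R₀ R₁ b l s c x y) : s ^ 2 ≠ 1 / 4 := by
  intro hs
  obtain ⟨hl, hu⟩ := D.x_bounds
  have hx : x = 1 := by rcases D.halfturn_cases with h | h | h <;> rw [hs] at h <;> linarith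
  have hy : y = 0 := by have := D.xy; rw [hx] at this; nlinarith
  obtain ⟨C, S, ε, h, hn⟩ := D.not_symmetric hy
  have hS : S = 0 := by
    rcases h.sign with rfl | rfl
    · rcases h.rotation_cases with h | h | h | h
      · exact h.2
      · exact h.2.1
      · rcases h.2.2 with h | h <;> rw [hs] at h <;> norm_num at h
      · rw [hs] at h; norm_num at h
    · obtain ⟨k, hk⟩ := h.int_normal
      obtain ⟨hl, hu⟩ := h.bounds
      have hsq := h.sq
      rw [hs] at hk
      have k1 : 0 ≤ k := by have : ((0 : ℤ) : ℝ) ≤ k := by push_cast; linarith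
                            exact_mod_cast this
      have k2 : k ≤ 1 := by have : (k : ℝ) ≤ (1 : ℤ) := by push_cast; linarith
                            exact_mod_cast this
      interval_cases k <;> push_cast at hk
      · have : C = 1 := by linarith
        rw [this] at hsq; nlinarith
      · have : C = -1 := by linarith
        rw [this] at hsq; nlinarith
  rw [hS, neg_zero] at hn
  rw [hS] at h
  exact hn h

/-- `G₂` is generated by the reflections in two perpendicular planes, one of which contains the
axis of `R₀`. -/
theorem sq_eq_three_quarters (hs : s ^ 2 = 3 / 4) : (x = 1 / 3 ∨ x = -1 / 3) ∧
    D.Rep x y (-1) ∧ D.Rep (-x) (-y) (-1) ∧ ∀ C S ε, D.Rep C S ε → (C = 1 ∧ S = 0 ∧ ε = 1) ∨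
      (C = -1 ∧ S = 0 ∧ ε = 1) ∨ (C = x ∧ S = y ∧ ε = -1) ∨ (C = -x ∧ S = -y ∧ ε = -1) := by
  obtain ⟨hl, hu⟩ := D.x_bounds
  have hrot : ∀ C S, D.Rep C S 1 → S = 0 ∧ (C = 1 ∨ C = -1) := by
    intro C S h
    rcases h.rotation_cases with h | h | h | h
    · exact ⟨h.2, Or.inl h.1⟩
    · exact ⟨h.2.1, Or.inr h.1⟩
    · rcases h.2.2 with h | h <;> rw [hs] at h <;> norm_num at h
    · rw [hs] at h; norm_num at h
  have hminus : D.Rep (-1) 0 1 := by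
    obtain ⟨C, S, h, hne⟩ := D.exists_rotation
    obtain ⟨rfl, rfl | rfl⟩ := hrot C S h
    · exact absurd ⟨rfl, rfl⟩ hne
    · exact h
  have hrefl : ∀ C S, D.Rep C S (-1) → C * x + S * y = 1 ∨ C * x + S * y = -1 := by
    intro C S h
    obtain ⟨m, hm⟩ := h.int_reflection
    obtain ⟨k, hk⟩ := h.int_halfturn
    obtain ⟨b1, b2⟩ := inner_bounds h.sq D.xy
    have m1 : -2 ≤ m := by have : ((-2 : ℤ) : ℝ) ≤ m := by push_cast; linarith
                           exact_mod_cast this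
    have m2 : m ≤ 2 := by have : (m : ℝ) ≤ (2 : ℤ) := by push_cast; linarith
                          exact_mod_cast this
    -- With `t = Cx + Sy` the two integers are `m = 2t` and `k = 3/2 (1 + t)`; divisibility by 4
    -- leaves `m = ±2`.
    have hmk : 6 + 3 * m = 4 * k := by
      have : (6 : ℝ) + 3 * m = 4 * k := by rw [← hm, ← hk, hs]; ring
      exact_mod_cast this
    interval_cases m
    · right; push_cast at hm; linarith
    · omega
    · omega
    · omega
    · left; push_cast at hm; linarith
  have hx : x = 1 / 3 ∨ x = -1 / 3 := by
    rcases D.halfturn_cases with h | h | h <;> rw [hs] at h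
    · right; linarith
    · left; linarith
    -- The remaining value `x = 1` would put the reflections on the coordinate axes, making `G₂`
    -- closed under `S ↦ -S`.
    · exfalso
      have hx : x = 1 := by linarith
      have hy : y = 0 := by have := D.xy; rw [hx] at this; nlinarith
      obtain ⟨C, S, ε, h, hn⟩ := D.not_symmetric hy
      have hS : S = 0 := by
        rcases h.sign with rfl | rfl
        · exact (hrot C S h).1
        · have hsq := h.sq
          have := hrefl C S h
          rw [hx, hy] at this
          rcases this with h' | h'
          · have : C = 1 := by linarith
            rw [this] at hsq; nlinarith
          · have : C = -1 := by linarith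
            rw [this] at hsq; nlinarith
      rw [hS, neg_zero] at hn
      rw [hS] at h
      exact hn h
  have hrefl' : ∀ C S, D.Rep C S (-1) → (C = x ∧ S = y) ∨ (C = -x ∧ S = -y) := by
    intro C S h
    rcases hrefl C S h with h' | h'
    · exact Or.inl (eq_of_inner_eq_one h.sq D.xy h')
    · refine Or.inr (eq_of_inner_eq_one h.sq (by linear_combination D.xy) (by linarith))
  have hpair : D.Rep x y (-1) ∧ D.Rep (-x) (-y) (-1) := by
    obtain ⟨C, S, h⟩ := D.exists_reflection hrot
    have h2 := hminus.mul h
    rcases hrefl' C S h with ⟨rfl, rfl⟩ | ⟨rfl, rfl⟩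
    · exact ⟨h, h2.congr (by ring) (by ring) (by ring)⟩
    · exact ⟨h2.congr (by ring) (by ring) (by ring), h⟩
  refine ⟨hx, hpair.1, hpair.2, fun C S ε h => ?_⟩
  rcases h.sign with rfl | rfl
  · obtain ⟨rfl, rfl | rfl⟩ := hrot C S h <;> simp
  · rcases hrefl' C S h with ⟨rfl, rfl⟩ | ⟨rfl, rfl⟩ <;> simp

/-- `G₂` contains the rotations of order three, and possibly the reflections in three planes. -/
theorem sq_eq_thirds (hs : s ^ 2 = 1 / 3 ∨ s ^ 2 = 2 / 3) : x = 1 / 2 ∧ y ^ 2 = 3 / 4 ∧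
    D.Rep (-1 / 2) y 1 ∧ D.Rep (-1 / 2) (-y) 1 ∧
    ((D.Rep 1 0 (-1) ∧ D.Rep (-1 / 2) y (-1) ∧ D.Rep (-1 / 2) (-y) (-1)) ∨
      (s ^ 2 = 2 / 3 ∧ ∀ C S, ¬ D.Rep C S (-1))) ∧
    ∀ C S ε, D.Rep C S ε → (C = 1 ∧ S = 0) ∨ (C = -1 / 2 ∧ S = y) ∨ (C = -1 / 2 ∧ S = -y) := by
  obtain ⟨hl, hu⟩ := D.x_bounds
  have hxy := D.xy
  have hrot : ∀ C S, D.Rep C S 1 → (C = 1 ∧ S = 0) ∨ (C = -1 / 2 ∧ S ^ 2 = 3 / 4) := by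
    intro C S h
    rcases h.rotation_cases with h | h | h | h
    · exact Or.inl h
    · rcases hs with hs | hs <;> rw [hs] at h <;> norm_num at h
    · exact Or.inr ⟨h.1, h.2.1⟩
    · rcases hs with hs | hs <;> rw [hs] at h <;> norm_num at h
  obtain ⟨T, hT, hT2⟩ : ∃ T, D.Rep (-1 / 2) T 1 ∧ T ^ 2 = 3 / 4 := by
    obtain ⟨C, S, h, hne⟩ := D.exists_rotation
    rcases hrot C S h with h' | ⟨rfl, h'⟩
    · exact absurd h' hne
    · exact ⟨S, h, h'⟩
  have hx : x = 1 / 2 := by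
    rcases hs with hs | hs
    · rcases D.halfturn_cases with h | h | h <;> rw [hs] at h <;> linarith
    · rcases D.halfturn_cases with h | h | h <;> rw [hs] at h
      · exfalso
        have hx : x = -1 / 4 := by linarith
        obtain ⟨m, hm⟩ := hT.int_halfturn
        rw [hs, hx] at hm
        rw [hx] at hxy
        -- For `x = -1/4` one gets `m = 3/2 + 4/3 T y` with `T² y² = 45/64`, so 5 would be a perfect
        -- square.
        have hm5 : (2 * m - 3) ^ 2 = (5 : ℤ) := by
          have : (2 * (m : ℝ) - 3) ^ 2 = 5 := by
            rw [← hm]; linear_combination (64 / 9) * y ^ 2 * hT2 + (16 / 3) * hxy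
          exact_mod_cast this
        have m1 : -1 < m := by nlinarith
        have m2 : m < 4 := by nlinarith
        interval_cases m <;> norm_num at hm5
      · linarith
      · linarith
  have hy : y ^ 2 = 3 / 4 := by rw [hx] at hxy; linarith
  have hS : ∀ S : ℝ, S ^ 2 = 3 / 4 → S = y ∨ S = -y := fun S h =>
    sq_eq_sq_iff_eq_or_eq_neg.1 (h.trans hy.symm)
  have hinvT : D.Rep (-1 / 2) (-T) 1 :=
    (hT.mul hT).congr (by linear_combination (-1) * hT2) (by ring) (by ring)
  have hpair : D.Rep (-1 / 2) y 1 ∧ D.Rep (-1 / 2) (-y) 1 := by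
    rcases hS T hT2 with rfl | rfl
    · exact ⟨hT, hinvT⟩
    · exact ⟨by rwa [neg_neg] at hinvT, hT⟩
  have hrefl : ∀ C S, D.Rep C S (-1) →
      (C = 1 ∧ S = 0) ∨ (C = -1 / 2 ∧ S = y) ∨ (C = -1 / 2 ∧ S = -y) := by
    intro C S h
    have hsq := h.sq
    rcases hs with hs | hs
    · obtain ⟨k, hk⟩ := h.int_normal
      obtain ⟨hl, hu⟩ := h.bounds
      rw [hs] at hk
      have k1 : 0 ≤ k := by have : ((0 : ℤ) : ℝ) ≤ k := by push_cast; linarith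
                            exact_mod_cast this
      have k2 : k < 2 := by have : (k : ℝ) < (2 : ℤ) := by push_cast; linarith
                            exact_mod_cast this
      interval_cases k <;> push_cast at hk
      · have : C = 1 := by linarith
        rw [this] at hsq
        exact Or.inl ⟨this, by nlinarith⟩
      · have : C = -1 / 2 := by linarith
        rw [this] at hsq
        rcases hS S (by linarith) with h' | h'
        · exact Or.inr (Or.inl ⟨this, h'⟩)
        · exact Or.inr (Or.inr ⟨this, h'⟩)
    · obtain ⟨m, hm⟩ := h.int_reflection
      obtain ⟨k, hk⟩ := h.int_halfturn
      obtain ⟨b1, b2⟩ := inner_bounds h.sq D.xy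
      have m1 : -2 ≤ m := by have : ((-2 : ℤ) : ℝ) ≤ m := by push_cast; linarith
                             exact_mod_cast this
      have m2 : m ≤ 2 := by have : (m : ℝ) ≤ (2 : ℤ) := by push_cast; linarith
                            exact_mod_cast this
      -- With `t = Cx + Sy` the two integers are `m = 2t` and `k = 4/3 (1 + t)`; divisibility by 3
      -- leaves `m = -2` and `m = 1`.
      have hmk : 4 + 2 * m = 3 * k := by
        have : (4 : ℝ) + 2 * m = 3 * k := by rw [← hm, ← hk, hs]; ring
        exact_mod_cast this
      interval_cases m
      · push_cast at hm
        obtain ⟨e1, e2⟩ := eq_of_inner_eq_one h.sq (x := -x) (y := -y)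
          (by linear_combination D.xy) (by linarith)
        exact Or.inr (Or.inr ⟨by rw [e1, hx]; norm_num, e2⟩)
      · omega
      · omega
      · push_cast at hm
        rw [hx] at hm
        have e1 : S * y = (1 - C) / 2 := by linarith
        have e2 : (1 - C) * (2 * C + 1) = 0 := by
          linear_combination (-3 / 2) * hsq + 2 * (S * y + (1 - C) / 2) * e1 - 2 * S ^ 2 * hy
        rcases mul_eq_zero.1 e2 with e | e
        · have : C = 1 := by linarith
          rw [this] at hsq
          exact Or.inl ⟨this, by nlinarith⟩
        · have hC : C = -1 / 2 := by linarith
          refine Or.inr (Or.inl ⟨hC, ?_⟩)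
          have e3 : (S - y) * y = 0 := by rw [hC] at e1; linarith
          have hy0 : y ≠ 0 := by rintro rfl; norm_num at hy
          have := (mul_eq_zero.1 e3).resolve_right hy0
          linarith
      · omega
  refine ⟨hx, hy, hpair.1, hpair.2, ?_, fun C S ε h => ?_⟩
  · by_cases hex : ∃ C S, D.Rep C S (-1)
    · left
      have h1 : D.Rep 1 0 (-1) := by
        obtain ⟨C, S, h⟩ := hex
        rcases hrefl C S h with ⟨rfl, rfl⟩ | ⟨rfl, rfl⟩ | ⟨rfl, rfl⟩
        · exact h
        · exact (hpair.2.mul h).congr (by linear_combination hy) (by ring) (by ring)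
        · exact (hpair.1.mul h).congr (by linear_combination hy) (by ring) (by ring)
      exact ⟨h1, (hpair.1.mul h1).congr (by ring) (by ring) (by ring),
        (hpair.2.mul h1).congr (by ring) (by ring) (by ring)⟩
    · push Not at hex
      rcases hs with hs | hs
      -- For `s² = 1/3` the rotation of order three satisfies `2s²(1 - C) = 1` and so produces a
      -- reflection; the purely cyclic group survives only for `s² = 2/3`.
      · exact absurd (hT.reflection_of_rotation (by rw [hs]; norm_num)) (hex _ _)
      · exact Or.inr ⟨hs, hex⟩
  · rcases h.sign with rfl | rfl
    · rcases hrot C S h with h' | ⟨h', h2⟩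
      · exact Or.inl h'
      · rcases hS S h2 with h3 | h3
        · exact Or.inr (Or.inl ⟨h', h3⟩)
        · exact Or.inr (Or.inr ⟨h', h3⟩)
    · exact hrefl C S h

/-- `G₂` is a dihedral group of order four or eight. -/
theorem sq_eq_half (hs : s ^ 2 = 1 / 2) : x = 0 ∧ y ^ 2 = 1 ∧
    (∀ C S ε, D.Rep C S ε → (C = 1 ∧ S = 0) ∨ (C = -1 ∧ S = 0) ∨ (C = 0 ∧ S = y) ∨
      (C = 0 ∧ S = -y)) ∧
    ((D.Rep 0 y (-1) ∧ D.Rep (-1) 0 (-1)) ∨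
      (D.Rep (-1) 0 (-1) ∧ D.Rep 1 0 (-1) ∧ ∀ C S ε, D.Rep C S ε → S = 0) ∨
      (D.Rep 0 y (-1) ∧ D.Rep 0 (-y) (-1) ∧
        ∀ C S ε, D.Rep C S ε → (ε = 1 ∧ S = 0) ∨ (ε = -1 ∧ C = 0))) := by
  obtain ⟨hl, hu⟩ := D.x_bounds
  have hxy := D.xy
  have hall : ∀ C S ε, D.Rep C S ε → (C = 1 ∧ S = 0) ∨ (C = -1 ∧ S = 0) ∨ (C = 0 ∧ S ^ 2 = 1) := by
    intro C S ε h
    have hsq := h.sq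
    obtain ⟨k, hk⟩ := h.int_normal
    obtain ⟨hl, hu⟩ := h.bounds
    rw [hs] at hk
    have k1 : 0 ≤ k := by have : ((0 : ℤ) : ℝ) ≤ k := by push_cast; linarith
                          exact_mod_cast this
    have k2 : k ≤ 2 := by have : (k : ℝ) ≤ (2 : ℤ) := by push_cast; linarith
                          exact_mod_cast this
    interval_cases k <;> push_cast at hk
    · have : C = 1 := by linarith
      rw [this] at hsq
      exact Or.inl ⟨this, by nlinarith⟩
    · have : C = 0 := by linarith
      rw [this] at hsq
      exact Or.inr (Or.inr ⟨this, by nlinarith⟩)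
    · have : C = -1 := by linarith
      rw [this] at hsq
      exact Or.inr (Or.inl ⟨this, by nlinarith⟩)
  have hminus : D.Rep (-1) 0 1 := by
    obtain ⟨C, S, h, hne⟩ := D.exists_rotation
    rcases hall C S 1 h with h' | ⟨rfl, rfl⟩ | ⟨rfl, h'⟩
    · exact absurd h' hne
    · exact h
    · exact (h.mul h).congr (by linear_combination (-1) * h') (by ring) (by ring)
  have hneg : ∀ C S ε, D.Rep C S ε → D.Rep (-C) (-S) ε := fun C S ε h =>
    (hminus.mul h).congr (by ring) (by ring) (by ring)
  have hx : x = 0 := by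
    rcases D.halfturn_cases with h | h | h <;> rw [hs] at h
    · linarith
    -- For `x = 1` one has `y = 0`. As `G₂` contains the half-turn and each element has `C = 0` or
    -- `S = 0`, closure under `S ↦ -S` is automatic, which `not_symmetric` forbids.
    · exfalso
      have hx : x = 1 := by linarith
      have hy : y = 0 := by have := D.xy; rw [hx] at this; nlinarith
      obtain ⟨C, S, ε, h, hn⟩ := D.not_symmetric hy
      rcases hall C S ε h with ⟨rfl, rfl⟩ | ⟨rfl, rfl⟩ | ⟨rfl, h'⟩
      · exact hn (by rwa [neg_zero])
      · exact hn (by rwa [neg_zero])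
      · exact hn ((hneg _ _ _ h).congr neg_zero rfl rfl)
    · linarith
  have hy : y ^ 2 = 1 := by rw [hx] at hxy; linarith
  have hall' : ∀ C S ε, D.Rep C S ε → (C = 1 ∧ S = 0) ∨ (C = -1 ∧ S = 0) ∨ (C = 0 ∧ S = y) ∨
      (C = 0 ∧ S = -y) := by
    intro C S ε h
    rcases hall C S ε h with h' | h' | ⟨h', h2⟩
    · exact Or.inl h'
    · exact Or.inr (Or.inl h')
    · rcases sq_eq_sq_iff_eq_or_eq_neg.1 (h2.trans hy.symm) with h3 | h3
      · exact Or.inr (Or.inr (Or.inl ⟨h', h3⟩))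
      · exact Or.inr (Or.inr (Or.inr ⟨h', h3⟩))
  have hy0 : y ≠ 0 := by rintro rfl; norm_num at hy
  have hone : ∀ C S ε, D.Rep C S ε → S = 0 → D.Rep 1 0 ε ∧ D.Rep (-1) 0 ε := by
    intro C S ε h hS
    have h2 := hneg C S ε h
    rcases hall' C S ε h with ⟨rfl, rfl⟩ | ⟨rfl, rfl⟩ | ⟨rfl, rfl⟩ | ⟨rfl, rfl⟩
    · exact ⟨h, h2.congr rfl neg_zero rfl⟩
    · exact ⟨h2.congr (neg_neg _) neg_zero rfl, h⟩
    · exact absurd hS hy0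
    · exact absurd (neg_eq_zero.1 hS) hy0
  have hzero : ∀ C S ε, D.Rep C S ε → C = 0 → D.Rep 0 y ε ∧ D.Rep 0 (-y) ε := by
    intro C S ε h hC
    have h2 := hneg C S ε h
    rcases hall' C S ε h with ⟨rfl, rfl⟩ | ⟨rfl, rfl⟩ | ⟨rfl, rfl⟩ | ⟨rfl, rfl⟩
    · norm_num at hC
    · norm_num at hC
    · exact ⟨h, h2.congr neg_zero rfl rfl⟩
    · exact ⟨h2.congr neg_zero (neg_neg _) rfl, h⟩
  refine ⟨hx, hy, hall', ?_⟩
  -- A quarter turn satisfies `2s²(1 - C) = 1`, so it brings reflections with it and the group has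
  -- order eight. Without one, the product of an axis reflection and a diagonal reflection cannot
  -- occur, so the reflections are all of one kind.
  by_cases hq : ∃ S, D.Rep 0 S 1
  · left
    obtain ⟨S, h⟩ := hq
    have h1 := (hzero 0 S 1 h rfl).1
    have h2 := h1.reflection_of_rotation (by rw [hs]; norm_num)
    refine ⟨h2, ?_⟩
    exact (h1.mul h2).congr (by linear_combination (-1) * hy) (by ring) (by ring)
  · right
    push Not at hq
    have hrot : ∀ C S, D.Rep C S 1 → S = 0 ∧ (C = 1 ∨ C = -1) := by
      intro C S h
      rcases hall' C S 1 h with ⟨rfl, rfl⟩ | ⟨rfl, rfl⟩ | ⟨rfl, rfl⟩ | ⟨rfl, rfl⟩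
      · exact ⟨rfl, Or.inl rfl⟩
      · exact ⟨rfl, Or.inr rfl⟩
      · exact absurd h (hq _)
      · exact absurd h (hq _)
    have hnot : D.Rep 1 0 (-1) → D.Rep 0 y (-1) → False := fun h h' =>
      hq y ((h'.mul h).congr (by ring) (by ring) (by ring))
    obtain ⟨C, S, h⟩ := D.exists_reflection hrot
    have hor : ∀ C S ε, D.Rep C S ε → S = 0 ∨ C = 0 := by
      intro C S ε h
      rcases hall' C S ε h with h | h | h | h
      · exact Or.inl h.2
      · exact Or.inl h.2
      · exact Or.inr h.1
      · exact Or.inr h.1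
    rcases hor C S _ h with hS | hC
    · left
      obtain ⟨h1, h2⟩ := hone C S _ h hS
      refine ⟨h2, h1, fun C' S' ε' h' => ?_⟩
      rcases h'.sign with rfl | rfl
      · exact (hrot _ _ h').1
      · exact (hor _ _ _ h').resolve_right fun hC' => hnot h1 (hzero _ _ _ h' hC').1
    · right
      obtain ⟨h1, h2⟩ := hzero C S _ h hC
      refine ⟨h1, h2, fun C' S' ε' h' => ?_⟩
      rcases h'.sign with rfl | rfl
      · exact Or.inl ⟨rfl, (hrot _ _ h').1⟩
      · exact Or.inr ⟨rfl, (hor _ _ _ h').resolve_left fun hS' => hnot (hone _ _ _ h' hS').1 h1⟩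

theorem sq_cases (D : FlagFrame K o p F R₀ R₁ b l s c x y) :
    s ^ 2 = 1 / 2 ∨ s ^ 2 = 3 / 4 ∨ s ^ 2 = 1 / 3 ∨ s ^ 2 = 2 / 3 := by
  obtain ⟨C, S, h, hne⟩ := D.exists_rotation
  have := D.sq_ne_one_quarter
  rcases h.rotation_cases with h | ⟨-, -, h⟩ | ⟨-, -, h⟩ | ⟨-, -, h⟩
  · exact absurd h hne
  all_goals tauto

end FlagFrame

/-! ### Recognizing a complex from its generators -/

/-- A similarity taking an orthonormal basis at `o` to given orthogonal vectors of equal length. -/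
theorem exists_dilation (b : OrthonormalBasis (Fin 3) ℝ E3) (o : E3) {w : Fin 3 → E3} {ρ : ℝ}
    (hρ : ρ ≠ 0) (hw : ∀ i j, inner ℝ (w i) (w j) = if i = j then ρ ^ 2 else 0) :
    ∃ (f : E3 ≃ᵈ E3) (Φ : E3 →ₗ[ℝ] E3), (∀ z, f z = Φ (z - o)) ∧ ∀ i, Φ (b i) = w i := by
  have horth : Orthonormal ℝ ((Set.univ : Set (Fin 3)).domRestrict fun i => ρ⁻¹ • w i) := by
    rw [orthonormal_iff_ite]
    rintro ⟨i, hi⟩ ⟨j, hj⟩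
    have : inner ℝ (ρ⁻¹ • w i) (ρ⁻¹ • w j) = if i = j then (1 : ℝ) else 0 := by
      rw [real_inner_smul_left, real_inner_smul_right, hw]
      split_ifs
      · field_simp
      · ring
    simpa [Set.domRestrict] using this
  obtain ⟨b', hb'⟩ := horth.exists_orthonormalBasis_extension_of_card_eq (by simp)
  set Q : E3 ≃ₗᵢ[ℝ] E3 := b.equiv b' (Equiv.refl _)
  set g : Isom3 := (AffineIsometryEquiv.constVAdd ℝ E3 (-o)).trans Q.toAffineIsometryEquiv
  refine ⟨g.toIsometryEquiv.toDilationEquiv.trans (DilationEquiv.smulTorsor (0 : E3) hρ),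
    ρ • (Q.toLinearEquiv : E3 →ₗ[ℝ] E3), fun z => ?_, fun i => ?_⟩
  · have : g z = Q (z - o) := by
      change Q (-o +ᵥ z) = _
      rw [vadd_eq_add, neg_add_eq_sub]
    change ρ • (g z) +ᵥ (0 : E3) = ρ • Q (z - o)
    rw [this, vadd_eq_add, add_zero]
  · change ρ • Q (b i) = w i
    have hQ : Q (b i) = b' i := by simp [Q]
    rw [hQ, hb' i (Set.mem_univ _), smul_smul, mul_inv_cancel₀ hρ, one_smul]

/-- The isometry `h` fixes the origin and `e 2`, and acts on the plane of the orthogonal vectors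
`e 0` and `e 1`, whose squared lengths have the ratio `κ`, as a rotation or reflection taking `e 0`
to `C • e 0 + k • e 1`. -/
structure ScaledForm (e : Fin 3 → E3) (κ : ℝ) (h : Isom3) (C k ε : ℝ) : Prop where
  sign : ε = 1 ∨ ε = -1
  fix : h 0 = 0
  map_zero : 𝓛 h (e 0) = C • e 0 + k • e 1
  map_one : 𝓛 h (e 1) = (-(ε * k * κ)) • e 0 + (ε * C) • e 1
  map_two : 𝓛 h (e 2) = e 2

namespace ScaledForm

variable {e : Fin 3 → E3} {κ : ℝ} {h h' : Isom3} {C k ε C' k' ε' : ℝ}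

theorem one : ScaledForm e κ 1 1 0 1 :=
  ⟨Or.inl rfl, rfl, by change e 0 = _; simp, by change e 1 = _; simp, rfl⟩

theorem mul (H : ScaledForm e κ h C k ε) (H' : ScaledForm e κ h' C' k' ε') :
    ScaledForm e κ (h * h') (C * C' - ε * κ * k * k') (k * C' + ε * C * k') (ε * ε') := by
  refine ⟨?_, ?_, ?_, ?_, ?_⟩
  · rcases H.sign with rfl | rfl <;> rcases H'.sign with rfl | rfl <;> norm_num
  · rw [isom_mul_apply, H'.fix, H.fix]
  · rw [lin_mul, H'.map_zero]
    simp only [_root_.map_add, _root_.map_smul, H.map_zero, H.map_one]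
    module
  · rw [lin_mul, H'.map_one]
    simp only [_root_.map_add, _root_.map_smul, H.map_zero, H.map_one]
    rcases H.sign with rfl | rfl <;> module
  · rw [lin_mul, H'.map_two, H.map_two]

theorem congr (H : ScaledForm e κ h C k ε) (hC : C = C') (hk : k = k') (hε : ε = ε') :
    ScaledForm e κ h C' k' ε' := by
  rw [← hC, ← hk, ← hε]; exact H

theorem of_apply (hε : ε = 1 ∨ ε = -1) (h0 : h 0 = 0) (he0 : h (e 0) = C • e 0 + k • e 1)
    (he1 : h (e 1) = (-(ε * k * κ)) • e 0 + (ε * C) • e 1) (he2 : h (e 2) = e 2) :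
    ScaledForm e κ h C k ε := by
  have hl : ∀ z, 𝓛 h z = h z := fun z => by
    have := lin_sub h z 0
    rwa [sub_zero, h0, sub_zero] at this
  exact ⟨hε, h0, by rw [hl, he0], by rw [hl, he1], by rw [hl, he2]⟩

end ScaledForm

/-- The generators `R₀`, `R₁` described in terms of an orthogonal frame at the origin. -/
structure GeneratorFrame (R₀ R₁ : Isom3) (e : Fin 3 → E3) (σ x : ℝ) : Prop where
  ne_zero : e 2 ≠ 0
  inner_zero_one : inner ℝ (e 0) (e 1) = (0 : ℝ)
  inner_zero_two : inner ℝ (e 0) (e 2) = (0 : ℝ)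
  inner_one_two : inner ℝ (e 1) (e 2) = (0 : ℝ)
  inner_zero : (1 - σ) * inner ℝ (e 0) (e 0) = σ * inner ℝ (e 2) (e 2)
  inner_one : inner ℝ (e 1) (e 1) = (1 - x ^ 2) * inner ℝ (e 0) (e 0)
  R₀_origin : R₀ 0 = e 2
  R₀_zero : R₀ (e 0) = x • e 0 + e 1 + e 2
  R₀_one : R₀ (e 1) = (1 - x ^ 2) • e 0 - x • e 1 + e 2
  R₀_two : R₀ (e 2) = 0
  R₁_origin : R₁ 0 = 0
  R₁_zero : R₁ (e 0) = (1 - 2 * σ) • e 0 - (2 * σ) • e 2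
  R₁_one : R₁ (e 1) = e 1
  R₁_two : R₁ (e 2) = (2 * σ - 1) • e 2 - (2 * (1 - σ)) • e 0

/-- The vectors `e 0`, `e 1`, `e 2` correspond to `b 0`, `b 1`, `b 2` rescaled by `ls/c`, `lsy/c`
and `l`. In this frame the generators depend only on `s²`, `x` and the quotients `k = S/y`, so
square roots and the sign of `y` disappear. The similarity matching the two frames intertwines the
generators, and `wythoff_map` concludes. -/
theorem FlagFrame.similar {K : PolygonalFigure} {o p : E3} {F : Set (Sym2 E3)} {R₀ R₁ : Isom3}
    {b : OrthonormalBasis (Fin 3) ℝ E3} {l s c x y : ℝ} (D : FlagFrame K o p F R₀ R₁ b l s c x y)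
    (hy : y ≠ 0) {R₀' R₁' : Isom3} {S' : Set Isom3} {e : Fin 3 → E3}
    (E : GeneratorFrame R₀' R₁' e (s ^ 2) x)
    (hS : ∀ C S ε, D.Rep C S ε → ∃ h ∈ closure S', ∃ k, S = k * y ∧
      ScaledForm e (1 - x ^ 2) h C k ε)
    (hS' : ∀ h ∈ S', ∃ C k ε, D.Rep C (k * y) ε ∧ ScaledForm e (1 - x ^ 2) h C k ε) :
    K.Similar (wythoff R₀' R₁' S' 0) := by
  have hl := D.l_ne
  have hs := D.s_ne
  have hc := D.c_ne
  have hsc := D.sc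
  have hxy := D.xy
  have hκ : 1 - x ^ 2 = y ^ 2 := by linarith
  set ρ := l⁻¹ * ‖e 2‖ with hρ
  have hρ0 : ρ ≠ 0 := mul_ne_zero (inv_ne_zero hl) (norm_ne_zero_iff.2 E.ne_zero)
  set N := inner ℝ (e 2) (e 2) with hN
  have hρ2 : l ^ 2 * ρ ^ 2 = N := by
    rw [hN, hρ, real_inner_self_eq_norm_sq]; field_simp
  have h00 : inner ℝ (e 0) (e 0) = s ^ 2 / c ^ 2 * N := by
    have := E.inner_zero
    rw [show 1 - s ^ 2 = c ^ 2 by linarith] at this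
    field_simp
    linarith
  have h11 : inner ℝ (e 1) (e 1) = y ^ 2 * (s ^ 2 / c ^ 2 * N) := by rw [E.inner_one, h00, hκ]
  have c10 : inner ℝ (e 1) (e 0) = (0 : ℝ) := by rw [real_inner_comm]; exact E.inner_zero_one
  have c20 : inner ℝ (e 2) (e 0) = (0 : ℝ) := by rw [real_inner_comm]; exact E.inner_zero_two
  have c21 : inner ℝ (e 2) (e 1) = (0 : ℝ) := by rw [real_inner_comm]; exact E.inner_one_two
  -- These are the images of the orthonormal basis; the inner products in `E` make them orthogonal
  -- of common length `|ρ|`.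
  set w : Fin 3 → E3 := ![(c / (l * s)) • e 0, (c / (l * s * y)) • e 1, l⁻¹ • e 2] with hw
  have hw0 : w 0 = (c / (l * s)) • e 0 := rfl
  have hw1 : w 1 = (c / (l * s * y)) • e 1 := rfl
  have hw2 : w 2 = l⁻¹ • e 2 := rfl
  obtain ⟨f, Φ, hf, hΦ⟩ := exists_dilation b o (w := w) hρ0 (by
    intro i j
    fin_cases i <;> fin_cases j <;>
      simp only [Fin.zero_eta, Fin.mk_one, Fin.reduceFinMk, hw0, hw1, hw2, real_inner_smul_left,
        real_inner_smul_right, E.inner_zero_one, E.inner_zero_two, E.inner_one_two, c10, c20, c21,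
        h00, h11, mul_zero, Fin.reduceEq, if_true, if_false, ← hN]
    · rw [← hρ2]; field_simp
    · rw [← hρ2]; field_simp
    · rw [← hρ2]; field_simp)
  have hitw : ∀ g h : Isom3, Φ (g o - o) = h 0 → (∀ i, Φ (𝓛 g (b i)) = 𝓛 h (w i)) →
      Intertwines f g h := by
    intro g h h0 hb z
    have hlin : ∀ z, Φ (𝓛 g z) = 𝓛 h (Φ z) := by
      intro z
      rw [basis_sum b z]
      simp only [map_add, map_smul, hb, hΦ]
    rw [hf, hf, isom_apply_eq g o z, isom_apply_eq h 0, sub_zero, ← hlin, ← h0, add_sub_assoc,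
      map_add]
  have hle : ∀ i, 𝓛 R₀' (e i) = R₀' (e i) - e 2 := fun i => by
    have := lin_sub R₀' (e i) 0
    rwa [sub_zero, E.R₀_origin] at this
  have hle1 : ∀ i, 𝓛 R₁' (e i) = R₁' (e i) := fun i => by
    have := lin_sub R₁' (e i) 0
    rwa [sub_zero, E.R₁_origin, sub_zero] at this
  have i0 : Intertwines f R₀ R₀' := by
    refine hitw _ _ ?_ fun i => ?_
    · rw [D.R₀_o, D.p_eq, map_smul, hΦ, hw2, smul_smul, mul_inv_cancel₀ hl, one_smul, E.R₀_origin]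
    · fin_cases i
      · change Φ (𝓛 R₀ (b 0)) = 𝓛 R₀' (w 0)
        rw [D.lin_R₀_zero, hw0, map_smul, hle, E.R₀_zero, map_add, map_smul, map_smul, hΦ, hΦ, hw0,
          hw1]
        match_scalars <;> field_simp
        ring
      · change Φ (𝓛 R₀ (b 1)) = 𝓛 R₀' (w 1)
        rw [D.lin_R₀_one, hw1, map_smul, hle, E.R₀_one, map_sub, map_smul, map_smul, hΦ, hΦ, hw0,
          hw1, hκ]
        match_scalars <;> field_simp
        ring
      · change Φ (𝓛 R₀ (b 2)) = 𝓛 R₀' (w 2)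
        rw [D.lin_R₀_two, hw2, map_smul, hle, E.R₀_two, map_neg, hΦ, hw2]
        module
  have i1 : Intertwines f R₁ R₁' := by
    refine hitw _ _ ?_ fun i => ?_
    · rw [D.R₁_o, sub_self, map_zero, E.R₁_origin]
    · have hc2 : 1 - s ^ 2 = c ^ 2 := by linarith
      fin_cases i
      · change Φ (𝓛 R₁ (b 0)) = 𝓛 R₁' (w 0)
        rw [D.lin_R₁, hw0, map_smul, hle1, E.R₁_zero]
        simp only [inner_add_left, real_inner_smul_left, basis_inner, Fin.reduceEq, if_true,
          if_false, map_sub, map_smul, map_add, hΦ, hw0, hw2]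
        match_scalars <;> field_simp <;> ring
      · change Φ (𝓛 R₁ (b 1)) = 𝓛 R₁' (w 1)
        rw [D.lin_R₁, hw1, map_smul, hle1, E.R₁_one]
        simp only [inner_add_left, real_inner_smul_left, basis_inner, Fin.reduceEq,
          if_false, mul_zero, add_zero, zero_smul, sub_zero, hΦ, hw1]
      · change Φ (𝓛 R₁ (b 2)) = 𝓛 R₁' (w 2)
        rw [D.lin_R₁, hw2, map_smul, hle1, E.R₁_two, hc2,
          show 2 * s ^ 2 - 1 = 1 - 2 * c ^ 2 by linarith]
        simp only [inner_add_left, real_inner_smul_left, basis_inner, Fin.reduceEq, if_true,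
          if_false, map_sub, map_smul, map_add, hΦ, hw0, hw2]
        match_scalars <;> field_simp <;> ring
  have i2 : ∀ g ∈ K.G2 (o, s(o, p), F), ∀ h C k ε, PlaneForm b (𝓛 g) C (k * y) ε →
      ScaledForm e (1 - x ^ 2) h C k ε → Intertwines f g h := by
    intro g hg h C k ε hg' hh
    refine hitw _ _ ?_ fun i => ?_
    · rw [(D.mem_G2.1 hg).2.1, sub_self, map_zero, hh.fix]
    · fin_cases i
      · change Φ (𝓛 g (b 0)) = 𝓛 h (w 0)
        rw [hg'.map_zero, hw0, map_smul, hh.map_zero, map_add, map_smul, map_smul, hΦ, hΦ, hw0, hw1]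
        match_scalars <;> field_simp
      · change Φ (𝓛 g (b 1)) = 𝓛 h (w 1)
        rw [hg'.map_one, hw1, map_smul, hh.map_one, map_add, map_smul, map_smul, hΦ, hΦ, hw0, hw1,
          hκ]
        match_scalars <;> field_simp
      · change Φ (𝓛 g (b 2)) = 𝓛 h (w 2)
        rw [hg'.map_two, hw2, map_smul, hh.map_two, hΦ, hw2]
  refine ⟨f, ?_⟩
  conv_lhs => rw [D.eq_wythoff]
  refine wythoff_map (by rw [hf, sub_self, map_zero]) i0 i1 (fun g hg => ?_) fun h hh => ?_
  · obtain ⟨C, S, ε, -, hform⟩ := D.exists_form hg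
    obtain ⟨h, hh, k, rfl, hk⟩ := hS C S ε ⟨g, hg, hform⟩
    exact ⟨h, hh, i2 g hg h C k ε hform hk⟩
  · obtain ⟨C, k, ε, ⟨g, hg, hform⟩, hk⟩ := hS' h hh
    exact ⟨g, subset_closure hg, i2 g hg h C k ε hform hk⟩

/-! ### The classification -/

namespace K12

theorem swap_apply_other : Equiv.swap (0 : Fin 3) 1 2 = 2 ∧ Equiv.swap (0 : Fin 3) 2 1 = 1 ∧
    Equiv.swap (1 : Fin 3) 2 0 = 0 := by decide

/-- Frames at the origin adapted to the generators of the complexes. -/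
noncomputable def frame (a : ℝ) : Fin 8 → Fin 3 → E3
  | 0 => ![!₂[a, -2 * a, -a], !₂[-4 / 3 * a, -4 / 3 * a, 4 / 3 * a], !₂[a, 0, a]]
  | 1 => ![!₂[-a, -2 * a, -a], !₂[-3 / 2 * a, 0, 3 / 2 * a], !₂[a, -a, a]]
  | 2 => ![!₂[-a, -2 * a, -a], !₂[-3 / 2 * a, 0, 3 / 2 * a], !₂[a, -a, a]]
  | 6 => ![!₂[a / 2, -a / 2, -a], !₂[3 / 4 * a, 3 / 4 * a, 0], !₂[a, -a, a]]
  | 7 => ![!₂[a, -2 * a, -a], !₂[4 / 3 * a, 4 / 3 * a, -4 / 3 * a], !₂[a, 0, a]]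
  | _ => ![!₂[-a, 0, 0], !₂[0, 0, a], !₂[0, a, 0]]

variable {a : ℝ}

theorem generatorFrame_zero (ha : a ≠ 0) :
    GeneratorFrame (genR0 a 0) (genR1 0) (frame a 0) (3 / 4) (1 / 3) := by
  constructor
  case ne_zero => exact fun h => ha (by simpa [frame] using congrArg (fun v : E3 => v 0) h)
  case R₀_origin | R₀_zero | R₀_one | R₀_two | R₁_origin | R₁_zero | R₁_one | R₁_two =>
    ext j
    fin_cases j <;> simp [frame, genR0, genR1, signedPerm_apply, swap_apply_other] <;> ring1
  all_goals
    rw [inner_E3]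
    try rw [inner_E3]
    simp [frame]
    try ring1

theorem generatorFrame_one (ha : a ≠ 0) :
    GeneratorFrame (genR0 a 1) (genR1 1) (frame a 1) (2 / 3) (1 / 2) := by
  constructor
  case ne_zero => exact fun h => ha (by simpa [frame] using congrArg (fun v : E3 => v 0) h)
  case R₀_origin | R₀_zero | R₀_one | R₀_two | R₁_origin | R₁_zero | R₁_one | R₁_two =>
    ext j
    fin_cases j <;> simp [frame, genR0, genR1, signedPerm_apply, swap_apply_other] <;> ring1
  all_goals
    rw [inner_E3]
    try rw [inner_E3]
    simp [frame]
    try ring1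

theorem generatorFrame_three (ha : a ≠ 0) :
    GeneratorFrame (genR0 a 3) (genR1 3) (frame a 3) (1 / 2) (0) := by
  constructor
  case ne_zero => exact fun h => ha (by simpa [frame] using congrArg (fun v : E3 => v 1) h)
  case R₀_origin | R₀_zero | R₀_one | R₀_two | R₁_origin | R₁_zero | R₁_one | R₁_two =>
    ext j
    fin_cases j <;> simp [frame, genR0, genR1, signedPerm_apply, swap_apply_other] <;> ring1
  all_goals
    rw [inner_E3]
    try rw [inner_E3]
    simp [frame]
    try (left; norm_num)

theorem generatorFrame_six (ha : a ≠ 0) :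
    GeneratorFrame (genR0 a 6) (genR1 6) (frame a 6) (1 / 3) (1 / 2) := by
  constructor
  case ne_zero => exact fun h => ha (by simpa [frame] using congrArg (fun v : E3 => v 0) h)
  case R₀_origin | R₀_zero | R₀_one | R₀_two | R₁_origin | R₁_zero | R₁_one | R₁_two =>
    ext j
    fin_cases j <;> simp [frame, genR0, genR1, signedPerm_apply, swap_apply_other] <;>
      first | ring1 | (left; ring1)
  all_goals
    rw [inner_E3]
    try rw [inner_E3]
    simp [frame]
    try ring1

theorem generatorFrame_seven (ha : a ≠ 0) :
    GeneratorFrame (genR0 a 7) (genR1 7) (frame a 7) (3 / 4) (-1 / 3) := by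
  constructor
  case ne_zero => exact fun h => ha (by simpa [frame] using congrArg (fun v : E3 => v 0) h)
  case R₀_origin | R₀_zero | R₀_one | R₀_two | R₁_origin | R₁_zero | R₁_one | R₁_two =>
    ext j
    fin_cases j <;> simp [frame, genR0, genR1, signedPerm_apply, swap_apply_other] <;> ring1
  all_goals
    rw [inner_E3]
    try rw [inner_E3]
    simp [frame]
    try ring1

theorem scaledForm_three_fst :
    ScaledForm (frame a 3) (1) (signedPerm (Equiv.swap 0 2) ![-1, 1, -1] 0) 0 1 (-1) := by
  refine ScaledForm.of_apply (by norm_num) ?_ ?_ ?_ ?_ <;> ext j <;> fin_cases j <;>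
    simp [frame, signedPerm_apply, swap_apply_other]

theorem scaledForm_three_snd :
    ScaledForm (frame a 3) (1) (signedPerm (Equiv.swap 0 2) ![1, 1, 1] 0) 0 (-1) (-1) := by
  refine ScaledForm.of_apply (by norm_num) ?_ ?_ ?_ ?_ <;> ext j <;> fin_cases j <;>
    simp [frame, signedPerm_apply, swap_apply_other]

theorem scaledForm_four_fst :
    ScaledForm (frame a 4) (1) (signedPerm 1 ![-1, 1, 1] 0) (-1) 0 (-1) := by
  refine ScaledForm.of_apply (by norm_num) ?_ ?_ ?_ ?_ <;> ext j <;> fin_cases j <;>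
    simp [frame, signedPerm_apply]

theorem scaledForm_four_snd : ScaledForm (frame a 4) (1) (signedPerm 1 ![1, 1, -1] 0) 1 0 (-1) := by
  refine ScaledForm.of_apply (by norm_num) ?_ ?_ ?_ ?_ <;> ext j <;> fin_cases j <;>
    simp [frame, signedPerm_apply]

theorem scaledForm_zero_fst :
    ScaledForm (frame a 0) (8 / 9) (signedPerm (Equiv.swap 0 2) ![1, 1, 1] 0) (1 / 3) 1 (-1) := by
  refine ScaledForm.of_apply (by norm_num) ?_ ?_ ?_ ?_ <;> ext j <;> fin_cases j <;>
    simp [frame, signedPerm_apply, swap_apply_other] <;> ring1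

theorem scaledForm_zero_snd :
    ScaledForm (frame a 0) (8 / 9) (signedPerm 1 ![1, -1, 1] 0) (-(1 / 3)) (-1) (-1) := by
  refine ScaledForm.of_apply (by norm_num) ?_ ?_ ?_ ?_ <;> ext j <;> fin_cases j <;>
    simp [frame, signedPerm_apply] <;> ring1

theorem scaledForm_seven_fst :
    ScaledForm (frame a 7) (8 / 9) (signedPerm 1 ![1, -1, 1] 0) (-1 / 3) 1 (-1) := by
  refine ScaledForm.of_apply (by norm_num) ?_ ?_ ?_ ?_ <;> ext j <;> fin_cases j <;>
    simp [frame, signedPerm_apply] <;> ring1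

theorem scaledForm_seven_snd :
    ScaledForm (frame a 7) (8 / 9) (signedPerm (Equiv.swap 0 2) ![1, 1, 1] 0)
      (-(-1 / 3)) (-1) (-1) := by
  refine ScaledForm.of_apply (by norm_num) ?_ ?_ ?_ ?_ <;> ext j <;> fin_cases j <;>
    simp [frame, signedPerm_apply, swap_apply_other] <;> ring1

theorem scaledForm_one :
    ScaledForm (frame a 1) (3 / 4) (signedPerm (finRotate 3) ![-1, -1, 1] 0) (-1 / 2) (-1) (1) := by
  refine ScaledForm.of_apply (by norm_num) ?_ ?_ ?_ ?_ <;> ext j <;> fin_cases j <;>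
    simp [frame, signedPerm_apply] <;> ring1

theorem scaledForm_two_fst :
    ScaledForm (frame a 2) (3 / 4) (signedPerm (Equiv.swap 0 1) ![-1, -1, 1] 0)
      (-1 / 2) (-1) (-1) := by
  refine ScaledForm.of_apply (by norm_num) ?_ ?_ ?_ ?_ <;> ext j <;> fin_cases j <;>
    simp [frame, signedPerm_apply, swap_apply_other] <;> ring1

theorem scaledForm_two_snd :
    ScaledForm (frame a 2) (3 / 4) (signedPerm (Equiv.swap 1 2) ![1, -1, -1] 0)
      (-1 / 2) 1 (-1) := by
  refine ScaledForm.of_apply (by norm_num) ?_ ?_ ?_ ?_ <;> ext j <;> fin_cases j <;>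
    simp [frame, signedPerm_apply, swap_apply_other] <;> ring1

theorem scaledForm_six_fst :
    ScaledForm (frame a 6) (3 / 4) (signedPerm (Equiv.swap 0 1) ![-1, -1, 1] 0) 1 0 (-1) := by
  refine ScaledForm.of_apply (by norm_num) ?_ ?_ ?_ ?_ <;> ext j <;> fin_cases j <;>
    simp [frame, signedPerm_apply, swap_apply_other] <;> ring1

theorem scaledForm_six_snd :
    ScaledForm (frame a 6) (3 / 4) (signedPerm (Equiv.swap 1 2) ![1, -1, -1] 0)
      (-1 / 2) 1 (-1) := by
  refine ScaledForm.of_apply (by norm_num) ?_ ?_ ?_ ?_ <;> ext j <;> fin_cases j <;>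
    simp [frame, signedPerm_apply, swap_apply_other] <;> ring1

end K12

/-! ### Matching each possible group `G₂` with its model -/

namespace FlagFrame

variable {K : PolygonalFigure} {o p : E3} {F : Set (Sym2 E3)} {R₀ R₁ : Isom3}
  {b : OrthonormalBasis (Fin 3) ℝ E3} {l s c x y : ℝ} (D : FlagFrame K o p F R₀ R₁ b l s c x y)
  {R₀' R₁' h₁ h₂ : Isom3} {e : Fin 3 → E3}

include D

theorem similar_of_three_quarters (hs : s ^ 2 = 3 / 4) (E : GeneratorFrame R₀' R₁' e (3 / 4) x)
    (H₁ : ScaledForm e (8 / 9) h₁ x 1 (-1)) (H₂ : ScaledForm e (8 / 9) h₂ (-x) (-1) (-1)) :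
    K.Similar (wythoff R₀' R₁' {h₁, h₂} 0) := by
  obtain ⟨hx, r1, r2, hall⟩ := sq_eq_three_quarters (D := D) hs
  have hκ : 1 - x ^ 2 = 8 / 9 := by rcases hx with rfl | rfl <;> norm_num
  have hy : y ≠ 0 := by rintro rfl; have := D.xy; linarith
  have m1 : h₁ ∈ closure ({h₁, h₂} : Set Isom3) := subset_closure (by simp)
  have m2 : h₂ ∈ closure ({h₁, h₂} : Set Isom3) := subset_closure (by simp)
  refine D.similar hy (hs ▸ E) ?_ ?_ <;> rw [hκ]
  · intro C S ε h
    rcases hall C S ε h with ⟨rfl, rfl, rfl⟩ | ⟨rfl, rfl, rfl⟩ | ⟨rfl, rfl, rfl⟩ | ⟨rfl, rfl, rfl⟩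
    · exact ⟨1, one_mem _, 0, by ring, ScaledForm.one⟩
    · exact ⟨_, mul_mem m1 m2, 0, by ring,
        (H₁.mul H₂).congr (by linear_combination hκ) (by ring) (by ring)⟩
    · exact ⟨_, m1, 1, by ring, H₁⟩
    · exact ⟨_, m2, -1, by ring, H₂⟩
  · rintro h (rfl | rfl)
    · exact ⟨_, _, _, r1.congr rfl (by ring) rfl, H₁⟩
    · exact ⟨_, _, _, r2.congr rfl (by ring) rfl, H₂⟩

theorem similar_of_cyclic_three (hs : s ^ 2 = 2 / 3) (hno : ∀ C S, ¬ D.Rep C S (-1))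
    (E : GeneratorFrame R₀' R₁' e (2 / 3) (1 / 2)) (H₁ : ScaledForm e (3 / 4) h₁ (-1 / 2) (-1) 1) :
    K.Similar (wythoff R₀' R₁' {h₁} 0) := by
  obtain ⟨hx, hy2, r1, r2, -, hall⟩ := sq_eq_thirds (D := D) (Or.inr hs)
  have hκ : 1 - x ^ 2 = 3 / 4 := by rw [hx]; norm_num
  have hy : y ≠ 0 := by rintro rfl; norm_num at hy2
  have m1 : h₁ ∈ closure ({h₁} : Set Isom3) := subset_closure (by simp)
  refine D.similar hy (by rw [hs, hx]; exact E) ?_ ?_ <;> rw [hκ]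
  · intro C S ε h
    obtain rfl : ε = 1 := h.sign.resolve_right (by rintro rfl; exact hno _ _ h)
    rcases hall C S 1 h with ⟨rfl, rfl⟩ | ⟨rfl, rfl⟩ | ⟨rfl, rfl⟩
    · exact ⟨1, one_mem _, 0, by ring, ScaledForm.one⟩
    · exact ⟨_, mul_mem m1 m1, 1, by ring, (H₁.mul H₁).congr (by ring) (by ring) (by ring)⟩
    · exact ⟨_, m1, -1, by ring, H₁⟩
  · rintro h rfl
    exact ⟨_, _, _, r2.congr rfl (by ring) rfl, H₁⟩

/-- Both dihedral cases of order six are covered: it suffices that the model's generators yield the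
two rotations of order three and one reflection fixing `e 0`, since the other reflections are
products of these. -/
theorem similar_of_dihedral_three (hs : s ^ 2 = 1 / 3 ∨ s ^ 2 = 2 / 3) {S' : Set Isom3}
    (hr : D.Rep 1 0 (-1)) (E : GeneratorFrame R₀' R₁' e (s ^ 2) (1 / 2))
    (H : ∀ k : ℝ, k = 1 ∨ k = -1 → ∃ h ∈ closure S', ScaledForm e (3 / 4) h (-1 / 2) k 1)
    {h₀ : Isom3} (hh₀ : h₀ ∈ closure S') (H₀ : ScaledForm e (3 / 4) h₀ 1 0 (-1))
    (HS : ∀ h ∈ S', ScaledForm e (3 / 4) h 1 0 (-1) ∨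
      ∃ k : ℝ, (k = 1 ∨ k = -1) ∧ ScaledForm e (3 / 4) h (-1 / 2) k (-1)) :
    K.Similar (wythoff R₀' R₁' S' 0) := by
  obtain ⟨hx, hy2, r1, r2, -, hall⟩ := sq_eq_thirds (D := D) hs
  have hκ : 1 - x ^ 2 = 3 / 4 := by rw [hx]; norm_num
  have hy : y ≠ 0 := by rintro rfl; norm_num at hy2
  have hrot : ∀ k : ℝ, k = 1 ∨ k = -1 → D.Rep (-1 / 2) (k * y) 1 := by
    rintro k (rfl | rfl)
    · rwa [one_mul]
    · rwa [neg_one_mul]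
  refine D.similar hy (by rw [hx]; exact E) ?_ ?_ <;> rw [hκ]
  · intro C S ε h
    have hk : (C = 1 ∧ S = 0) ∨ ∃ k : ℝ, (k = 1 ∨ k = -1) ∧ C = -1 / 2 ∧ S = k * y := by
      rcases hall C S ε h with h | ⟨h, h'⟩ | ⟨h, h'⟩
      · exact Or.inl h
      · exact Or.inr ⟨1, Or.inl rfl, h, by rw [h']; ring⟩
      · exact Or.inr ⟨-1, Or.inr rfl, h, by rw [h']; ring⟩
    rcases hk with ⟨rfl, rfl⟩ | ⟨k, hk, rfl, rfl⟩
    · rcases h.sign with rfl | rfl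
      · exact ⟨1, one_mem _, 0, by ring, ScaledForm.one⟩
      · exact ⟨h₀, hh₀, 0, by ring, H₀⟩
    · obtain ⟨g, hg, Hg⟩ := H k hk
      rcases h.sign with rfl | rfl
      · exact ⟨g, hg, k, rfl, Hg⟩
      · exact ⟨_, mul_mem hg hh₀, k, rfl, (Hg.mul H₀).congr (by ring) (by ring) (by ring)⟩
  · intro h hh
    rcases HS h hh with H | ⟨k, hk, H⟩
    · exact ⟨_, _, _, hr.congr rfl (by ring) rfl, H⟩
    · exact ⟨_, _, _, ((hrot k hk).mul hr).congr (by ring) (by ring) (by ring), H⟩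

/-- The cases, with indices in `Fin 8`: `s² = 1/2` gives 5 when `G₂` has order eight, 4 when its
reflections have `S = 0`, and 3 when they have `C = 0`; `s² = 3/4` gives 0 for `x = 1/3` and 7 for
`x = -1/3`; `s² = 1/3` gives 6; `s² = 2/3` gives 2 or 1, according to whether `G₂` contains
reflections. -/
theorem similar_complexK12 {a : ℝ} (ha : a ≠ 0) : ∃ i : Fin 8, K.Similar (complexK12 i a) := by
  rcases D.sq_cases with hs | hs | hs
  · obtain ⟨hx, hy2, hall, hcase⟩ := sq_eq_half (D := D) hs
    have hκ : 1 - x ^ 2 = 1 := by rw [hx]; norm_num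
    have hy : y ≠ 0 := by rintro rfl; norm_num at hy2
    have E : GeneratorFrame (genR0 a 3) (genR1 3) (K12.frame a 3) (s ^ 2) x := by
      rw [hs, hx]; exact K12.generatorFrame_three ha
    rcases hcase with ⟨q1, q2⟩ | ⟨q1, q2, hS⟩ | ⟨q1, q2, hS⟩
    · refine ⟨5, D.similar (S' := genG2 5) hy E ?_ ?_⟩ <;> rw [hκ]
      · have m1 := subset_closure (show signedPerm (Equiv.swap 0 2) ![-1, 1, -1] 0 ∈ genG2 5 from
          Or.inl rfl)
        have m2 := subset_closure (show signedPerm 1 ![-1, 1, 1] 0 ∈ genG2 5 from Or.inr rfl)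
        have H1 := K12.scaledForm_three_fst (a := a)
        have H2 := K12.scaledForm_four_fst (a := a)
        intro C S ε h
        rcases hall C S ε h with ⟨rfl, rfl⟩ | ⟨rfl, rfl⟩ | ⟨rfl, rfl⟩ | ⟨rfl, rfl⟩ <;>
          rcases h.sign with rfl | rfl
        · exact ⟨1, one_mem _, 0, by ring, ScaledForm.one⟩
        · exact ⟨_, mul_mem (mul_mem m1 m2) m1, 0, by ring,
            ((H1.mul H2).mul H1).congr (by ring) (by ring) (by ring)⟩
        · exact ⟨_, mul_mem (mul_mem (mul_mem m1 m2) m1) m2, 0, by ring,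
            (((H1.mul H2).mul H1).mul H2).congr (by ring) (by ring) (by ring)⟩
        · exact ⟨_, m2, 0, by ring, H2⟩
        · exact ⟨_, mul_mem m2 m1, 1, by ring, (H2.mul H1).congr (by ring) (by ring) (by ring)⟩
        · exact ⟨_, m1, 1, by ring, H1⟩
        · exact ⟨_, mul_mem m1 m2, -1, by ring, (H1.mul H2).congr (by ring) (by ring) (by ring)⟩
        · exact ⟨_, mul_mem (mul_mem m2 m1) m2, -1, by ring,
            ((H2.mul H1).mul H2).congr (by ring) (by ring) (by ring)⟩
      · rintro h (rfl | rfl)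
        · exact ⟨_, _, _, q1.congr rfl (by ring) rfl, K12.scaledForm_three_fst⟩
        · exact ⟨_, _, _, q2.congr rfl (by ring) rfl, K12.scaledForm_four_fst⟩
    · refine ⟨4, D.similar (S' := genG2 4) hy E ?_ ?_⟩ <;> rw [hκ]
      · have m1 := subset_closure (show signedPerm 1 ![-1, 1, 1] 0 ∈ genG2 4 from Or.inl rfl)
        have m2 := subset_closure (show signedPerm 1 ![1, 1, -1] 0 ∈ genG2 4 from Or.inr rfl)
        have H1 := K12.scaledForm_four_fst (a := a)
        have H2 := K12.scaledForm_four_snd (a := a)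
        intro C S ε h
        obtain rfl := hS C S ε h
        have hC : C = 1 ∨ C = -1 := mul_self_eq_one_iff.1 (by linear_combination h.sq)
        rcases hC with rfl | rfl <;> rcases h.sign with rfl | rfl
        · exact ⟨1, one_mem _, 0, by ring, ScaledForm.one⟩
        · exact ⟨_, m2, 0, by ring, H2⟩
        · exact ⟨_, mul_mem m1 m2, 0, by ring, (H1.mul H2).congr (by ring) (by ring) (by ring)⟩
        · exact ⟨_, m1, 0, by ring, H1⟩
      · rintro h (rfl | rfl)
        · exact ⟨_, _, _, q1.congr rfl (by ring) rfl, K12.scaledForm_four_fst⟩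
        · exact ⟨_, _, _, q2.congr rfl (by ring) rfl, K12.scaledForm_four_snd⟩
    · refine ⟨3, D.similar (S' := genG2 3) hy E ?_ ?_⟩ <;> rw [hκ]
      · have m1 := subset_closure (show signedPerm (Equiv.swap 0 2) ![-1, 1, -1] 0 ∈ genG2 3 from
          Or.inl rfl)
        have m2 := subset_closure (show signedPerm (Equiv.swap 0 2) ![1, 1, 1] 0 ∈ genG2 3 from
          Or.inr rfl)
        have H1 := K12.scaledForm_three_fst (a := a)
        have H2 := K12.scaledForm_three_snd (a := a)
        intro C S ε h
        rcases hS C S ε h with ⟨rfl, rfl⟩ | ⟨rfl, rfl⟩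
        · have hC : C = 1 ∨ C = -1 := mul_self_eq_one_iff.1 (by linear_combination h.sq)
          rcases hC with rfl | rfl
          · exact ⟨1, one_mem _, 0, by ring, ScaledForm.one⟩
          · exact ⟨_, mul_mem m1 m2, 0, by ring, (H1.mul H2).congr (by ring) (by ring) (by ring)⟩
        · have hS : S = y ∨ S = -y :=
            sq_eq_sq_iff_eq_or_eq_neg.1 (by linear_combination h.sq - hy2)
          rcases hS with rfl | rfl
          · exact ⟨_, m1, 1, by ring, H1⟩
          · exact ⟨_, m2, -1, by ring, H2⟩
      · rintro h (rfl | rfl)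
        · exact ⟨_, _, _, q1.congr rfl (by ring) rfl, K12.scaledForm_three_fst⟩
        · exact ⟨_, _, _, q2.congr rfl (by ring) rfl, K12.scaledForm_three_snd⟩
  · obtain ⟨hx, -⟩ := sq_eq_three_quarters (D := D) hs
    rcases hx with rfl | rfl
    · exact ⟨0, D.similar_of_three_quarters hs (K12.generatorFrame_zero ha) K12.scaledForm_zero_fst
        K12.scaledForm_zero_snd⟩
    · exact ⟨7, D.similar_of_three_quarters hs (K12.generatorFrame_seven ha)
        K12.scaledForm_seven_fst K12.scaledForm_seven_snd⟩
  · obtain ⟨-, -, -, -, hrefl, -⟩ := sq_eq_thirds (D := D) hs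
    rcases hrefl with ⟨hr, -, -⟩ | ⟨hs, hno⟩
    · rcases hs with hs | hs
      · have m1 := subset_closure (show signedPerm (Equiv.swap 0 1) ![-1, -1, 1] 0 ∈ genG2 6 from
          Or.inl rfl)
        have m2 := subset_closure (show signedPerm (Equiv.swap 1 2) ![1, -1, -1] 0 ∈ genG2 6 from
          Or.inr rfl)
        have H1 := K12.scaledForm_six_fst (a := a)
        have H2 := K12.scaledForm_six_snd (a := a)
        refine ⟨6, D.similar_of_dihedral_three (Or.inl hs) (S' := genG2 6) hr
          (by rw [hs]; exact K12.generatorFrame_six ha) ?_ m1 H1 ?_⟩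
        · rintro k (rfl | rfl)
          · exact ⟨_, mul_mem m2 m1, (H2.mul H1).congr (by ring) (by ring) (by ring)⟩
          · exact ⟨_, mul_mem m1 m2, (H1.mul H2).congr (by ring) (by ring) (by ring)⟩
        · rintro h (rfl | rfl)
          · exact Or.inl H1
          · exact Or.inr ⟨1, Or.inl rfl, H2⟩
      · have m1 := subset_closure (show signedPerm (Equiv.swap 0 1) ![-1, -1, 1] 0 ∈ genG2 2 from
          Or.inl rfl)
        have m2 := subset_closure (show signedPerm (Equiv.swap 1 2) ![1, -1, -1] 0 ∈ genG2 2 from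
          Or.inr rfl)
        have H1 := K12.scaledForm_two_fst (a := a)
        have H2 := K12.scaledForm_two_snd (a := a)
        refine ⟨2, D.similar_of_dihedral_three (Or.inr hs) (S' := genG2 2) hr
          (by rw [hs]; exact K12.generatorFrame_one ha) ?_ (mul_mem (mul_mem m1 m2) m1)
          (((H1.mul H2).mul H1).congr (by ring) (by ring) (by ring)) ?_⟩
        · rintro k (rfl | rfl)
          · exact ⟨_, mul_mem m1 m2, (H1.mul H2).congr (by ring) (by ring) (by ring)⟩
          · exact ⟨_, mul_mem m2 m1, (H2.mul H1).congr (by ring) (by ring) (by ring)⟩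
        · rintro h (rfl | rfl)
          · exact Or.inr ⟨-1, Or.inr rfl, H1⟩
          · exact Or.inr ⟨1, Or.inl rfl, H2⟩
    · exact ⟨1, D.similar_of_cyclic_three hs hno (K12.generatorFrame_one ha) K12.scaledForm_one⟩

end FlagFrame

/-- Every non-polyhedral simply flag-transitive complex with finite faces and mirror vector `(1, 2)`
is similar to one of the eight. -/
theorem exists_similar_complexK12 {a : ℝ} (ha : a ≠ 0) {K : PolygonalFigure}
    (hK : K.IsSimplyFlagTransitive) (hfin : K.HasFiniteFaces) (hm : K.HasMirrorVector 1 2)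
    (hp : ¬ K.IsPolyhedron) : ∃ i : Fin 8, K.Similar (complexK12 i a) := by
  obtain ⟨o, p, F, R₀, R₁, D⟩ := exists_flagData hK hfin hm hp
  obtain ⟨b, l, s, c, x, y, D⟩ := D.exists_frame
  exact D.similar_complexK12 ha

theorem theorem6 :
    -- each of the eight complexes is of the required kind, and its symmetry group is the group
    -- generated by the given isometries, with the octahedral group as special group
    (∀ (i : Fin 8) (a : ℝ), a ≠ 0 →
      (complexK12 i a).IsSimplyFlagTransitive ∧
      (complexK12 i a).HasFiniteFaces ∧
      (complexK12 i a).HasMirrorVector 1 2 ∧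
      ¬ (complexK12 i a).IsPolyhedron ∧
      (complexK12 i a).symmetryGroup =
        Subgroup.closure ({genR0 a i, genR1 i} ∪ genG2 i) ∧
      baseFlagK12 i a ∈ (complexK12 i a).flags ∧
      (complexK12 i a).G0 (baseFlagK12 i a) = Subgroup.zpowers (genR0 a i) ∧
      (complexK12 i a).G1 (baseFlagK12 i a) = Subgroup.zpowers (genR1 i) ∧
      (complexK12 i a).G2 (baseFlagK12 i a) = Subgroup.closure (genG2 i) ∧
      specialGroup (complexK12 i a).symmetryGroup = octahedralGroup) ∧
    -- they are pairwise non-similar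
    (∀ (i j : Fin 8) (a b : ℝ), a ≠ 0 → b ≠ 0 → i ≠ j →
      ¬ (complexK12 i a).Similar (complexK12 j b)) ∧
    -- there are no others
    (∀ (a : ℝ), a ≠ 0 → ∀ K : PolygonalFigure,
      K.IsSimplyFlagTransitive → K.HasFiniteFaces → K.HasMirrorVector 1 2 → ¬ K.IsPolyhedron →
      ∃ i : Fin 8, K.Similar (complexK12 i a)) := by
  exact ⟨K12.complexK12_spec, fun i j a b ha hb hij => K12.not_similar ha hb hij,
    fun a ha K hK hfin hm hp => exists_similar_complexK12 ha hK hfin hm hp⟩
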